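/- A genus one curve over a field $k$ is a smooth, proper (equivalently, projective), geometrically integral curve $C$ over $k$ with $\dim_k H^0(C,\Omega_{C/k})=1$; it is not required to have a $k$-rational point. Its index is the greatest common divisor of the degrees $[\kappa(x):k]$ of its closed points $x$. A collection $\mathcal{C}$ of varieties, over possibly different ground fields, satisfies uniform potential density if there is a constant $d_{\mathcal{C}}$ such that every $X/k\in\mathcal{C}$ admits a finite extension $L/k$ with $[L:k]\le d_{\mathcal{C}}$ for which $X(L)$ is Zariski dense in $X_L$. Proposition 3.1. The collection of all genus one curves over number fields does not satisfy uniform potential density. Moreover, there are genus one curves over number fields of arbitrarily large index: for every $N$ there exist a number field $k$ and a genus one curve over $k$ whose index is at least $N$. -/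

import Mathlib

open AlgebraicGeometry CategoryTheory Limits

noncomputable section

namespace PotentialDensity

universe u

variable {k : Type u} [Field k] {X : Scheme.{u}}

/-! ### Differential forms and the genus of a curve -/

/-- The ring `Γ(X, U)` of functions on an open `U` of a `k`-scheme `f : X ⟶ Spec k`, as a type that
remembers `f`, so that it can carry the `k`-algebra structure given by `f`. -/
def SectionRing (_f : X ⟶ Spec (.of k)) (U : X.Opens) : Type u := Γ(X, U)

instance (f : X ⟶ Spec (.of k)) (U : X.Opens) : CommRing (SectionRing f U) :=
  inferInstanceAs (CommRing Γ(X, U))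

theorem le_preimage_top (f : X ⟶ Spec (.of k)) (U : X.Opens) : U ≤ f ⁻¹ᵁ ⊤ := fun _ _ ↦ trivial

/-- The structure map `k → Γ(Spec k, ⊤) → Γ(X, U)`. -/
def structureHom (f : X ⟶ Spec (.of k)) (U : X.Opens) : k →+* SectionRing f U :=
  ((Scheme.ΓSpecIso (.of k)).inv ≫ f.appLE ⊤ U (le_preimage_top f U)).hom

instance (f : X ⟶ Spec (.of k)) (U : X.Opens) : Algebra k (SectionRing f U) :=
  (structureHom f U).toAlgebra

/-- Restriction of functions `Γ(X, U) → Γ(X, V)` for `V ≤ U`, as a map of `k`-algebras. -/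
def restrictFunctions (f : X ⟶ Spec (.of k)) {U V : X.Opens} (h : V ≤ U) :
    SectionRing f U →ₐ[k] SectionRing f V where
  toRingHom := (X.presheaf.map (homOfLE h).op).hom
  commutes' r := by
    have h₁ := f.appLE_map (le_preimage_top f U) (homOfLE h).op
    exact congr(($h₁).hom ((Scheme.ΓSpecIso (.of k)).inv.hom r))

/-- Restriction of Kähler differentials, `a db ↦ a|_V d(b|_V)`. -/
def restrictDifferentials (f : X ⟶ Spec (.of k)) {U V : X.Opens} (h : V ≤ U) :
    Ω[SectionRing f U⁄k] →ₗ[k] Ω[SectionRing f V⁄k] :=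
  letI : Algebra (SectionRing f U) (SectionRing f V) := (restrictFunctions f h).toRingHom.toAlgebra
  haveI : IsScalarTower k (SectionRing f U) (SectionRing f V) :=
    IsScalarTower.of_algebraMap_eq fun r ↦ ((restrictFunctions f h).commutes r).symm
  (KaehlerDifferential.map k k (SectionRing f U) (SectionRing f V)).restrictScalars k

/-- The `k`-vector space `H⁰(X, Ω_{X/k})` of global differential forms. Since the sections of
`Ω_{X/k}` over an affine open `U` are the Kähler differentials of `Γ(X, U)` over `k`, a global
section is a family of Kähler differentials on the affine opens compatible with restriction. -/
def globalDifferentials (f : X ⟶ Spec (.of k)) :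
    Submodule k (∀ U : X.affineOpens, Ω[SectionRing f U.1⁄k]) where
  carrier := {ω | ∀ (U V : X.affineOpens) (h : V.1 ≤ U.1), restrictDifferentials f h (ω U) = ω V}
  zero_mem' U V h := map_zero _
  add_mem' {ω η} hω hη U V h := by
    rw [Pi.add_apply, map_add, hω U V h, hη U V h, Pi.add_apply]
  smul_mem' c ω hω U V h := by
    rw [Pi.smul_apply, map_smul, hω U V h, Pi.smul_apply]

/-- The genus `dim_k H⁰(X, Ω_{X/k})`, for a smooth proper geometrically integral curve `X`. -/
def genus (f : X ⟶ Spec (.of k)) : ℕ := Module.finrank k (globalDifferentials f)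

/-- `f : X ⟶ Spec k` is a (smooth, proper, geometrically integral) curve of genus one. A proper
curve over a field is projective. -/
structure IsGenusOneCurve (f : X ⟶ Spec (.of k)) : Prop where
  isProper : IsProper f
  geometricallyIntegral : GeometricallyIntegral f
  smooth : SmoothOfRelativeDimension 1 f
  genus_eq_one : genus f = 1

/-! ### Closed points and the index -/

/-- The degree `[κ(x) : k]` of a point `x` of a `k`-scheme. -/
def pointDegree (f : X ⟶ Spec (.of k)) (x : X) : ℕ :=
  letI : Algebra k (X.residueField x) :=
    (Spec.preimage (X.fromSpecResidueField x ≫ f)).hom.toAlgebra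
  Module.finrank k (X.residueField x)

/-- `n` is the index of `X`: the greatest common divisor of the degrees of its closed points. -/
def HasIndex (f : X ⟶ Spec (.of k)) (n : ℕ) : Prop :=
  (∀ x : X, IsClosed {x} → n ∣ pointDegree f x) ∧
    ∀ m : ℕ, (∀ x : X, IsClosed {x} → m ∣ pointDegree f x) → m ∣ n

/-! ### Uniform potential density -/

/-- The set of `k`-rational points of `f : X ⟶ Spec k`, that is, the points of `X` in the image of
a section of `f`. -/
def rationalPoints (f : X ⟶ Spec (.of k)) : Set X :=
  {x | ∃ s : Spec (.of k) ⟶ X, s ≫ f = 𝟙 _ ∧ x ∈ Set.range s}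

/-- The structure morphism of the base change `X_L ⟶ Spec L` of `f : X ⟶ Spec k`. -/
abbrev baseChange (f : X ⟶ Spec (.of k)) (L : Type u) [Field L] [Algebra k L] :
    pullback f (Spec.map (CommRingCat.ofHom (algebraMap k L))) ⟶ Spec (.of L) :=
  pullback.snd f (Spec.map (CommRingCat.ofHom (algebraMap k L)))

/-- A collection `C` of varieties (over varying ground fields) satisfies uniform potential density
if there is a constant `d` such that every member `X/k` of `C` has an extension `L/k` of degree at
most `d` such that `X(L)` is Zariski dense in `X_L`. -/
def UniformPotentialDensity
    (C : ∀ (k : Type u) [Field k] (X : Scheme.{u}), (X ⟶ Spec (.of k)) → Prop) : Prop :=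
  ∃ d : ℕ, ∀ (k : Type u) [Field k] (X : Scheme.{u}) (f : X ⟶ Spec (.of k)), C k X f →
    ∃ (L : Type u) (_ : Field L) (_ : Algebra k L),
      FiniteDimensional k L ∧ Module.finrank k L ≤ d ∧ Dense (rationalPoints (baseChange f L))

/-- The collection of all genus one curves over number fields. -/
def GenusOneCurvesOverNumberFields (k : Type u) [Field k] (X : Scheme.{u})
    (f : X ⟶ Spec (.of k)) : Prop :=
  NumberField k ∧ IsGenusOneCurve f

end PotentialDensity

end

/-! It suffices to construct, for each `r ≠ 0`, a genus one curve over a number field `k` such that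
a point over an extension `F/k` forces `2 ^ r ∣ [F : k]` (`exists_genusOneCurve`). All degrees of
points are then divisible by `2 ^ r`, so the index is at least `2 ^ r`; and density of the points
over a field `L` of degree at most `d` would give an `L`-point, which is absurd once `2 ^ r > d`.

Put `n = 2 ^ r`. The curve is a twist of an unramified cyclic cover. Suppose a quartic `P` admits a
Pell identity `A² - P B² = 1` with `deg A = n`. On the genus one curve `y² = P(x)` the function `A +
B y` is then a unit away from infinity, and its divisor is `n` times the difference of the two
points at infinity. Hence `z ^ n = c (A + B y)` is unramified over that curve, and its smooth
projective model has genus one whenever it is geometrically irreducible.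

Arithmetic enters through the choice of `c`. Let `v` be a prime of `k` at which `2` and the nonzero
coefficients of `A` are units, and let `c` be a uniformizer at `v`. For a point over `F` and a place
`w` of `F` above `v`, the elements `f = A + B y` and `f⁻¹ = A - B y` satisfy `f + f⁻¹ = 2 A(x)`. If
`x` is `w`-integral, `f` is a `w`-unit; otherwise `w f` is `w x ^ n` or its inverse. So `w c` is an
`n`-th power, that is, `n` divides the ramification index of `w` (`dvd_finrank_of_hasPoint`). Since
`[F : k]` is the sum of the products of ramification and inertia degrees, `n` divides it.

The Pell identity comes from torsion on `y² = x³ - x`. A point `(p, q)` with `2 ^ r (p, q) = (0, 0)`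
yields a function whose norm is a constant times `(x - p) ^ n x` (`exists_polynomial_solution`).
Moving `x = p` to infinity turns the norm identity into `D₁ a₁² - D₂ b₁² = c`; squaring gives a Pell
identity for `P = D₁ D₂` (`exists_pell`). It also shows that `A - 1` and `A + 1` are, up to
constants, `D₂` and `D₁` times squares, so they have roots of odd multiplicity; this makes the cover
geometrically irreducible (`irreducible_coverPolynomial`). All the data descend from
`AlgebraicClosure ℚ` to a number field.

The projective model is glued by hand from two affine charts inside the function field
(`CoverData`). On each chart `dx / 2y` generates the differentials, and the two generators agree up
to sign on the overlap. This gives smoothness, and genus one because global functions are constants.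
-/

noncomputable section

namespace PotentialDensity

universe u

open scoped TensorProduct

set_option linter.unusedSectionVars false

/-! ### Gluing two schemes along an open subscheme -/
section Pushout
variable {U Y Z : Scheme.{u}} (f : U ⟶ Y) (g : U ⟶ Z) [IsOpenImmersion f] [IsOpenImmersion g]

instance isOpenImmersion_pushout_inl : IsOpenImmersion (pushout.inl f g) :=
  inferInstanceAs (IsOpenImmersion (colimit.ι (span f g) WalkingSpan.left))

instance isOpenImmersion_pushout_inr : IsOpenImmersion (pushout.inr f g) :=
  inferInstanceAs (IsOpenImmersion (colimit.ι (span f g) WalkingSpan.right))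

theorem pushout_jointly_surjective (x : ↑(pushout f g)) :
    (∃ y, pushout.inl f g y = x) ∨ ∃ z, pushout.inr f g z = x := by
  obtain ⟨i, xi, rfl⟩ := Scheme.IsLocallyDirected.ι_jointly_surjective (span f g) x
  match i with
  | WalkingSpan.zero =>
    exact .inl ⟨f xi, congr($(colimit.w (span f g) WalkingSpan.Hom.fst) xi)⟩
  | WalkingSpan.left => exact .inl ⟨xi, rfl⟩
  | WalkingSpan.right => exact .inr ⟨xi, rfl⟩

theorem exists_of_pushout_inl_eq_inr {y : Y} {z : Z} (h : pushout.inl f g y = pushout.inr f g z) :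
    ∃ u, f u = y ∧ g u = z := by
  obtain ⟨k, fi, fj, x, hx, hx'⟩ := (Scheme.IsLocallyDirected.ι_eq_ι_iff (span f g)
    (i := WalkingSpan.left) (j := WalkingSpan.right)).mp h
  match k with
  | WalkingSpan.zero =>
    obtain rfl : fi = WalkingSpan.Hom.fst := Subsingleton.elim _ _
    obtain rfl : fj = WalkingSpan.Hom.snd := Subsingleton.elim _ _
    exact ⟨x, hx, hx'⟩
  | WalkingSpan.left => nomatch fj
  | WalkingSpan.right => nomatch fi

/-- The comparison map from `U` to the fibre product is an open immersion, and it is surjective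
because the two charts are identified only along `U`. -/
theorem isPullback_pushout : IsPullback f g (pushout.inl f g) (pushout.inr f g) := by
  let l : U ⟶ pullback (pushout.inl f g) (pushout.inr f g) := pullback.lift f g pushout.condition
  have hl : l ≫ pullback.fst _ _ = f := pullback.lift_fst _ _ _
  have hl' : l ≫ pullback.snd _ _ = g := pullback.lift_snd _ _ _
  have : IsOpenImmersion (l ≫ pullback.fst (pushout.inl f g) (pushout.inr f g)) := by
    rw [hl]; infer_instance
  have : IsOpenImmersion l := .of_comp _ (pullback.fst (pushout.inl f g) (pushout.inr f g))
  have : Surjective l := ⟨fun p ↦ by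
    obtain ⟨u, hu, -⟩ := exists_of_pushout_inl_eq_inr f g
      (y := pullback.fst (pushout.inl f g) (pushout.inr f g) p)
      (z := pullback.snd (pushout.inl f g) (pushout.inr f g) p) (by
        rw [← Scheme.Hom.comp_apply, ← Scheme.Hom.comp_apply, pullback.condition])
    refine ⟨u, (pullback.fst (pushout.inl f g) (pushout.inr f g)).isOpenEmbedding.injective ?_⟩
    rw [← Scheme.Hom.comp_apply, hl, hu]⟩
  have : Epi l.base := (TopCat.epi_iff_surjective _).mpr l.surjective
  have : IsIso l := IsOpenImmersion.isIso l
  exact IsPullback.of_iso_pullback ⟨pushout.condition⟩ (asIso l) hl hl'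

end Pushout

/-! ### Schemes covered by two open subschemes -/
section Pair
variable {X Y Z : Scheme.{u}} (i : Y ⟶ X) (j : Z ⟶ X) [IsOpenImmersion i] [IsOpenImmersion j]

/-- The open cover of a scheme given by two open immersions. -/
def pairCover (h : ∀ x : X, (∃ y, i y = x) ∨ ∃ z, j z = x) : X.OpenCover where
  I₀ := Bool
  X b := match b with
    | false => Y
    | true => Z
  f b := match b with
    | false => i
    | true => j
  mem₀ := by
    rw [Scheme.presieve₀_mem_precoverage_iff]
    refine ⟨fun x ↦ ?_, ?_⟩
    · rcases h x with ⟨y, hy⟩ | ⟨z, hz⟩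
      exacts [⟨false, y, hy⟩, ⟨true, z, hz⟩]
    · rintro (_ | _)
      exacts [‹IsOpenImmersion i›, ‹IsOpenImmersion j›]

/-- Reducedness is local. For irreducibility, two irreducible open sets that meet are each dense in
their union. -/
theorem isIntegral_of_pair [IsIntegral Y] [IsIntegral Z]
    (h : ∀ x : X, (∃ y, i y = x) ∨ ∃ z, j z = x) (y : Y) (z : Z) (hyz : i y = j z) :
    IsIntegral X := by
  have hY : IsIrreducible (Set.range i) := by
    rw [← Set.image_univ]
    exact (IrreducibleSpace.isIrreducible_univ Y).image _ i.continuous.continuousOn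
  have hZ : IsIrreducible (Set.range j) := by
    rw [← Set.image_univ]
    exact (IrreducibleSpace.isIrreducible_univ Z).image _ j.continuous.continuousOn
  have hd : closure (Set.range i) = Set.univ := by
    refine Set.eq_univ_of_forall fun x ↦ ?_
    rcases h x with hx | hx
    · exact subset_closure hx
    · exact closure_mono Set.inter_subset_right
        (subset_closure_inter_of_isPreirreducible_of_isOpen hZ.2 i.isOpenEmbedding.isOpen_range
          ⟨j z, ⟨z, rfl⟩, ⟨y, hyz⟩⟩ hx)
  have h₁ : IrreducibleSpace X := by
    have := hd ▸ hY.closure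
    exact (irreducibleSpace_def X).mpr this
  have h₂ : IsReduced X := by
    have : ∀ b, IsReduced ((pairCover i j h).X b) := by
      rintro (_ | _)
      exacts [inferInstanceAs (IsReduced Y), inferInstanceAs (IsReduced Z)]
    exact IsReduced.of_openCover X (pairCover i j h)
  exact isIntegral_of_irreducibleSpace_of_isReduced X

/-- Over the product of two charts the diagonal becomes `Spec O ⟶ Spec (A ⊗ B)`, so surjectivity of
`A ⊗ B → O` makes it a closed immersion. This is the mixed piece of the separatedness check; the
unmixed pieces are multiplication maps. -/
theorem isClosedImmersion_pullback_map_diagonal {S A B O : Type u} [CommRing S] [CommRing A]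
    [CommRing B] [CommRing O] [Algebra S A] [Algebra S B] [Algebra S O]
    (p : A →ₐ[S] O) (q : B →ₐ[S] O)
    (i : Spec (.of A) ⟶ X) (j : Spec (.of B) ⟶ X) (f : X ⟶ Spec (.of S))
    (hi : i ≫ f = Spec.map (CommRingCat.ofHom (algebraMap S A)))
    (hj : j ≫ f = Spec.map (CommRingCat.ofHom (algebraMap S B)))
    (hpb : IsPullback (Spec.map (CommRingCat.ofHom p.toRingHom))
      (Spec.map (CommRingCat.ofHom q.toRingHom)) i j)
    (hs : Function.Surjective (Algebra.TensorProduct.lift p q (fun _ _ ↦ .all _ _))) :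
    IsClosedImmersion (pullback.snd (pullback.diagonal f) (pullback.map (i ≫ f) (j ≫ f) f f i j
      (𝟙 _) (Category.comp_id _) (Category.comp_id _))) := by
  refine (MorphismProperty.cancel_left_of_respectsIso (P := @IsClosedImmersion)
    (f := (pullbackDiagonalMapIdIso i j f).inv) _).mp ?_
  let e₁ : pullback (i ≫ f) (j ≫ f) ≅ Spec (.of <| TensorProduct S A B) :=
    pullback.congrHom hi hj ≪≫ pullbackSpecIso S A B
  let e₂ : pullback i j ≅ Spec (.of O) := hpb.isoPullback.symm
  rw [← MorphismProperty.cancel_right_of_respectsIso (P := @IsClosedImmersion) _ e₁.hom,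
    ← MorphismProperty.cancel_left_of_respectsIso (P := @IsClosedImmersion) e₂.inv]
  let F : TensorProduct S A B →+* O :=
    (Algebra.TensorProduct.lift p q (fun _ _ ↦ .all _ _)).toRingHom
  have key := IsClosedImmersion.spec_of_surjective (CommRingCat.ofHom F) hs
  convert! key using 1
  rw [← cancel_mono (pullbackSpecIso ..).inv]
  apply pullback.hom_ext
  · simp only [Iso.trans_hom, pullback.congrHom_hom, Category.assoc, Iso.hom_inv_id,
      Category.comp_id, pullbackSpecIso_inv_fst,
      ← Spec.map_comp, e₁]
    erw [pullback.lift_fst]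
    rw [Category.comp_id]
    erw [pullbackDiagonalMapIdIso_inv_snd_fst]
    rw [show e₂.inv ≫ pullback.fst i j = Spec.map (CommRingCat.ofHom p.toRingHom) from
      hpb.isoPullback_hom_fst]
    congr 1
    ext x : 2
    exact DFunLike.congr_fun (Algebra.TensorProduct.lift_comp_includeLeft p q
      (fun _ _ ↦ .all _ _)).symm x
  · simp only [Iso.trans_hom, pullback.congrHom_hom, Category.assoc, Iso.hom_inv_id,
      Category.comp_id, pullbackSpecIso_inv_snd,
      ← Spec.map_comp, e₁]
    erw [pullback.lift_snd]
    rw [Category.comp_id]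
    erw [pullbackDiagonalMapIdIso_inv_snd_snd]
    rw [show e₂.inv ≫ pullback.snd i j = Spec.map (CommRingCat.ofHom q.toRingHom) from
      hpb.isoPullback_hom_snd]
    congr 1
    ext x : 2
    exact DFunLike.congr_fun (Algebra.TensorProduct.lift_comp_includeRight p q
      (fun _ _ ↦ .all _ _)).symm x

theorem isSeparated_of_pair {S : Type u} [CommRing S] {A B O : Type u} [CommRing A] [CommRing B]
    [CommRing O] [Algebra S A] [Algebra S B] [Algebra S O]  (p : A →ₐ[S] O) (q : B →ₐ[S] O)
    (i : Spec (.of A) ⟶ X) (j : Spec (.of B) ⟶ X) [IsOpenImmersion i] [IsOpenImmersion j]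
    (h : ∀ x : X, (∃ y, i y = x) ∨ ∃ z, j z = x) (f : X ⟶ Spec (.of S))
    (hi : i ≫ f = Spec.map (CommRingCat.ofHom (algebraMap S A)))
    (hj : j ≫ f = Spec.map (CommRingCat.ofHom (algebraMap S B)))
    (hpb : IsPullback (Spec.map (CommRingCat.ofHom p.toRingHom))
      (Spec.map (CommRingCat.ofHom q.toRingHom)) i j)
    (hs : Function.Surjective (Algebra.TensorProduct.lift p q (fun _ _ ↦ .all _ _))) :
    IsSeparated f := by
  refine ⟨IsZariskiLocalAtTarget.of_openCover (Scheme.Pullback.openCoverOfLeftRight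
    (pairCover i j h) (pairCover i j h) f f) ?_⟩
  have hid {A : Type u} [CommRing A] [Algebra S A] : Function.Surjective
      (Algebra.TensorProduct.lift (AlgHom.id S A) (AlgHom.id S A) (fun _ _ ↦ .all _ _)) :=
    fun a ↦ ⟨a ⊗ₜ[S] 1, by simp⟩
  have hpid {A : Type u} [CommRing A] [Algebra S A] (l : Spec (.of A) ⟶ X) [Mono l] :
      IsPullback (Spec.map (CommRingCat.ofHom (AlgHom.id S A).toRingHom))
        (Spec.map (CommRingCat.ofHom (AlgHom.id S A).toRingHom)) l l := by
    have : Spec.map (CommRingCat.ofHom (AlgHom.id S A).toRingHom) = 𝟙 _ := Spec.map_id _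
    rw [this]
    exact IsKernelPair.id_of_mono l
  have hs' : Function.Surjective (Algebra.TensorProduct.lift q p (fun _ _ ↦ .all _ _)) := by
    intro o
    obtain ⟨t, rfl⟩ := hs o
    refine ⟨Algebra.TensorProduct.comm S A B t, ?_⟩
    induction t with
    | zero => simp
    | add a b ha hb => rw [map_add, map_add, ha, hb, map_add]
    | tmul a b => simp [mul_comm]
  rintro ⟨_ | _, _ | _⟩
  · exact isClosedImmersion_pullback_map_diagonal _ _ i i f hi hi (hpid i) hid
  · exact isClosedImmersion_pullback_map_diagonal p q i j f hi hj hpb hs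
  · exact isClosedImmersion_pullback_map_diagonal q p j i f hj hi hpb.flip hs'
  · exact isClosedImmersion_pullback_map_diagonal _ _ j j f hj hj (hpid j) hid

end Pair

/-! ### Gluing two affine schemes over a field -/
section Glue

/-- A valuation ring is integrally closed: once `x` lands in `R`, so does `k[x]`, and with it
everything integral over `k[x]`. -/
theorem mem_range_of_isIntegral_adjoin {k A R F : Type u} [Field k] [CommRing A] [Algebra k A]
    [CommRing R] [IsDomain R] [ValuationRing R] [Field F] [Algebra R F] [IsFractionRing R F]
    (g : k →+* R) (φ : A →+* F) (hφ : φ.comp (algebraMap k A) = (algebraMap R F).comp g) (x : A)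
    (hx : ∃ r, algebraMap R F r = φ x) (a : A) (ha : IsIntegral (Algebra.adjoin k {x}) a) :
    ∃ r, algebraMap R F r = φ a := by
  have hmem : ∀ b ∈ Algebra.adjoin k {x}, φ b ∈ (algebraMap R F).range := by
    intro b hb
    induction hb using Algebra.adjoin_induction with
    | mem y hy => obtain rfl := hy; exact hx
    | algebraMap r => exact ⟨g r, congr($(hφ.symm) r)⟩
    | add y z _ _ hy hz => rw [map_add]; exact add_mem hy hz
    | mul y z _ _ hy hz => rw [map_mul]; exact mul_mem hy hz
  obtain ⟨P, hP, hPa⟩ := ha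
  have h₁ : IsIntegral (algebraMap R F).range (φ a) := by
    refine ⟨P.map ((φ.comp (Algebra.adjoin k {x}).val.toRingHom).codRestrict
      (algebraMap R F).range fun b ↦ hmem b b.2), hP.map _, ?_⟩
    rw [Polynomial.eval₂_map]
    have h := congr(φ $hPa)
    rw [map_zero, Polynomial.hom_eval₂] at h
    exact h
  have h₂ : IsIntegral R (φ a) := by
    obtain ⟨Q, hQ, hQa⟩ := h₁
    obtain ⟨Q', hQ', -, hQ'm⟩ := Polynomial.lifts_and_natDegree_eq_and_monic
      (f := (algebraMap R F).rangeRestrict) (p := Q)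
      (Polynomial.mem_lifts_of_surjective (algebraMap R F).rangeRestrict_surjective Q) hQ
    refine ⟨Q', hQ'm, ?_⟩
    rw [← hQ', Polynomial.eval₂_map] at hQa
    exact hQa
  exact (IsIntegrallyClosed.isIntegral_iff).mp h₂

theorem hasLift_of_chart {k A : Type u} [Field k] [CommRing A] [Algebra k A] {X : Scheme.{u}}
    (f : X ⟶ Spec (.of k)) (i : Spec (.of A) ⟶ X)
    (hi : i ≫ f = Spec.map (CommRingCat.ofHom (algebraMap k A))) (S : ValuativeCommSq f)
    (φ : A →+* S.K) (hφ : S.i₁ = Spec.map (CommRingCat.ofHom φ) ≫ i)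
    (h : ∀ a, ∃ r, algebraMap S.R S.K r = φ a) : S.commSq.HasLift := by
  have hinj : Function.Injective (algebraMap S.R S.K) := IsFractionRing.injective _ _
  choose ψ hψ using h
  let ψ' : A →+* S.R :=
    { toFun := ψ
      map_one' := hinj (by rw [hψ, map_one, map_one])
      map_mul' a b := hinj (by rw [hψ, map_mul, map_mul, hψ, hψ])
      map_zero' := hinj (by rw [hψ, map_zero, map_zero])
      map_add' a b := hinj (by rw [hψ, map_add, map_add, hψ, hψ]) }
  have hψ' : (algebraMap S.R S.K).comp ψ' = φ := RingHom.ext hψ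
  refine ⟨⟨Spec.map (CommRingCat.ofHom ψ') ≫ i, ?_, ?_⟩⟩
  · rw [hφ, ← Category.assoc, ← Spec.map_comp, ← CommRingCat.ofHom_comp, hψ']
  · have w := S.commSq.w
    obtain ⟨g, hg⟩ := Spec.map_surjective S.i₂
    rw [Category.assoc, hi, ← hg, ← Spec.map_comp]
    rw [hφ, Category.assoc, hi, ← hg, ← Spec.map_comp, ← Spec.map_comp] at w
    have w' := Spec.map_injective w
    congr 1
    ext a
    refine hinj ?_
    have := congr($(w').hom a)
    exact (hψ _).trans this

theorem specMap_algHom_comp {k A O : Type u} [Field k] [CommRing A] [CommRing O] [Algebra k A] [Algebra k O]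
    (p : A →ₐ[k] O) : Spec.map (CommRingCat.ofHom p.toRingHom) ≫
      Spec.map (CommRingCat.ofHom (algebraMap k A)) =
        Spec.map (CommRingCat.ofHom (algebraMap k O)) := by
  rw [← Spec.map_comp, ← CommRingCat.ofHom_comp]
  congr 2
  exact p.comp_algebraMap

variable {k A B O : Type u} [Field k] [CommRing A] [CommRing B] [CommRing O] [Algebra k A]
  [Algebra k B] [Algebra k O] (p : A →ₐ[k] O) (q : B →ₐ[k] O)

variable [IsOpenImmersion (Spec.map (CommRingCat.ofHom p.toRingHom))]
  [IsOpenImmersion (Spec.map (CommRingCat.ofHom q.toRingHom))]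

/-- The scheme obtained by gluing `Spec A` and `Spec B` along `Spec O`. -/
abbrev glued : Scheme.{u} :=
  pushout (Spec.map (CommRingCat.ofHom p.toRingHom)) (Spec.map (CommRingCat.ofHom q.toRingHom))

/-- The first chart of `glued p q`. -/
abbrev gluedInl : Spec (.of A) ⟶ glued p q := pushout.inl _ _

/-- The second chart of `glued p q`. -/
abbrev gluedInr : Spec (.of B) ⟶ glued p q := pushout.inr _ _

/-- The structure morphism of `glued p q`. -/
def gluedHom : glued p q ⟶ Spec (.of k) :=
  pushout.desc (Spec.map (CommRingCat.ofHom (algebraMap k A)))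
    (Spec.map (CommRingCat.ofHom (algebraMap k B)))
    ((specMap_algHom_comp p).trans (specMap_algHom_comp q).symm)

@[simp] theorem gluedInl_gluedHom :
    gluedInl p q ≫ gluedHom p q = Spec.map (CommRingCat.ofHom (algebraMap k A)) :=
  pushout.inl_desc _ _ _

@[simp] theorem gluedInr_gluedHom :
    gluedInr p q ≫ gluedHom p q = Spec.map (CommRingCat.ofHom (algebraMap k B)) :=
  pushout.inr_desc _ _ _

theorem glued_cover (x : glued p q) :
    (∃ y, gluedInl p q y = x) ∨ ∃ z, gluedInr p q z = x :=
  pushout_jointly_surjective _ _ x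

theorem glued_spec_field {F : Type u} [Field F] (s : Spec (.of F) ⟶ glued p q) :
    (∃ φ : A →+* F, s = Spec.map (CommRingCat.ofHom φ) ≫ gluedInl p q) ∨
      ∃ φ : B →+* F, s = Spec.map (CommRingCat.ofHom φ) ≫ gluedInr p q := by
  have key {C : Type u} [CommRing C] (i : Spec (.of C) ⟶ glued p q) [IsOpenImmersion i]
      (h : ∃ y, i y = s (IsLocalRing.closedPoint F)) :
      ∃ φ : C →+* F, s = Spec.map (CommRingCat.ofHom φ) ≫ i := by
    have hr : Set.range s ⊆ Set.range i := by
      rintro _ ⟨t, rfl⟩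
      obtain rfl : t = IsLocalRing.closedPoint F := Subsingleton.elim _ _
      exact h
    obtain ⟨φ, hφ⟩ := Spec.map_surjective (IsOpenImmersion.lift i s hr)
    refine ⟨φ.hom, ?_⟩
    rw [CommRingCat.ofHom_hom, hφ, IsOpenImmersion.lift_fac]
  rcases glued_cover p q (s (IsLocalRing.closedPoint F)) with h | h
  · exact .inl (key _ h)
  · exact .inr (key _ h)

instance quasiCompact_gluedHom : QuasiCompact (gluedHom p q) := by
  have : CompactSpace (glued p q) := by
    have : Finite (pairCover (gluedInl p q) (gluedInr p q) (glued_cover p q)).I₀ :=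
      inferInstanceAs (Finite Bool)
    have : ∀ b, CompactSpace ((pairCover (gluedInl p q) (gluedInr p q) (glued_cover p q)).X b) := by
      rintro (_ | _)
      exacts [inferInstanceAs (CompactSpace (Spec _)), inferInstanceAs (CompactSpace (Spec _))]
    exact Scheme.OpenCover.compactSpace (pairCover (gluedInl p q) (gluedInr p q) (glued_cover p q))
  exact (quasiCompact_iff_compactSpace _).mpr this

theorem locallyOfFiniteType_gluedHom [Algebra.FiniteType k A] [Algebra.FiniteType k B] :
    LocallyOfFiniteType (gluedHom p q) := by
  have : IsZariskiLocalAtSource (@LocallyOfFiniteType) := HasRingHomProperty.instIsZariskiLocalAtSource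
  rw [IsZariskiLocalAtSource.iff_of_openCover (P := @LocallyOfFiniteType)
    (pairCover (gluedInl p q) (gluedInr p q) (glued_cover p q))]
  rintro (_ | _)
  · change LocallyOfFiniteType (gluedInl p q ≫ gluedHom p q)
    rw [gluedInl_gluedHom, HasRingHomProperty.Spec_iff (P := @LocallyOfFiniteType)]
    exact (RingHom.finiteType_algebraMap).mpr ‹_›
  · change LocallyOfFiniteType (gluedInr p q ≫ gluedHom p q)
    rw [gluedInr_gluedHom, HasRingHomProperty.Spec_iff (P := @LocallyOfFiniteType)]
    exact (RingHom.finiteType_algebraMap).mpr ‹_›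

theorem smooth_gluedHom (n : ℕ)
    (hA : RingHom.Locally (RingHom.IsStandardSmoothOfRelativeDimension n) (algebraMap k A))
    (hB : RingHom.Locally (RingHom.IsStandardSmoothOfRelativeDimension n) (algebraMap k B)) :
    SmoothOfRelativeDimension n (gluedHom p q) := by
  have : IsZariskiLocalAtSource (@SmoothOfRelativeDimension n) := HasRingHomProperty.instIsZariskiLocalAtSource
  rw [IsZariskiLocalAtSource.iff_of_openCover (P := @SmoothOfRelativeDimension n)
    (pairCover (gluedInl p q) (gluedInr p q) (glued_cover p q))]
  rintro (_ | _)
  · change SmoothOfRelativeDimension n (gluedInl p q ≫ gluedHom p q)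
    rw [gluedInl_gluedHom, HasRingHomProperty.Spec_iff (P := @SmoothOfRelativeDimension n)]
    exact hA
  · change SmoothOfRelativeDimension n (gluedInr p q ≫ gluedHom p q)
    rw [gluedInr_gluedHom, HasRingHomProperty.Spec_iff (P := @SmoothOfRelativeDimension n)]
    exact hB

/-- Valuative criterion: for a point in the first chart, either `x` takes an integral value and the
whole chart ring extends over `R`, or `1 / x` does. In the latter case the point lies in the
overlap, and it extends through the second chart, where `y = 1 / x`. -/
theorem universallyClosed_gluedHom (x : A) (y : B) (hxy : p x * q y = 1)
    (hA : ∀ a : A, IsIntegral (Algebra.adjoin k {x}) a) (hB : ∀ b : B, IsIntegral (Algebra.adjoin k {y}) b)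
    (hx : ∀ {F : Type u} [Field F] (φ : A →+* F), φ x ≠ 0 → ∃ ψ : O →+* F, ψ.comp p.toRingHom = φ)
    (hy : ∀ {F : Type u} [Field F] (φ : B →+* F), φ y ≠ 0 → ∃ ψ : O →+* F, ψ.comp q.toRingHom = φ) :
    UniversallyClosed (gluedHom p q) := by
  refine .of_valuativeCriterion _ fun S ↦ ?_
  obtain ⟨g, hg⟩ := Spec.map_surjective S.i₂
  have lA (φ : A →+* S.K) (hφ : S.i₁ = Spec.map (CommRingCat.ofHom φ) ≫ gluedInl p q)
      (h : ∃ r, algebraMap S.R S.K r = φ x) : S.commSq.HasLift := by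
    refine hasLift_of_chart _ _ (gluedInl_gluedHom p q) S φ hφ fun a ↦
      mem_range_of_isIntegral_adjoin g.hom φ ?_ x h a (hA a)
    have w := S.commSq.w
    rw [hφ, Category.assoc, gluedInl_gluedHom, ← hg, ← Spec.map_comp, ← Spec.map_comp] at w
    exact congr(($(Spec.map_injective w)).hom)
  have lB (φ : B →+* S.K) (hφ : S.i₁ = Spec.map (CommRingCat.ofHom φ) ≫ gluedInr p q)
      (h : ∃ r, algebraMap S.R S.K r = φ y) : S.commSq.HasLift := by
    refine hasLift_of_chart _ _ (gluedInr_gluedHom p q) S φ hφ fun a ↦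
      mem_range_of_isIntegral_adjoin g.hom φ ?_ y h a (hB a)
    have w := S.commSq.w
    rw [hφ, Category.assoc, gluedInr_gluedHom, ← hg, ← Spec.map_comp, ← Spec.map_comp] at w
    exact congr(($(Spec.map_injective w)).hom)
  have glue (ψ : O →+* S.K) : Spec.map (CommRingCat.ofHom (ψ.comp p.toRingHom)) ≫ gluedInl p q =
      Spec.map (CommRingCat.ofHom (ψ.comp q.toRingHom)) ≫ gluedInr p q := by
    rw [CommRingCat.ofHom_comp, CommRingCat.ofHom_comp, Spec.map_comp, Spec.map_comp,
      Category.assoc, Category.assoc, pushout.condition]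
  rcases glued_spec_field p q S.i₁ with ⟨φ, hφ⟩ | ⟨φ, hφ⟩
  · rcases ValuationRing.isInteger_or_isInteger S.R (φ x) with h | h
    · exact lA φ hφ h
    · by_cases h0 : φ x = 0
      · exact lA φ hφ ⟨0, by rw [h0, map_zero]⟩
      obtain ⟨ψ, hψ⟩ := hx φ h0
      refine lB (ψ.comp q.toRingHom) (by rw [hφ, ← hψ, glue]) ?_
      have : (φ x)⁻¹ = (ψ.comp q.toRingHom) y := by
        rw [← hψ]
        refine inv_eq_of_mul_eq_one_right ?_
        rw [RingHom.comp_apply, RingHom.comp_apply, ← map_mul]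
        exact (congr(ψ $hxy)).trans (map_one ψ)
      exact this ▸ h
  · rcases ValuationRing.isInteger_or_isInteger S.R (φ y) with h | h
    · exact lB φ hφ h
    · by_cases h0 : φ y = 0
      · exact lB φ hφ ⟨0, by rw [h0, map_zero]⟩
      obtain ⟨ψ, hψ⟩ := hy φ h0
      refine lA (ψ.comp p.toRingHom) (by rw [hφ, ← hψ, glue]) ?_
      have : (φ y)⁻¹ = (ψ.comp p.toRingHom) x := by
        rw [← hψ]
        refine inv_eq_of_mul_eq_one_left ?_
        rw [RingHom.comp_apply, RingHom.comp_apply, ← map_mul]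
        exact (congr(ψ $hxy)).trans (map_one ψ)
      exact this ▸ h

theorem isProper_gluedHom [Algebra.FiniteType k A] [Algebra.FiniteType k B]
    (x : A) (y : B) (hxy : p x * q y = 1)
    (hA : ∀ a : A, IsIntegral (Algebra.adjoin k {x}) a) (hB : ∀ b : B, IsIntegral (Algebra.adjoin k {y}) b)
    (hx : ∀ {F : Type u} [Field F] (φ : A →+* F), φ x ≠ 0 → ∃ ψ : O →+* F, ψ.comp p.toRingHom = φ)
    (hy : ∀ {F : Type u} [Field F] (φ : B →+* F), φ y ≠ 0 → ∃ ψ : O →+* F, ψ.comp q.toRingHom = φ)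
    (hs : Function.Surjective (Algebra.TensorProduct.lift p q (fun _ _ ↦ .all _ _))) :
    IsProper (gluedHom p q) := by
  have := isSeparated_of_pair p q (gluedInl p q) (gluedInr p q) (glued_cover p q) (gluedHom p q)
    (gluedInl_gluedHom p q) (gluedInr_gluedHom p q) (isPullback_pushout _ _) hs
  have := locallyOfFiniteType_gluedHom p q
  have := universallyClosed_gluedHom p q x y hxy hA hB hx hy
  exact {}

end Glue

/-! ### Geometric integrality of a gluing. -/

section GlueIntegral
variable {k A B O : Type u} [Field k] [CommRing A] [CommRing B] [CommRing O] [Algebra k A]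
  [Algebra k B] [Algebra k O] (p : A →ₐ[k] O) (q : B →ₐ[k] O)
  [IsOpenImmersion (Spec.map (CommRingCat.ofHom p.toRingHom))]
  [IsOpenImmersion (Spec.map (CommRingCat.ofHom q.toRingHom))]

theorem isIntegral_glued [IsDomain A] [IsDomain B] [Nontrivial O] : IsIntegral (glued p q) := by
  obtain ⟨z⟩ : Nonempty (Spec (.of O)) := inferInstance
  refine isIntegral_of_pair (gluedInl p q) (gluedInr p q) (glued_cover p q)
    (Spec.map (CommRingCat.ofHom p.toRingHom) z) (Spec.map (CommRingCat.ofHom q.toRingHom) z) ?_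
  rw [← Scheme.Hom.comp_apply, ← Scheme.Hom.comp_apply, pushout.condition]

theorem geometricallyIntegral_gluedHom [Nontrivial O]
    (hA : ∀ (F : Type u) [Field F] [Algebra k F], IsDomain (A ⊗[k] F))
    (hB : ∀ (F : Type u) [Field F] [Algebra k F], IsDomain (B ⊗[k] F)) :
    GeometricallyIntegral (gluedHom p q) := by
  refine ⟨?_⟩
  have : ObjectProperty.IsClosedUnderIsomorphisms (C := Scheme.{u}) (IsIntegral ·) :=
    ⟨fun {Y Z} e (h : IsIntegral Y) ↦ by
      have : Nonempty Z := ⟨e.hom h.nonempty.some⟩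
      exact isIntegral_of_isOpenImmersion e.inv⟩
  rw [geometrically_iff_of_commRing_of_isClosedUnderIsomorphisms]
  intro F _ _
  let g : Spec (.of F) ⟶ Spec (.of k) := Spec.map (CommRingCat.ofHom (algebraMap k F))
  have chart {C : Type u} [CommRing C] [Algebra k C] (l : Spec (.of C) ⟶ glued p q)
      (hl : l ≫ gluedHom p q = Spec.map (CommRingCat.ofHom (algebraMap k C)))
      (hC : IsDomain (C ⊗[k] F)) : IsIntegral (pullback (l ≫ gluedHom p q) g) := by
    let e : pullback (l ≫ gluedHom p q) g ≅ Spec (.of (C ⊗[k] F)) :=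
      pullback.congrHom hl (Eq.refl g) ≪≫ pullbackSpecIso k C F
    have : IsIntegral (Spec (.of (C ⊗[k] F))) := inferInstance
    have : Nonempty ↑(pullback (l ≫ gluedHom p q) g) := by
      obtain ⟨z⟩ : Nonempty (Spec (.of (C ⊗[k] F))) := inferInstance
      exact ⟨e.inv z⟩
    exact isIntegral_of_isOpenImmersion e.hom
  have h₁ := chart (gluedInl p q) (gluedInl_gluedHom p q) (hA F)
  have h₂ := chart (gluedInr p q) (gluedInr_gluedHom p q) (hB F)
  let 𝒰 := Scheme.Pullback.openCoverOfLeft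
    (pairCover (gluedInl p q) (gluedInr p q) (glued_cover p q)) (gluedHom p q) g
  let i' : pullback (gluedInl p q ≫ gluedHom p q) g ⟶ pullback (gluedHom p q) g := 𝒰.f false
  let j' : pullback (gluedInr p q ≫ gluedHom p q) g ⟶ pullback (gluedHom p q) g := 𝒰.f true
  have hi' : i' = pullback.map _ _ _ _ (gluedInl p q) (𝟙 _) (𝟙 _) (by simp) (by simp) := rfl
  have hj' : j' = pullback.map _ _ _ _ (gluedInr p q) (𝟙 _) (𝟙 _) (by simp) (by simp) := rfl
  have : IsOpenImmersion i' := 𝒰.map_prop false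
  have : IsOpenImmersion j' := 𝒰.map_prop true
  have hcov (x : ↑(pullback (gluedHom p q) g)) : (∃ y, i' y = x) ∨ ∃ z, j' z = x := by
    obtain ⟨b, y, hy⟩ := 𝒰.exists_eq x
    match b, y, hy with
    | false, y, hy => exact .inl ⟨y, hy⟩
    | true, y, hy => exact .inr ⟨y, hy⟩
  obtain ⟨z⟩ : Nonempty (Spec (.of (O ⊗[k] F))) := inferInstance
  let z' := (pullbackSpecIso k O F).inv z
  let s := pullback.fst (Spec.map (CommRingCat.ofHom (algebraMap k O))) g
  let t := pullback.snd (Spec.map (CommRingCat.ofHom (algebraMap k O))) g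
  have hst : s ≫ Spec.map (CommRingCat.ofHom (algebraMap k O)) = t ≫ g := pullback.condition
  let a : pullback (Spec.map (CommRingCat.ofHom (algebraMap k O))) g ⟶
      pullback (gluedInl p q ≫ gluedHom p q) g :=
    pullback.lift (s ≫ Spec.map (CommRingCat.ofHom p.toRingHom)) t
      (by rw [gluedInl_gluedHom, Category.assoc, specMap_algHom_comp, hst])
  let b : pullback (Spec.map (CommRingCat.ofHom (algebraMap k O))) g ⟶
      pullback (gluedInr p q ≫ gluedHom p q) g :=
    pullback.lift (s ≫ Spec.map (CommRingCat.ofHom q.toRingHom)) t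
      (by rw [gluedInr_gluedHom, Category.assoc, specMap_algHom_comp, hst])
  have hab : a ≫ i' = b ≫ j' := by
    rw [hi', hj']
    apply pullback.hom_ext
    · simp only [Category.assoc, pullback.lift_fst, a, b, pullback.map]
      rw [pullback.lift_fst_assoc, pullback.lift_fst_assoc, Category.assoc, Category.assoc,
        pushout.condition]
    · simp only [Category.assoc, pullback.lift_snd, a, b, pullback.map]
      rw [pullback.lift_snd_assoc, pullback.lift_snd_assoc]
  exact isIntegral_of_pair i' j' hcov (a z') (b z')
    ((Scheme.Hom.comp_apply a i' z').symm.trans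
      (congr($hab z').trans (Scheme.Hom.comp_apply b j' z')))

end GlueIntegral

/-! ### Functoriality of Kähler differentials -/
section Differentials
variable {k A B C : Type u} [Field k] [CommRing A] [CommRing B] [CommRing C] [Algebra k A]
  [Algebra k B] [Algebra k C]

/-- The map on Kähler differentials induced by a map of `k`-algebras. -/
def mapDifferentials (φ : A →ₐ[k] B) : Ω[A⁄k] →ₗ[k] Ω[B⁄k] :=
  letI : Algebra A B := φ.toRingHom.toAlgebra
  haveI : IsScalarTower k A B := IsScalarTower.of_algebraMap_eq fun r ↦ (φ.commutes r).symm
  (KaehlerDifferential.map k k A B).restrictScalars k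

theorem mapDifferentials_D (φ : A →ₐ[k] B) (a : A) :
    mapDifferentials φ (KaehlerDifferential.D k A a) = KaehlerDifferential.D k B (φ a) := by
  let : Algebra A B := φ.toRingHom.toAlgebra
  have : IsScalarTower k A B := IsScalarTower.of_algebraMap_eq fun r ↦ (φ.commutes r).symm
  exact KaehlerDifferential.map_D k k A B a

theorem mapDifferentials_smul (φ : A →ₐ[k] B) (a : A) (ω : Ω[A⁄k]) :
    mapDifferentials φ (a • ω) = φ a • mapDifferentials φ ω := by
  let : Algebra A B := φ.toRingHom.toAlgebra
  have : IsScalarTower k A B := IsScalarTower.of_algebraMap_eq fun r ↦ (φ.commutes r).symm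
  exact (map_smul (KaehlerDifferential.map k k A B) a ω).trans (algebraMap_smul B a _).symm

theorem mapDifferentials_comp (ψ : B →ₐ[k] C) (φ : A →ₐ[k] B) (ω : Ω[A⁄k]) :
    mapDifferentials (ψ.comp φ) ω = mapDifferentials ψ (mapDifferentials φ ω) := by
  have h : ω ∈ Submodule.span A (Set.range (KaehlerDifferential.D k A)) := by
    rw [KaehlerDifferential.span_range_derivation]; trivial
  induction h using Submodule.span_induction with
  | mem x hx => obtain ⟨a, rfl⟩ := hx; simp only [mapDifferentials_D, AlgHom.comp_apply]
  | zero => simp only [map_zero]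
  | add x y _ _ hx hy => simp only [map_add, hx, hy]
  | smul a x _ hx => simp only [mapDifferentials_smul, hx, AlgHom.comp_apply]

theorem mapDifferentials_id (ω : Ω[A⁄k]) : mapDifferentials (AlgHom.id k A) ω = ω := by
  have h : ω ∈ Submodule.span A (Set.range (KaehlerDifferential.D k A)) := by
    rw [KaehlerDifferential.span_range_derivation]; trivial
  induction h using Submodule.span_induction with
  | mem x hx => obtain ⟨a, rfl⟩ := hx; simp only [mapDifferentials_D, AlgHom.id_apply]
  | zero => simp only [map_zero]
  | add x y _ _ hx hy => simp only [map_add, hx, hy]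
  | smul a x _ hx => simp only [mapDifferentials_smul, hx, AlgHom.id_apply]

theorem mapDifferentials_symm_apply (e : A ≃ₐ[k] B) (ω : Ω[B⁄k]) :
    mapDifferentials e.toAlgHom (mapDifferentials e.symm.toAlgHom ω) = ω := by
  rw [← mapDifferentials_comp]
  have : e.toAlgHom.comp e.symm.toAlgHom = AlgHom.id k B := AlgHom.ext fun b ↦ e.apply_symm_apply b
  rw [this, mapDifferentials_id]

/-- Differentials commute with localization, so the kernel is torsion, and a flat module has none.
This lets differentials on a smooth scheme be compared inside the function field. -/
theorem mapDifferentials_injective (φ : A →ₐ[k] B)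
    (hφ : letI := φ.toRingHom.toAlgebra; IsFractionRing A B) [Module.Flat A (Ω[A⁄k])] :
    Function.Injective (mapDifferentials φ) := by
  let : Algebra A B := φ.toRingHom.toAlgebra
  have : IsFractionRing A B := hφ
  have : IsScalarTower k A B := IsScalarTower.of_algebraMap_eq fun r ↦ (φ.commutes r).symm
  rw [injective_iff_map_eq_zero]
  intro ω hω
  obtain ⟨s, hs⟩ := (IsLocalizedModule.eq_zero_iff (nonZeroDivisors A)
    (KaehlerDifferential.map k k A B)).mp hω
  exact Module.Flat.isSMulRegular_of_nonZeroDivisors s.2 (hs.trans (smul_zero s.1).symm)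

theorem exists_mapDifferentials_eq_smul (φ : A →ₐ[k] B) (g : A)
    (hφ : letI := φ.toRingHom.toAlgebra; IsLocalization.Away g B) (ω : Ω[B⁄k]) :
    ∃ (n : ℕ) (ω' : Ω[A⁄k]), mapDifferentials φ ω' = φ (g ^ n) • ω := by
  let : Algebra A B := φ.toRingHom.toAlgebra
  have : IsLocalization.Away g B := hφ
  have : IsScalarTower k A B := IsScalarTower.of_algebraMap_eq fun r ↦ (φ.commutes r).symm
  obtain ⟨⟨ω', ⟨_, n, rfl⟩⟩, h⟩ := IsLocalizedModule.surj (Submonoid.powers g)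
    (KaehlerDifferential.map k k A B) ω
  exact ⟨n, ω', h.symm.trans (algebraMap_smul B (g ^ n) ω).symm⟩

/-- The denominators that clear `η` form an ideal; regularity of `η` means that it contains `1`. -/
theorem mem_range_mapDifferentials (φ : A →ₐ[k] B) (η : Ω[B⁄k])
    (h : Ideal.span {a : A | φ a • η ∈ LinearMap.range (mapDifferentials φ)} = ⊤) :
    η ∈ LinearMap.range (mapDifferentials φ) := by
  let J : Ideal A :=
    { carrier := {a : A | φ a • η ∈ LinearMap.range (mapDifferentials φ)}
      add_mem' {a b} ha hb := by
        rw [Set.mem_ofPred, map_add, add_smul]; exact add_mem ha hb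
      zero_mem' := by rw [Set.mem_ofPred, map_zero, zero_smul]; exact zero_mem _
      smul_mem' c a ha := by
        obtain ⟨ω, hω⟩ := ha
        exact ⟨c • ω, by rw [mapDifferentials_smul, hω, smul_smul, smul_eq_mul, map_mul]⟩ }
  have h₁ : (1 : A) ∈ J := by
    have : Ideal.span {a : A | φ a • η ∈ LinearMap.range (mapDifferentials φ)} ≤ J :=
      Ideal.span_le.mpr fun a ha ↦ ha
    exact this (h ▸ trivial)
  have h₂ : φ 1 • η ∈ LinearMap.range (mapDifferentials φ) := h₁
  rwa [map_one, one_smul] at h₂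

end Differentials

/-! ### Global differentials seen inside the function field. -/

section FunctionField
variable {k : Type u} [Field k] {X : Scheme.{u}} (f : X ⟶ Spec (.of k))

theorem restrictDifferentials_eq {U V : X.Opens} (h : V ≤ U) :
    restrictDifferentials f h = mapDifferentials (restrictFunctions f h) := rfl

theorem flat_differentials [Smooth f] (U : X.affineOpens) :
    Module.Flat (SectionRing f U.1) (Ω[SectionRing f U.1⁄k]) := by
  have h₁ : (f.appLE ⊤ U.1 (le_preimage_top f U.1)).hom.Smooth :=
    HasRingHomProperty.appLE @Smooth f ‹_› ⟨⊤, isAffineOpen_top _⟩ U _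
  have h₂ : (structureHom f U.1).Smooth :=
    RingHom.Smooth.respectsIso.2 _ (Scheme.ΓSpecIso (.of k)).symm.commRingCatIsoToRingEquiv h₁
  have : Algebra.Smooth k (SectionRing f U.1) := h₂
  infer_instance

variable [IsIntegral X]

/-- The function field of an integral `k`-scheme `f : X ⟶ Spec k`, with its `k`-algebra
structure. -/
def FunctionRing (_f : X ⟶ Spec (.of k)) : Type u := X.functionField

instance : Field (FunctionRing f) := inferInstanceAs (Field X.functionField)

instance : Nonempty (⊤ : X.Opens) := ⟨⟨genericPoint X, trivial⟩⟩

instance : Algebra k (FunctionRing f) :=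
  ((X.germToFunctionField ⊤).hom.comp (structureHom f ⊤)).toAlgebra

theorem germ_restrictFunctions {U V : X.Opens} (h : V ≤ U) [Nonempty U] [Nonempty V]
    (s : SectionRing f U) : (X.germToFunctionField V).hom (restrictFunctions f h s) =
      (X.germToFunctionField U).hom s :=
  X.presheaf.germ_res_apply (homOfLE h) _ _ s

/-- The map from the functions on a nonempty open subset to the function field. -/
def toFunctionRing (U : X.Opens) [Nonempty U] : SectionRing f U →ₐ[k] FunctionRing f where
  toRingHom := (X.germToFunctionField U).hom
  commutes' r := by
    have h := germ_restrictFunctions f (le_top : U ≤ ⊤) (algebraMap k _ r)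
    rw [AlgHom.commutes] at h
    exact h

theorem toFunctionRing_comp_restrictFunctions {U V : X.Opens} (h : V ≤ U) [Nonempty U]
    [Nonempty V] : (toFunctionRing f V).comp (restrictFunctions f h) = toFunctionRing f U :=
  AlgHom.ext fun s ↦ germ_restrictFunctions f h s

theorem toFunctionRing_injective (U : X.Opens) [Nonempty U] :
    Function.Injective (toFunctionRing f U) :=
  Scheme.germToFunctionField_injective X U

theorem mapDifferentials_toFunctionRing_injective [Smooth f] (U : X.affineOpens) [Nonempty U.1] :
    Function.Injective (mapDifferentials (toFunctionRing f U.1)) := by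
  have := flat_differentials f U
  exact mapDifferentials_injective _ (functionField_isFractionRing_of_isAffineOpen X U.1 U.2)

/-- Regularity of `η` near `x` gives, after clearing denominators on a basic open, a function that
does not vanish at `x` and multiplies `η` into the forms on `V`. Such functions have no common zero
on `V`. -/
theorem mem_range_mapDifferentials_toFunctionRing (η : Ω[FunctionRing f⁄k])
    (h : ∀ x : X, ∃ (U : X.affineOpens) (_ : x ∈ U.1) (_ : Nonempty U.1),
      η ∈ LinearMap.range (mapDifferentials (toFunctionRing f U.1)))
    (V : X.affineOpens) [Nonempty V.1] :
    η ∈ LinearMap.range (mapDifferentials (toFunctionRing f V.1)) := by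
  apply mem_range_mapDifferentials
  refine (V.2.self_le_iSup_basicOpen_iff (s := {a : SectionRing f V.1 |
    toFunctionRing f V.1 a • η ∈ LinearMap.range (mapDifferentials (toFunctionRing f V.1))})).mp ?_
  intro x hx
  obtain ⟨U, hxU, hU, ω, hω⟩ := h x
  obtain ⟨g, hgU, hxg⟩ := V.2.exists_basicOpen_le (V := U.1) ⟨x, hxU⟩ hx
  have hne : Nonempty (X.basicOpen g) := ⟨⟨x, hxg⟩⟩
  obtain ⟨n, ω', hω'⟩ := exists_mapDifferentials_eq_smul
    (restrictFunctions f (X.basicOpen_le g)) g (V.2.isLocalization_basicOpen g)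
    (mapDifferentials (restrictFunctions f hgU) ω)
  rw [TopologicalSpace.Opens.mem_iSup]
  -- The extra factor `g` keeps the exponent positive, so the power has the same nonvanishing locus
  -- as `g`.
  have hgn : x ∈ X.basicOpen (g ^ (n + 1)) := (X.basicOpen_pow g n.succ_pos).ge hxg
  refine ⟨⟨g ^ (n + 1), ?_⟩, hgn⟩
  let g' : SectionRing f V.1 := g
  refine ⟨g' • ω', ?_⟩
  have h₁ := congr(mapDifferentials (toFunctionRing f (X.basicOpen g)) $hω')
  rw [← mapDifferentials_comp, toFunctionRing_comp_restrictFunctions, mapDifferentials_smul,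
    ← mapDifferentials_comp, toFunctionRing_comp_restrictFunctions, hω, ← AlgHom.comp_apply,
    toFunctionRing_comp_restrictFunctions] at h₁
  rw [mapDifferentials_smul, h₁, smul_smul, ← map_mul, ← pow_succ']
  rfl

theorem mapDifferentials_toFunctionRing_eq {ω : ∀ U : X.affineOpens, Ω[SectionRing f U.1⁄k]}
    (hω : ω ∈ globalDifferentials f) (V W : X.affineOpens) [Nonempty V.1] [Nonempty W.1] :
    mapDifferentials (toFunctionRing f V.1) (ω V) =
      mapDifferentials (toFunctionRing f W.1) (ω W) := by
  have hres (V W : X.affineOpens) (hWV : W.1 ≤ V.1) [Nonempty V.1] [Nonempty W.1] :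
      mapDifferentials (toFunctionRing f V.1) (ω V) =
        mapDifferentials (toFunctionRing f W.1) (ω W) := by
    rw [← hω V W hWV, restrictDifferentials_eq, ← mapDifferentials_comp,
      toFunctionRing_comp_restrictFunctions]
  have hgV : genericPoint X ∈ V.1 :=
    ((genericPoint_spec X).mem_open_set_iff V.1.isOpen).mpr (by simpa using ‹Nonempty V.1›)
  have hgW : genericPoint X ∈ W.1 :=
    ((genericPoint_spec X).mem_open_set_iff W.1.isOpen).mpr (by simpa using ‹Nonempty W.1›)
  obtain ⟨g, hgU, hxg⟩ := V.2.exists_basicOpen_le (V := W.1) ⟨_, hgW⟩ hgV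
  have : Nonempty (X.basicOpen g) := ⟨⟨_, hxg⟩⟩
  let Z : X.affineOpens := ⟨X.basicOpen g, V.2.basicOpen g⟩
  have : Nonempty Z.1 := this
  rw [hres V Z (X.basicOpen_le g), hres W Z hgU]

/-- If `η` is a nonzero differential of the function field of `X` that is regular everywhere, and
every global differential is a multiple of `η`, then `X` has genus one. -/
theorem genus_eq_one [Smooth f] (η : Ω[FunctionRing f⁄k]) (hη : η ≠ 0)
    (h : ∀ x : X, ∃ (U : X.affineOpens) (_ : x ∈ U.1) (_ : Nonempty U.1),
      η ∈ LinearMap.range (mapDifferentials (toFunctionRing f U.1)))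
    (U₀ : X.affineOpens) [Nonempty U₀.1]
    (h' : ∀ ω ∈ globalDifferentials f, ∃ c : k,
      mapDifferentials (toFunctionRing f U₀.1) (ω U₀) = c • η) : genus f = 1 := by
  -- Families of forms are also indexed by the empty open, where the value is immaterial because the
  -- module of differentials is zero.
  have hV (V : X.affineOpens) : ∃ ω : Ω[SectionRing f V.1⁄k], ∀ _ : Nonempty V.1,
      mapDifferentials (toFunctionRing f V.1) ω = η := by
    by_cases hne : Nonempty V.1
    · obtain ⟨ω, hω⟩ := mem_range_mapDifferentials_toFunctionRing f η h V
      exact ⟨ω, fun _ ↦ hω⟩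
    · exact ⟨0, fun h ↦ absurd h hne⟩
  have hsub (V : X.affineOpens) (hne : ¬ Nonempty V.1) : Subsingleton (Ω[SectionRing f V.1⁄k]) := by
    have : V.1 = ⊥ := by
      ext x
      exact ⟨fun hx ↦ (hne ⟨⟨x, hx⟩⟩).elim, fun hx ↦ hx.elim⟩
    have : Subsingleton (SectionRing f V.1) := by
      rw [this]
      exact inferInstanceAs (Subsingleton Γ(X, ⊥))
    exact Module.subsingleton (SectionRing f V.1) _
  choose ω₀ hω₀ using hV
  have hg : ω₀ ∈ globalDifferentials f := by
    intro V W hWV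
    by_cases hW : Nonempty W.1
    · have : Nonempty V.1 := ⟨⟨hW.some.1, hWV hW.some.2⟩⟩
      apply mapDifferentials_toFunctionRing_injective f W
      rw [restrictDifferentials_eq, ← mapDifferentials_comp,
        toFunctionRing_comp_restrictFunctions, hω₀ V, hω₀ W]
    · have := hsub W hW
      exact Subsingleton.elim _ _
  refine finrank_eq_one_iff'.mpr ⟨⟨ω₀, hg⟩, fun h0 ↦ hη ?_, fun ω ↦ ?_⟩
  · rw [← hω₀ U₀ ‹_›, show ω₀ = 0 from congr(($h0).1), Pi.zero_apply, map_zero]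
  · obtain ⟨c, hc⟩ := h' ω.1 ω.2
    refine ⟨c, Subtype.ext (funext fun V ↦ ?_)⟩
    by_cases hne : Nonempty V.1
    · apply mapDifferentials_toFunctionRing_injective f V
      rw [mapDifferentials_toFunctionRing_eq f ω.2 V U₀, hc]
      exact (map_smul _ c (ω₀ V)).trans (by rw [hω₀ V])
    · have := hsub V hne
      exact Subsingleton.elim _ _

end FunctionField

/-! ### Affine charts and their maps to the function field. -/

section Chart
variable {k A B : Type u} [Field k] [CommRing A] [Algebra k A] [CommRing B] [Algebra k B]
  {X : Scheme.{u}} (f : X ⟶ Spec (.of k))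

/-- Evaluation of functions along a morphism from an affine scheme. -/
def chartHom (i : Spec (.of A) ⟶ X) (hi : i ≫ f = Spec.map (CommRingCat.ofHom (algebraMap k A)))
    (U : X.Opens) (hU : ⊤ ≤ i ⁻¹ᵁ U) : SectionRing f U →ₐ[k] A where
  toRingHom := (i.appLE U ⊤ hU ≫ (Scheme.ΓSpecIso (.of A)).hom).hom
  commutes' r := by
    have h₀ : (i ≫ f).appLE ⊤ ⊤ (le_preimage_top (i ≫ f) ⊤) ≫ (Scheme.ΓSpecIso (.of A)).hom =
        (Scheme.ΓSpecIso (.of k)).hom ≫ CommRingCat.ofHom (algebraMap k A) := by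
      rw [← Scheme.ΓSpecIso_naturality, ← hi]
      congr 1
    have h : ((Scheme.ΓSpecIso (.of k)).inv ≫ f.appLE ⊤ U (le_preimage_top f U)) ≫
        i.appLE U ⊤ hU ≫ (Scheme.ΓSpecIso (.of A)).hom = CommRingCat.ofHom (algebraMap k A) := by
      rw [Category.assoc, Scheme.Hom.appLE_comp_appLE_assoc, h₀, Iso.inv_hom_id_assoc]
    exact congr(($h).hom r)

theorem chartHom_bijective (i : Spec (.of A) ⟶ X)
    (hi : i ≫ f = Spec.map (CommRingCat.ofHom (algebraMap k A))) [IsOpenImmersion i] :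
    Function.Bijective (chartHom f i hi i.opensRange fun x _ ↦ ⟨x, rfl⟩) := by
  have h₁ : IsIso (i.app i.opensRange) := i.isIso_app _ le_rfl
  have h₂ : IsIso (homOfLE (show ⊤ ≤ i ⁻¹ᵁ i.opensRange from fun x _ ↦ ⟨x, rfl⟩)) :=
    ⟨homOfLE le_top, Subsingleton.elim _ _, Subsingleton.elim _ _⟩
  have h₃ : IsIso (i.appLE i.opensRange ⊤ (fun x _ ↦ ⟨x, rfl⟩)) := by
    exact inferInstanceAs (IsIso (i.app i.opensRange ≫
      (Spec (.of A)).presheaf.map (homOfLE fun x _ ↦ ⟨x, rfl⟩).op))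
  exact ConcreteCategory.bijective_of_isIso
    (i.appLE i.opensRange ⊤ (fun x _ ↦ ⟨x, rfl⟩) ≫ (Scheme.ΓSpecIso (.of A)).hom)

theorem chartHom_restrictFunctions (i : Spec (.of A) ⟶ X)
    (hi : i ≫ f = Spec.map (CommRingCat.ofHom (algebraMap k A))) (U : X.Opens) (hU : ⊤ ≤ i ⁻¹ᵁ U)
    (p : A →ₐ[k] B) (j : Spec (.of B) ⟶ X)
    (hj : j ≫ f = Spec.map (CommRingCat.ofHom (algebraMap k B)))
    (hij : Spec.map (CommRingCat.ofHom p.toRingHom) ≫ i = j) (V : X.Opens) (hV : ⊤ ≤ j ⁻¹ᵁ V)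
    (h : V ≤ U) (s : SectionRing f U) :
    chartHom f j hj V hV (restrictFunctions f h s) = p (chartHom f i hi U hU s) := by
  subst hij
  have h₀ : X.presheaf.map (homOfLE h).op ≫
      (Spec.map (CommRingCat.ofHom p.toRingHom) ≫ i).appLE V ⊤ hV ≫
        (Scheme.ΓSpecIso (.of B)).hom =
      (i.appLE U ⊤ hU ≫ (Scheme.ΓSpecIso (.of A)).hom) ≫ CommRingCat.ofHom p.toRingHom := by
    rw [Scheme.Hom.map_appLE_assoc, Category.assoc, ← Scheme.ΓSpecIso_naturality,
      ← Scheme.Hom.appLE_comp_appLE_assoc _ _ U ⊤ ⊤ hU le_top]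
    congr 2
  exact congr(($h₀).hom s)

/-- The functions on the image of an affine chart. -/
def chartEquiv (i : Spec (.of A) ⟶ X) (hi : i ≫ f = Spec.map (CommRingCat.ofHom (algebraMap k A)))
    [IsOpenImmersion i] : SectionRing f i.opensRange ≃ₐ[k] A :=
  .ofBijective _ (chartHom_bijective f i hi)

theorem nonempty_opensRange {A : Type u} [CommRing A] {X : Scheme.{u}} [Nontrivial A] (i : Spec (.of A) ⟶ X) [IsOpenImmersion i] :
    Nonempty i.opensRange := by
  obtain ⟨z⟩ : Nonempty (Spec (.of A)) := inferInstance
  exact ⟨⟨i z, z, rfl⟩⟩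

variable [IsIntegral X] [Nontrivial A] [Nontrivial B]

/-- The map from the coordinate ring of an affine chart to the function field. -/
def chartToFunctionRing (i : Spec (.of A) ⟶ X)
    (hi : i ≫ f = Spec.map (CommRingCat.ofHom (algebraMap k A))) [IsOpenImmersion i] :
    A →ₐ[k] FunctionRing f :=
  haveI := nonempty_opensRange i
  (toFunctionRing f i.opensRange).comp (chartEquiv f i hi).symm.toAlgHom

theorem chartToFunctionRing_injective (i : Spec (.of A) ⟶ X)
    (hi : i ≫ f = Spec.map (CommRingCat.ofHom (algebraMap k A))) [IsOpenImmersion i] :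
    Function.Injective (chartToFunctionRing f i hi) :=
  haveI := nonempty_opensRange i
  (toFunctionRing_injective f i.opensRange).comp (chartEquiv f i hi).symm.injective

theorem chartToFunctionRing_comp (i : Spec (.of A) ⟶ X)
    (hi : i ≫ f = Spec.map (CommRingCat.ofHom (algebraMap k A))) [IsOpenImmersion i]
    (p : A →ₐ[k] B) (j : Spec (.of B) ⟶ X)
    (hj : j ≫ f = Spec.map (CommRingCat.ofHom (algebraMap k B))) [IsOpenImmersion j]
    (hij : Spec.map (CommRingCat.ofHom p.toRingHom) ≫ i = j) :
    (chartToFunctionRing f j hj).comp p = chartToFunctionRing f i hi := by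
  have := nonempty_opensRange i
  have := nonempty_opensRange j
  have hle : j.opensRange ≤ i.opensRange := by
    rintro _ ⟨z, rfl⟩
    exact ⟨Spec.map (CommRingCat.ofHom p.toRingHom) z, by rw [← Scheme.Hom.comp_apply, hij]⟩
  ext a
  obtain ⟨s, rfl⟩ := (chartEquiv f i hi).surjective a
  have h := chartHom_restrictFunctions f i hi i.opensRange (fun x _ ↦ ⟨x, rfl⟩) p j hj hij j.opensRange
    (fun x _ ↦ ⟨x, rfl⟩) hle s
  change toFunctionRing f j.opensRange ((chartEquiv f j hj).symm (p (chartEquiv f i hi s))) =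
    toFunctionRing f i.opensRange ((chartEquiv f i hi).symm (chartEquiv f i hi s))
  rw [show p (chartEquiv f i hi s) = chartEquiv f j hj (restrictFunctions f hle s) from h.symm,
    AlgEquiv.symm_apply_apply, AlgEquiv.symm_apply_apply, ← AlgHom.comp_apply,
    toFunctionRing_comp_restrictFunctions]

theorem mapDifferentials_chartToFunctionRing_mem (i : Spec (.of A) ⟶ X)
    (hi : i ≫ f = Spec.map (CommRingCat.ofHom (algebraMap k A))) [IsOpenImmersion i]
    [Nonempty i.opensRange] (ω : Ω[A⁄k]) : mapDifferentials (chartToFunctionRing f i hi) ω ∈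
      LinearMap.range (mapDifferentials (toFunctionRing f i.opensRange)) :=
  ⟨_, (mapDifferentials_comp _ _ ω).symm⟩

theorem exists_mapDifferentials_toFunctionRing_eq (i : Spec (.of A) ⟶ X)
    (hi : i ≫ f = Spec.map (CommRingCat.ofHom (algebraMap k A))) [IsOpenImmersion i]
    [Nonempty i.opensRange] (ω : Ω[SectionRing f i.opensRange⁄k]) : ∃ ω' : Ω[A⁄k],
      mapDifferentials (toFunctionRing f i.opensRange) ω =
        mapDifferentials (chartToFunctionRing f i hi) ω' := by
  refine ⟨mapDifferentials (chartEquiv f i hi).toAlgHom ω, ?_⟩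
  rw [chartToFunctionRing, mapDifferentials_comp]
  congr 1
  exact (mapDifferentials_symm_apply (chartEquiv f i hi).symm ω).symm

theorem mapDifferentials_chartToFunctionRing_injective [Smooth f] (i : Spec (.of A) ⟶ X)
    (hi : i ≫ f = Spec.map (CommRingCat.ofHom (algebraMap k A))) [IsOpenImmersion i] :
    Function.Injective (mapDifferentials (chartToFunctionRing f i hi)) := by
  have := nonempty_opensRange i
  have h₁ := mapDifferentials_toFunctionRing_injective f ⟨i.opensRange, isAffineOpen_opensRange i⟩
  have h₂ : Function.Injective (mapDifferentials (chartEquiv f i hi).symm.toAlgHom) :=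
    Function.LeftInverse.injective (g := mapDifferentials (chartEquiv f i hi).toAlgHom)
      (mapDifferentials_symm_apply (chartEquiv f i hi))
  intro ω ω' h
  rw [chartToFunctionRing, mapDifferentials_comp, mapDifferentials_comp] at h
  exact h₂ (h₁ h)

end Chart

/-! ### The genus of a gluing of two charts. -/

section GlueGenus
variable {k A B O : Type u} [Field k] [CommRing A] [CommRing B] [CommRing O] [Algebra k A]
  [Algebra k B] [Algebra k O] (p : A →ₐ[k] O) (q : B →ₐ[k] O)
  [IsOpenImmersion (Spec.map (CommRingCat.ofHom p.toRingHom))]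
  [IsOpenImmersion (Spec.map (CommRingCat.ofHom q.toRingHom))]

/-- A global form is `a ωA` on one chart and `b ωB` on the other. The generators agree on the
overlap, so `a` and `b` do too, and `hconst` makes their common value a constant. -/
theorem genus_gluedHom [IsDomain A] [IsDomain B] [Nontrivial O] [Smooth (gluedHom p q)]
    (hconst : ∀ a b, p a = q b → ∃ c : k, a = algebraMap k A c)
    (ωA : Ω[A⁄k]) (hA : ∀ ω, ∃ a : A, ω = a • ωA) (h0 : ωA ≠ 0)
    (ωB : Ω[B⁄k]) (hB : ∀ ω, ∃ b : B, ω = b • ωB)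
    (hAB : mapDifferentials p ωA = mapDifferentials q ωB) : genus (gluedHom p q) = 1 := by
  have := isIntegral_glued p q
  let f := gluedHom p q
  let i := gluedInl p q
  let j := gluedInr p q
  let l := Spec.map (CommRingCat.ofHom p.toRingHom) ≫ i
  have hi : i ≫ f = _ := gluedInl_gluedHom p q
  have hj : j ≫ f = _ := gluedInr_gluedHom p q
  have hl : l ≫ f = Spec.map (CommRingCat.ofHom (algebraMap k O)) := by
    rw [Category.assoc, hi, specMap_algHom_comp]
  have hjl : Spec.map (CommRingCat.ofHom q.toRingHom) ≫ j = l := pushout.condition.symm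
  have := nonempty_opensRange i
  have := nonempty_opensRange j
  have hp := chartToFunctionRing_comp f i hi p l hl rfl
  have hq := chartToFunctionRing_comp f j hj q l hl hjl
  have hη : mapDifferentials (chartToFunctionRing f i hi) ωA =
      mapDifferentials (chartToFunctionRing f j hj) ωB := by
    rw [← hp, ← hq, mapDifferentials_comp, hAB, mapDifferentials_comp]
  have hη0 : mapDifferentials (chartToFunctionRing f i hi) ωA ≠ 0 := fun h ↦
    h0 (mapDifferentials_chartToFunctionRing_injective f i hi (h.trans (map_zero _).symm))
  let UA : (glued p q).affineOpens := ⟨i.opensRange, isAffineOpen_opensRange i⟩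
  let UB : (glued p q).affineOpens := ⟨j.opensRange, isAffineOpen_opensRange j⟩
  have hUA : Nonempty UA.1 := ‹Nonempty i.opensRange›
  have hUB : Nonempty UB.1 := ‹Nonempty j.opensRange›
  refine genus_eq_one f _ hη0 (fun x ↦ ?_) UA fun ω hω ↦ ?_
  · rcases glued_cover p q x with ⟨y, rfl⟩ | ⟨y, rfl⟩
    · exact ⟨UA, ⟨y, rfl⟩, hUA, mapDifferentials_chartToFunctionRing_mem f i hi ωA⟩
    · exact ⟨UB, ⟨y, rfl⟩, hUB, hη ▸ mapDifferentials_chartToFunctionRing_mem f j hj ωB⟩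
  · obtain ⟨ω₁, h₁⟩ := exists_mapDifferentials_toFunctionRing_eq f i hi (ω UA)
    obtain ⟨ω₂, h₂⟩ := exists_mapDifferentials_toFunctionRing_eq f j hj (ω UB)
    obtain ⟨a, rfl⟩ := hA ω₁
    obtain ⟨b, rfl⟩ := hB ω₂
    have h₃ := mapDifferentials_toFunctionRing_eq f hω UA UB
    rw [show mapDifferentials (toFunctionRing f UA.1) (ω UA) = _ from h₁,
      show mapDifferentials (toFunctionRing f UB.1) (ω UB) = _ from h₂, mapDifferentials_smul,
      mapDifferentials_smul, ← hη] at h₃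
    have h₄ := smul_left_injective _ hη0 h₃
    rw [← hp, ← hq] at h₄
    obtain ⟨c, rfl⟩ := hconst a b (chartToFunctionRing_injective f l hl h₄)
    refine ⟨c, h₁.trans ?_⟩
    rw [mapDifferentials_smul, AlgHom.commutes, algebraMap_smul]

end GlueGenus

/-! ### Global functions are constants. -/

section Constants
variable {k A B O : Type u} [Field k] [CommRing A] [CommRing B] [CommRing O] [Algebra k A]
  [Algebra k B] [Algebra k O]

/-- With `F = k(a)` inside `A`, the ring `F ⊗ F` embeds in `A ⊗ F`, so it is a domain finite over
`k`, hence a field. Its multiplication map to `F` is then injective, and `[F : k]² ≤ [F : k]`. -/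
theorem mem_range_algebraMap_of_isIntegral [IsDomain A]
    (hA : ∀ (F : Type u) [Field F] [Algebra k F], IsDomain (A ⊗[k] F)) (a : A)
    (ha : IsIntegral k a) : ∃ c : k, a = algebraMap k A c := by
  have hirr := minpoly.irreducible ha
  have : Fact (Irreducible (minpoly k a)) := ⟨hirr⟩
  let F := AdjoinRoot (minpoly k a)
  let ι : F →ₐ[k] A := AdjoinRoot.liftAlgHom (minpoly k a) (Algebra.ofId k A) a (minpoly.aeval k a)
  have : Module.Finite k F := (minpoly.monic ha).finite_adjoinRoot
  have hdom : IsDomain (A ⊗[k] F) := hA F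
  have hinj : Function.Injective (Algebra.TensorProduct.map ι (AlgHom.id k F)) :=
    Module.Flat.rTensor_preserves_injective_linearMap (M := F) ι.toLinearMap ι.toRingHom.injective
  have : IsDomain (F ⊗[k] F) := hinj.isDomain (Algebra.TensorProduct.map ι (AlgHom.id k F)).toRingHom
  have hf : IsField (F ⊗[k] F) := isField_of_isIntegral_of_isField' (Field.toIsField k)
  let := hf.toField
  have hμ : Function.Injective (Algebra.TensorProduct.lmul' k (S := F)) :=
    (Algebra.TensorProduct.lmul' k (S := F)).toRingHom.injective
  have h₁ := LinearMap.finrank_le_finrank_of_injective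
    (f := (Algebra.TensorProduct.lmul' k (S := F)).toLinearMap) hμ
  rw [Module.finrank_tensorProduct] at h₁
  have h₂ : 0 < Module.finrank k F := Module.finrank_pos
  have h₃ : Module.finrank k F = (minpoly k a).natDegree :=
    (AdjoinRoot.powerBasis hirr.ne_zero).finrank.trans (AdjoinRoot.powerBasis_dim hirr.ne_zero)
  have h₄ : (minpoly k a).natDegree = 1 := by
    rw [← h₃]
    nlinarith
  obtain ⟨c, hc⟩ := minpoly.natDegree_eq_one_iff.mp h₄
  exact ⟨c, hc.symm⟩

variable (p : A →ₐ[k] O) (q : B →ₐ[k] O)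
  [IsOpenImmersion (Spec.map (CommRingCat.ofHom p.toRingHom))]
  [IsOpenImmersion (Spec.map (CommRingCat.ofHom q.toRingHom))]

/-- The pair `a`, `b` glues to a map to the affine line, that is, to a global function; over a
universally closed morphism these are integral over the base. -/
theorem isIntegral_of_glued [UniversallyClosed (gluedHom p q)] (a : A) (b : B) (h : p a = q b) :
    IsIntegral k a := by
  let m : glued p q ⟶ Spec (.of (Polynomial k)) := pushout.desc
    (Spec.map (CommRingCat.ofHom (Polynomial.aeval a).toRingHom))
    (Spec.map (CommRingCat.ofHom (Polynomial.aeval b).toRingHom)) (by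
      rw [← Spec.map_comp, ← Spec.map_comp, ← CommRingCat.ofHom_comp, ← CommRingCat.ofHom_comp]
      congr 2
      have : p.comp (Polynomial.aeval a) = q.comp (Polynomial.aeval b) :=
        Polynomial.algHom_ext (by simpa using h)
      exact congr(($this).toRingHom))
  have hm : gluedInl p q ≫ m = Spec.map (CommRingCat.ofHom (Polynomial.aeval a).toRingHom) :=
    pushout.inl_desc _ _ _
  let s : Γ(glued p q, ⊤) := (m.appTop).hom ((Scheme.ΓSpecIso (.of (Polynomial k))).inv.hom .X)
  have hs := isIntegral_appTop_of_universallyClosed (gluedHom p q) s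
  let ev : Γ(glued p q, ⊤) →+* A :=
    ((gluedInl p q).appTop ≫ (Scheme.ΓSpecIso (.of A)).hom).hom
  have hev : ev s = a := by
    have h₁ : (Scheme.ΓSpecIso (.of (Polynomial k))).inv ≫ m.appTop ≫
        (gluedInl p q).appTop ≫ (Scheme.ΓSpecIso (.of A)).hom =
        CommRingCat.ofHom (Polynomial.aeval a).toRingHom := by
      rw [← Scheme.Hom.comp_appTop_assoc, hm, Scheme.ΓSpecIso_naturality, Iso.inv_hom_id_assoc]
    have h₂ := congr(($h₁).hom Polynomial.X)
    exact h₂.trans (Polynomial.aeval_X a)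
  have hev' : ev.comp (gluedHom p q).appTop.hom =
      (algebraMap k A).comp (Scheme.ΓSpecIso (.of k)).hom.hom := by
    have h₁ : (gluedHom p q).appTop ≫ (gluedInl p q).appTop ≫ (Scheme.ΓSpecIso (.of A)).hom =
        (Scheme.ΓSpecIso (.of k)).hom ≫ CommRingCat.ofHom (algebraMap k A) := by
      rw [← Scheme.Hom.comp_appTop_assoc, gluedInl_gluedHom, Scheme.ΓSpecIso_naturality]
    exact congr(($h₁).hom)
  obtain ⟨P, hP, hPs⟩ := hs
  refine ⟨P.map (Scheme.ΓSpecIso (.of k)).hom.hom, hP.map _, ?_⟩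
  rw [Polynomial.eval₂_map, ← hev', ← hev, ← Polynomial.hom_eval₂, hPs, map_zero]

end Constants

/-! ### Irreducibility of iterated square roots -/
section Irreducible
open Polynomial IntermediateField

/-- If `x = s²` in `K(x)`, then `e` is the norm of `s`, and `t + 2 e` is the square of its trace. -/
theorem exists_sq_eq_of_isSquare_gen {K : Type u} [Field K] {t m : K} {E : Type u} [Field E]
    [Algebra K E] (x : E) (hx : minpoly K x = X ^ 2 - C t * X + C m)
    (hsq : IsSquare (AdjoinSimple.gen K x)) : ∃ e : K, e ^ 2 = m ∧ IsSquare (t + 2 * e) := by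
  have hdeg : (minpoly K x).natDegree = 2 := by rw [hx]; compute_degree!
  have hint : IsIntegral K x := by
    by_contra h
    rw [minpoly.eq_zero h, natDegree_zero] at hdeg
    omega
  let g := AdjoinSimple.gen K x
  have hspan (s : K⟮x⟯) : ∃ a b : K, s = algebraMap K _ a + algebraMap K _ b * g := by
    obtain ⟨f, hf, rfl⟩ := (adjoin.powerBasis hint).exists_eq_aeval s
    rw [adjoin.powerBasis_dim, hdeg] at hf
    obtain ⟨b, a, rfl⟩ := exists_eq_X_add_C_of_natDegree_le_one (Nat.lt_succ_iff.mp hf)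
    exact ⟨a, b, by simp [add_comm, g]⟩
  have hind (a b : K) (h : algebraMap K K⟮x⟯ a + algebraMap K _ b * g = 0) : a = 0 ∧ b = 0 := by
    have h₁ : aeval x (C b * X + C a) = 0 := by
      have := congr(algebraMap K⟮x⟯ E $h)
      simpa [g, add_comm] using this
    have h₂ : C b * X + C a = (0 : K[X]) := by
      by_contra h0
      have h₃ := natDegree_le_of_dvd (minpoly.dvd K x h₁) h0
      have h₄ : (C b * X + C a).natDegree ≤ 1 := natDegree_linear_le
      omega
    exact ⟨by simpa using congr(($h₂).coeff 0), by simpa using congr(($h₂).coeff 1)⟩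
  have hg : g * g = algebraMap K _ t * g - algebraMap K _ m := by
    have h := minpoly.aeval K x
    rw [hx] at h
    apply (algebraMap K⟮x⟯ E).injective
    simp only [map_add, map_sub, map_mul, aeval_X, aeval_C, map_pow] at h
    simp only [map_sub, map_mul, g, AdjoinSimple.algebraMap_gen, ← IsScalarTower.algebraMap_apply]
    linear_combination h
  obtain ⟨s, hs⟩ := hsq
  obtain ⟨a, b, rfl⟩ := hspan s
  have h₁ := hind (a ^ 2 - b ^ 2 * m) (2 * a * b + b ^ 2 * t - 1) (by
    simp only [map_add, map_sub, map_mul, map_pow, map_one, map_ofNat]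
    linear_combination -hs - algebraMap K K⟮x⟯ b ^ 2 * hg)
  have hb : b ≠ 0 := by
    rintro rfl
    simpa using h₁.2
  -- For `s = a + b x`, the relations in `h₁` show that the norm of `s` is `a / b` and its trace is
  -- `1 / b`.
  refine ⟨a / b, ?_, 1 / b, ?_⟩
  · field_simp
    linear_combination h₁.1
  · field_simp
    linear_combination h₁.2

/-- Induction up the tower of square roots. A square root of `u` that is a square in `K(√u)` would
make its norm `-u` a square in `K`, hence also `u`, because `-1` is a square. -/
theorem irreducible_X_pow_two_pow_sub_C (r : ℕ) : ∀ {K : Type u} [Field K] (u : K)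
    (_ : ∃ i : K, i ^ 2 = -1) (_ : ¬ IsSquare u), Irreducible (X ^ 2 ^ r - C u) := by
  induction r with
  | zero => intro K _ u _ _; rw [pow_zero, pow_one]; exact irreducible_X_sub_C u
  | succ r ih =>
    rintro K _ u ⟨i, hi⟩ hu
    rw [pow_succ]
    refine X_pow_mul_sub_C_irreducible ?_ ?_
    · refine irreducible_of_degree_le_three_of_not_isRoot ?_ fun y hy ↦ hu ⟨y, ?_⟩
      · rw [natDegree_X_pow_sub_C]; decide
      · simp only [IsRoot.def, eval_sub, eval_pow, eval_X, eval_C] at hy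
        linear_combination -hy
    · intro E _ _ x hx
      refine ih _ ⟨algebraMap K _ i, by rw [← map_pow, hi, map_neg, map_one]⟩ fun hsq ↦ hu ?_
      obtain ⟨e, he, -⟩ := exists_sq_eq_of_isSquare_gen (t := 0) (m := -u) x (by simp [hx, sub_eq_add_neg]) hsq
      exact ⟨i * e, by linear_combination -(i ^ 2) * he + u * hi⟩

/-- The quadratic has discriminant `4 c² (a² - 1)`. A root has norm `c²` and trace `2 c a`, so it
can be a square in its field only if `2 c a + 2 c` or `2 c a - 2 c` is a square in `K`. -/
theorem irreducible_quadratic_comp {K : Type u} [Field K]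
    (hi : ∃ i : K, i ^ 2 = -1) (a c : K) (hc : c ≠ 0) (h₀ : ¬ IsSquare (a ^ 2 - 1))
    (h₁ : ¬ IsSquare (2 * c * (a + 1))) (h₁' : ¬ IsSquare (2 * c * (a - 1))) (r : ℕ) :
    Irreducible ((X ^ 2 - C (2 * c * a) * X + C (c ^ 2)).comp (X ^ 2 ^ r)) := by
  have hm : (X ^ 2 - C (2 * c * a) * X + C (c ^ 2)).Monic := by monicity!
  refine irreducible_comp hm (monic_X_pow _) ?_ ?_
  · refine irreducible_of_degree_le_three_of_not_isRoot ?_ fun y hy ↦ h₀ ⟨(y - c * a) / c, ?_⟩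
    · have : (X ^ 2 - C (2 * c * a) * X + C (c ^ 2)).natDegree = 2 := by compute_degree!
      rw [this]; decide
    · simp only [IsRoot.def, eval_sub, eval_add, eval_mul, eval_pow, eval_X, eval_C] at hy
      field_simp
      linear_combination -hy
  · intro E _ _ x hx
    rw [Polynomial.map_pow, map_X]
    obtain ⟨i, hi⟩ := hi
    refine irreducible_X_pow_two_pow_sub_C r _
      ⟨algebraMap K _ i, by rw [← map_pow, hi, map_neg, map_one]⟩ fun hsq ↦ ?_
    obtain ⟨e, he, hs⟩ := exists_sq_eq_of_isSquare_gen x hx hsq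
    rcases sq_eq_sq_iff_eq_or_eq_neg.mp he with rfl | rfl
    · exact h₁ (by convert hs using 1; ring)
    · exact h₁' (by convert hs using 1; ring)

/-- As `F[X]` is integrally closed, a square root of `g` would be a polynomial, and all root
multiplicities of `g` would be even. -/
theorem not_isSquare_algebraMap_of_odd_rootMultiplicity {F E : Type u} [Field F] [Field E]
    [Algebra F[X] E] [IsFractionRing F[X] E] (g : F[X]) (α : F) (h : Odd (g.rootMultiplicity α)) :
    ¬ IsSquare (algebraMap F[X] E g) := by
  rintro ⟨s, hs⟩
  have hint : IsIntegral F[X] s := by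
    refine IsIntegral.of_pow two_pos ?_
    rw [pow_two, ← hs]
    exact isIntegral_algebraMap
  obtain ⟨t, rfl⟩ := IsIntegrallyClosed.isIntegral_iff.mp hint
  rw [← map_mul] at hs
  have hg := IsFractionRing.injective F[X] E hs
  have hg0 : g ≠ 0 := by
    rintro rfl
    simp at h
  subst hg
  rw [rootMultiplicity_mul hg0] at h
  exact (Nat.not_odd_iff_even.mpr ⟨_, rfl⟩) h

/-- The polynomial `Z^(2n) - 2 c A Z^n + c²`, `n = 2^r`, whose roots are the `n`-th roots of
`c (A ± √(A² - 1))`. -/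
def coverPolynomial {R : Type u} [CommRing R] (a c : R) (r : ℕ) : R[X] :=
  (X ^ 2 - C (2 * c * a) * X + C (c ^ 2)).comp (X ^ 2 ^ r)

theorem monic_coverPolynomial {R : Type u} [CommRing R] [Nontrivial R] (a c : R) (r : ℕ) :
    (coverPolynomial a c r).Monic := by
  have hm : (X ^ 2 - C (2 * c * a) * X + C (c ^ 2)).Monic := by monicity!
  exact hm.comp (monic_X_pow _) (by rw [natDegree_X_pow]; positivity)

theorem map_coverPolynomial {R S : Type u} [CommRing R] [CommRing S] (f : R →+* S) (a c : R)
    (r : ℕ) : (coverPolynomial a c r).map f = coverPolynomial (f a) (f c) r := by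
  simp [coverPolynomial, map_ofNat f 2]

theorem irreducible_coverPolynomial {F E : Type u} [Field F] [CharZero F] [Field E]
    [Algebra F[X] E] [IsFractionRing F[X] E] (hi : ∃ i : F, i ^ 2 = -1) (A : F[X]) (c : F)
    (hc : c ≠ 0) (α β : F) (hα : Odd ((A - 1).rootMultiplicity α))
    (hβ : Odd ((A + 1).rootMultiplicity β)) (r : ℕ) :
    Irreducible (coverPolynomial (algebraMap F[X] E A) (algebraMap F[X] E (C c)) r) := by
  have hinj := IsFractionRing.injective F[X] E
  have hA1 : A - 1 ≠ 0 := by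
    intro h
    simp [h] at hα
  have hA1' : A + 1 ≠ 0 := by
    intro h
    simp [h] at hβ
  have hcmul (g : F[X]) (γ : F) (hg : g ≠ 0) (h : Odd (g.rootMultiplicity γ)) :
      ¬ IsSquare (2 * algebraMap F[X] E (C c) * algebraMap F[X] E g) := by
    have hcc : 2 * C c * g ≠ 0 := mul_ne_zero (mul_ne_zero two_ne_zero (C_ne_zero.mpr hc)) hg
    have := not_isSquare_algebraMap_of_odd_rootMultiplicity (E := E) (2 * C c * g) γ (by
      rw [rootMultiplicity_mul hcc, show (2 : F[X]) * C c = C (2 * c) by rw [C_mul, map_ofNat C 2], rootMultiplicity_C,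
        zero_add]
      exact h)
    rwa [map_mul, map_mul, map_ofNat] at this
  refine irreducible_quadratic_comp ?_ _ _ ?_ ?_ ?_ ?_ r
  · obtain ⟨i, hi⟩ := hi
    exact ⟨algebraMap F[X] E (C i), by rw [← map_pow, ← C_pow, hi]; simp⟩
  · rwa [Ne, map_eq_zero_iff _ hinj, C_eq_zero]
  · have h := not_isSquare_algebraMap_of_odd_rootMultiplicity (E := E) ((A - 1) * (A + 1)) α (by
      rw [rootMultiplicity_mul (mul_ne_zero hA1 hA1'), rootMultiplicity_eq_zero (p := A + 1),
        add_zero]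
      · exact hα
      · intro h
        have h' : (A - 1).IsRoot α := (rootMultiplicity_pos hA1).mp hα.pos
        simp only [IsRoot.def, eval_add, eval_sub, eval_one] at h h'
        exact two_ne_zero (α := F) (by linear_combination h - h'))
    convert h using 2
    simp only [map_mul, map_sub, map_add, map_one]
    ring
  · convert hcmul (A + 1) β hA1' hβ using 3
    simp
  · convert hcmul (A - 1) α hA1 hα using 3
    simp

end Irreducible

/-! ### The function field of the cyclic cover. -/

section CoverField
open Polynomial

theorem powerBasisAux'_apply {R : Type u} [CommRing R] {P : R[X]} (hP : P.Monic)
    (i : Fin P.natDegree) : AdjoinRoot.powerBasisAux' hP i = AdjoinRoot.root P ^ (i : ℕ) :=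
  (AdjoinRoot.powerBasis' hP).basis_eq_pow i

/-- The monomials in `X` and the root of `P` form a `k`-basis of `AdjoinRoot P`. Independence of
their images over `F` embeds the base change into the field `L`. -/
theorem isDomain_tensorProduct_adjoinRoot {k F L : Type u} [Field k] [Field F] [Field L]
    [Algebra k F] [Algebra F L] [Algebra k L] [IsScalarTower k F L] (P : k[X][X]) (hP : P.Monic)
    (t ζ : L) (hζ : eval₂ (aeval t : k[X] →ₐ[k] L).toRingHom ζ P = 0)
    (hli : LinearIndependent F fun p : ℕ × Fin P.natDegree ↦ t ^ p.1 • ζ ^ (p.2 : ℕ)) :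
    IsDomain (F ⊗[k] AdjoinRoot P) := by
  let ψ : AdjoinRoot P →ₐ[k] L := AdjoinRoot.liftAlgHom P (aeval t) ζ hζ
  let Φ : F ⊗[k] AdjoinRoot P →ₐ[F] L :=
    Algebra.TensorProduct.lift (Algebra.ofId F L) ψ fun _ _ ↦ Commute.all _ _
  let b : Module.Basis (ℕ × Fin P.natDegree) k (AdjoinRoot P) :=
    (Polynomial.basisMonomials k).smulTower (AdjoinRoot.powerBasisAux' hP)
  have hb (p : ℕ × Fin P.natDegree) : Φ (b.baseChange F p) = t ^ p.1 • ζ ^ (p.2 : ℕ) := by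
    rw [Module.Basis.baseChange_apply, show b p = _ from Module.Basis.smulTower_apply _ _ p,
      Algebra.smul_def]
    have h₁ : ψ (algebraMap k[X] (AdjoinRoot P) (Polynomial.basisMonomials k p.1)) = t ^ p.1 := by
      change ψ (AdjoinRoot.of P _) = _
      rw [coe_basisMonomials]
      exact (AdjoinRoot.lift_of hζ).trans (by simp [aeval_monomial])
    have h₂ : ψ (AdjoinRoot.powerBasisAux' hP p.2) = ζ ^ (p.2 : ℕ) := by
      rw [powerBasisAux'_apply, map_pow]
      exact congr($(AdjoinRoot.lift_root hζ) ^ _)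
    simp only [Φ, Algebra.TensorProduct.lift_tmul, map_one, one_mul, map_mul, h₁, h₂, smul_eq_mul]
  have hinj : Function.Injective Φ := by
    rw [injective_iff_map_eq_zero]
    intro v hv
    rw [← (b.baseChange F).linearCombination_repr v] at hv ⊢
    have h := Finsupp.apply_linearCombination F Φ.toLinearMap (b.baseChange F)
      ((b.baseChange F).repr v)
    rw [show Φ.toLinearMap _ = 0 from hv, show ⇑Φ.toLinearMap ∘ ⇑(b.baseChange F) = _ from
      funext hb] at h
    rw [linearIndependent_iff.mp hli _ h.symm, map_zero]
  exact hinj.isDomain Φ.toRingHom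

theorem linearIndependent_adjoinRoot {F : Type u} [Field F] (P : (FractionRing F[X])[X])
    (hP : P.Monic) : LinearIndependent F fun p : ℕ × Fin P.natDegree ↦
      (algebraMap F[X] (AdjoinRoot P) X) ^ p.1 • (AdjoinRoot.root P) ^ (p.2 : ℕ) := by
  have h₁ : LinearIndependent F fun n : ℕ ↦ (algebraMap F[X] (FractionRing F[X]) (X ^ n)) := by
    have := (Polynomial.basisMonomials F).linearIndependent.map'
      (Algebra.linearMap F[X] (FractionRing F[X]) |>.restrictScalars F)
      (LinearMap.ker_eq_bot.mpr (IsFractionRing.injective _ _))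
    have he : (fun n : ℕ ↦ (algebraMap F[X] (FractionRing F[X]) (X ^ n))) =
        (Algebra.linearMap F[X] (FractionRing F[X]) |>.restrictScalars F) ∘
          (Polynomial.basisMonomials F) := by
      ext n
      simp [X_pow_eq_monomial]
    rw [he]
    exact this
  have h₂ := (AdjoinRoot.powerBasisAux' hP).linearIndependent
  have h₃ := linearIndependent_smul h₁ h₂
  refine (congr(LinearIndependent F $(_root_.funext fun p ↦ ?_))).mpr h₃
  rw [powerBasisAux'_apply, ← map_pow, smul_eq_mul, ← Algebra.smul_def, algebraMap_smul]

/-- The irreducibility criterion involves only root multiplicities and a square root of `-1`, which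
survive any extension of scalars; so `L` can be the extension of `F(X)` cut out by the same
polynomial. -/
theorem isDomain_tensorProduct_coverRing {k : Type u} [Field k] [CharZero k]
    (hi : ∃ i : k, i ^ 2 = -1) (A : k[X]) (c : k) (hc : c ≠ 0) (α β : k)
    (hα : Odd ((A - 1).rootMultiplicity α)) (hβ : Odd ((A + 1).rootMultiplicity β)) (r : ℕ)
    (F : Type u) [Field F] [Algebra k F] :
    IsDomain (F ⊗[k] AdjoinRoot (coverPolynomial A (C c) r)) := by
  have : CharZero F := charZero_of_injective_algebraMap (algebraMap k F).injective
  let E := FractionRing F[X]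
  have hinj := (algebraMap k F).injective
  let g : k[X] →+* E := (algebraMap F[X] E).comp (mapRingHom (algebraMap k F))
  have hirr : Irreducible ((coverPolynomial A (C c) r).map g) := by
    rw [map_coverPolynomial]
    have h := irreducible_coverPolynomial (F := F) (E := E)
      (by obtain ⟨i, hi⟩ := hi
          exact ⟨algebraMap k F i, by rw [← map_pow, hi, map_neg, map_one]⟩)
      (A.map (algebraMap k F)) (algebraMap k F c) (by simpa using hc) (algebraMap k F α)
      (algebraMap k F β)
      (by rwa [← Polynomial.map_one (algebraMap k F), ← Polynomial.map_sub,
            ← eq_rootMultiplicity_map hinj])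
      (by rwa [← Polynomial.map_one (algebraMap k F), ← Polynomial.map_add,
            ← eq_rootMultiplicity_map hinj]) r
    simpa [g] using h
  have hm := monic_coverPolynomial A (C c) r
  have : Fact (Irreducible ((coverPolynomial A (C c) r).map g)) := ⟨hirr⟩
  let L := AdjoinRoot ((coverPolynomial A (C c) r).map g)
  have hli := linearIndependent_adjoinRoot ((coverPolynomial A (C c) r).map g) (hm.map g)
  refine isDomain_tensorProduct_adjoinRoot (F := F) (L := L) _ hm
    (algebraMap F[X] L X) (AdjoinRoot.root _) ?_ ?_
  · have h := AdjoinRoot.eval₂_root ((coverPolynomial A (C c) r).map g)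
    rw [eval₂_map] at h
    have he : (aeval (algebraMap F[X] L X) : k[X] →ₐ[k] L).toRingHom =
        (AdjoinRoot.of ((coverPolynomial A (C c) r).map g)).comp g := by
      ext a
      · have : g (C a) = algebraMap k E a := by
          simp only [g, RingHom.comp_apply, coe_mapRingHom, map_C]
          rw [IsScalarTower.algebraMap_apply k F E, IsScalarTower.algebraMap_apply F F[X] E]
          rfl
        simp only [AlgHom.toRingHom_eq_coe, RingHom.comp_apply, RingHom.coe_coe, aeval_C, this]
        rfl
      · have : g X = algebraMap F[X] E X := by simp [g]
        simp only [AlgHom.toRingHom_eq_coe, RingHom.comp_apply, RingHom.coe_coe, aeval_X, this]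
        rfl
    rw [he]
    exact h
  · exact hli.comp (Prod.map id (Fin.cast (hm.natDegree_map g).symm))
      (Function.injective_id.prodMap (Fin.cast_injective _))

theorem isDomain_tensorProduct_fractionRing {k S : Type u} [Field k] [CommRing S] [IsDomain S]
    [Algebra k S] (F : Type u) [Field F] [Algebra k F] (h : IsDomain (F ⊗[k] S)) :
    IsDomain (FractionRing S ⊗[k] F) := by
  have h' : IsDomain (S ⊗[k] F) := (Algebra.TensorProduct.comm k S F).toMulEquiv.isDomain _
  let φ : S ⊗[k] F →ₐ[S] FractionRing S ⊗[k] F :=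
    Algebra.TensorProduct.map (Algebra.ofId S (FractionRing S)) (AlgHom.id k F)
  let := φ.toRingHom.toAlgebra
  have : IsScalarTower S (S ⊗[k] F) (FractionRing S ⊗[k] F) :=
    .of_algebraMap_eq fun s ↦ (φ.commutes s).symm
  have := IsLocalization.tensorProduct_tensorProduct k F (nonZeroDivisors S) (FractionRing S) (by
    ext f
    change Algebra.TensorProduct.map (Algebra.ofId S (FractionRing S)) (AlgHom.id k F)
      (1 ⊗ₜ f) = _
    simp)
  refine IsLocalization.isDomain_of_le_nonZeroDivisors
    (M := Algebra.algebraMapSubmonoid (S ⊗[k] F) (nonZeroDivisors S)) _ ?_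
  rintro _ ⟨s, hs, rfl⟩
  refine mem_nonZeroDivisors_of_ne_zero fun h0 ↦ nonZeroDivisors.ne_zero hs ?_
  exact Algebra.TensorProduct.includeLeft_injective (R := k) (S := k) (A := S) (B := F)
    (algebraMap k F).injective (h0.trans (map_zero _).symm)

theorem eval₂_coverPolynomial {R S : Type u} [CommRing R] [CommRing S] (f : R →+* S) (z : S)
    (a c : R) (r : ℕ) : eval₂ f z (coverPolynomial a c r) =
      (z ^ 2 ^ r) ^ 2 - 2 * f c * f a * z ^ 2 ^ r + f c ^ 2 := by
  simp [coverPolynomial, eval₂_pow, map_ofNat f 2]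

/-- The cover polynomial is the norm of `Z ^ n - c (A + B y)` and no longer mentions `y`; here `y`
is recovered by solving `t = c (a + b y)` with `t = z ^ n`. -/
theorem cover_identities {K : Type u} [Field K] {a b c d t : K} (hc : c ≠ 0) (hb : b ≠ 0)
    (ht : t ^ 2 - 2 * c * a * t + c ^ 2 = 0) (h : a ^ 2 - d * b ^ 2 = 1) :
    ((t / c - a) / b) ^ 2 = d ∧ t = c * (a + b * ((t / c - a) / b)) := by
  constructor
  · field_simp
    linear_combination ht + c ^ 2 * h
  · field_simp
    ring

/-- The function field of the cover `z^n = c (A(x) + B(x) y)` of the curve `y² = D(x)`. -/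
theorem exists_cover_field {k : Type u} [Field k] [CharZero k]
    (hi : ∃ i : k, i ^ 2 = -1) (A B D : k[X]) (hAB : A ^ 2 - D * B ^ 2 = 1) (c : k) (hc : c ≠ 0)
    (α β : k) (hα : Odd ((A - 1).rootMultiplicity α)) (hβ : Odd ((A + 1).rootMultiplicity β))
    (r : ℕ) : ∃ (K : Type u) (_ : Field K) (_ : Algebra k K) (x y z : K),
      Transcendental k x ∧ y ^ 2 = aeval x D ∧
      z ^ 2 ^ r = algebraMap k K c * (aeval x A + aeval x B * y) ∧
      ∀ (F : Type u) [Field F] [Algebra k F], IsDomain (K ⊗[k] F) := by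
  let S := AdjoinRoot (coverPolynomial A (C c) r)
  have hm := monic_coverPolynomial A (C c) r
  have hdom := isDomain_tensorProduct_coverRing hi A c hc α β hα hβ r
  have := hdom k
  have : IsDomain S := (Algebra.TensorProduct.lid k S).symm.toMulEquiv.isDomain _
  have : Module.Free k[X] S := hm.free_adjoinRoot
  have hinj₁ : Function.Injective (algebraMap k[X] S) := FaithfulSMul.algebraMap_injective _ _
  let K := FractionRing S
  let x : K := algebraMap S K (algebraMap k[X] S X)
  let z : K := algebraMap S K (AdjoinRoot.root _)
  have hx (Q : k[X]) : aeval x Q = algebraMap S K (algebraMap k[X] S Q) := by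
    rw [aeval_algebraMap_apply, aeval_algebraMap_apply, aeval_X_left_apply]
  have hinj (Q : k[X]) (hQ : Q ≠ 0) : aeval x Q ≠ 0 := by
    rw [hx]
    exact fun h ↦ hQ (hinj₁ (IsFractionRing.injective S K (by rw [h, map_zero, map_zero])))
  -- Division by `B` is needed to define `y`. If `B = 0`, then `A` is constant and `A - 1` has no
  -- root of odd multiplicity.
  have hB : B ≠ 0 := by
    rintro rfl
    have hA : IsUnit A := IsUnit.of_mul_eq_one A (by linear_combination hAB)
    obtain ⟨a, ha⟩ := natDegree_eq_zero.mp (natDegree_eq_zero_of_isUnit hA)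
    rw [← ha, ← C_1, ← C_sub, rootMultiplicity_C] at hα
    exact Nat.not_odd_zero hα
  have hcK : algebraMap k K c ≠ 0 := by simpa using hc
  have hBK := hinj B hB
  have hz : (z ^ 2 ^ r) ^ 2 - 2 * algebraMap k K c * aeval x A * z ^ 2 ^ r +
      algebraMap k K c ^ 2 = 0 := by
    have h := congr(algebraMap S K $(AdjoinRoot.eval₂_root (coverPolynomial A (C c) r)))
    rw [hom_eval₂, eval₂_coverPolynomial, map_zero] at h
    have hAx : algebraMap S K (AdjoinRoot.of _ A) = aeval x A := (hx A).symm
    have hcx : algebraMap S K (AdjoinRoot.of _ (C c)) = algebraMap k K c :=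
      (hx (C c)).symm.trans (aeval_C x c)
    rwa [RingHom.comp_apply, RingHom.comp_apply, hAx, hcx] at h
  refine ⟨K, inferInstance, inferInstance, x, (z ^ 2 ^ r / algebraMap k K c - aeval x A) /
    aeval x B, z, ?_, ?_, ?_, fun F _ _ ↦ isDomain_tensorProduct_fractionRing F (hdom F)⟩
  · rw [transcendental_iff]
    exact fun Q hQ ↦ by_contra fun h ↦ hinj Q h hQ
  · have h := congr(aeval x $hAB)
    simp only [map_sub, map_mul, map_pow, map_one] at h
    exact (cover_identities hcK hBK hz h).1
  · have h := congr(aeval x $hAB)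
    simp only [map_sub, map_mul, map_pow, map_one] at h
    exact (cover_identities hcK hBK hz h).2

end CoverField

/-! ### Smoothness of double covers -/
section Chart
open Polynomial

/-- The differential `dx / (2y)` on a curve `y² = P(x)`, where `a P + b P' = 1`. -/
def chartForm {k C : Type u} [Field k] [CommRing C] [Algebra k C] (a b : k[X]) (x y : C) :
    Ω[C⁄k] :=
  (algebraMap k C 2⁻¹ * aeval x a * y) • KaehlerDifferential.D k C x +
    aeval x b • KaehlerDifferential.D k C y

variable {k C : Type u} [Field k] [CharZero k] [CommRing C] [Algebra k C] {P a b : k[X]} {x y : C}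

theorem D_chart_relation (hy : y ^ 2 = aeval x P) :
    (2 * y) • KaehlerDifferential.D k C y =
      aeval x (derivative P) • KaehlerDifferential.D k C x := by
  have h := congrArg (KaehlerDifferential.D k C) hy
  rw [Derivation.leibniz_pow, Derivation.map_aeval] at h
  rw [← h, ← Nat.cast_smul_eq_nsmul C, smul_smul]
  simp

theorem algebraMap_half : (2 : C) * algebraMap k C 2⁻¹ = 1 := by
  rw [← map_ofNat (algebraMap k C) 2, ← map_mul, mul_inv_cancel₀ two_ne_zero, map_one]

theorem D_eq_smul_chartForm (hy : y ^ 2 = aeval x P) (hab : a * P + b * derivative P = 1) :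
    KaehlerDifferential.D k C x = (2 * y) • chartForm a b x y := by
  have h := D_chart_relation (k := k) hy
  have h₂ := algebraMap_half (k := k) (C := C)
  have h₁ := congrArg (aeval x) hab
  simp only [map_add, map_mul, map_one] at h₁
  have h₃ := mul_smul (aeval x b) (2 * y) (KaehlerDifferential.D k C y)
  rw [h, smul_smul] at h₃
  rw [chartForm, smul_add, smul_smul, smul_smul, mul_comm (2 * y) (aeval x b), h₃, ← add_smul]
  have : 2 * y * (algebraMap k C 2⁻¹ * aeval x a * y) + aeval x b * aeval x (derivative P) = 1 := by
    linear_combination h₁ + aeval x a * (y ^ 2 * h₂ + hy)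
  rw [this, one_smul]

theorem D_eq_smul_chartForm' (hy : y ^ 2 = aeval x P) (hab : a * P + b * derivative P = 1) :
    KaehlerDifferential.D k C y = aeval x (derivative P) • chartForm a b x y := by
  have h := D_chart_relation (k := k) hy
  have h₂ := algebraMap_half (k := k) (C := C)
  have h₁ := congrArg (aeval x) hab
  simp only [map_add, map_mul, map_one] at h₁
  have h₃ := mul_smul (algebraMap k C 2⁻¹ * aeval x a * y) (aeval x (derivative P))
    (KaehlerDifferential.D k C x)
  rw [← h, smul_smul] at h₃
  rw [chartForm, smul_add, smul_smul, smul_smul, mul_comm (aeval x (derivative P)), h₃, ← add_smul]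
  have : algebraMap k C 2⁻¹ * aeval x a * y * (2 * y) + aeval x (derivative P) * aeval x b = 1 := by
    linear_combination h₁ + aeval x a * (y ^ 2 * h₂ + hy)
  rw [this, one_smul]

/-- Both `dx = 2y ω` and `dy = P'(x) ω` are multiples of `ω = chartForm a b x y`; this form makes
sense even where `y` vanishes, thanks to the Bézout relation. -/
theorem exists_eq_smul_chartForm (hy : y ^ 2 = aeval x P) (hab : a * P + b * derivative P = 1)
    (hs : Submodule.span C {KaehlerDifferential.D k C x, KaehlerDifferential.D k C y} = ⊤)
    (ω : Ω[C⁄k]) : ∃ c : C, ω = c • chartForm a b x y := by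
  have h : ω ∈ Submodule.span C {KaehlerDifferential.D k C x, KaehlerDifferential.D k C y} := by
    rw [hs]; trivial
  obtain ⟨c, d, rfl⟩ := Submodule.mem_span_pair.1 h
  refine ⟨c * (2 * y) + d * aeval x (derivative P), ?_⟩
  rw [add_smul, mul_smul c, mul_smul d, ← D_eq_smul_chartForm hy hab, ← D_eq_smul_chartForm' hy hab]

theorem isStandardSmoothOfRelativeDimension_polynomial :
    Algebra.IsStandardSmoothOfRelativeDimension 1 k k[X] := by
  let b : Module.Basis Unit k[X] (Ω[k[X]⁄k]) :=
    (Module.Basis.singleton Unit k[X]).map (KaehlerDifferential.polynomialEquiv k).symm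
  have hb : Set.range b ⊆ Set.range (KaehlerDifferential.D k k[X]) := by
    rintro _ ⟨i, rfl⟩
    refine ⟨X, ?_⟩
    simp [b]
  have := Algebra.IsStandardSmooth.of_basis_kaehlerDifferential b hb
  rw [Algebra.IsStandardSmoothOfRelativeDimension.iff_of_isStandardSmooth]
  rw [rank_eq_card_basis b]
  simp

/-- The element `t` makes `C` étale over `k[t]`: torsion-free over a principal ideal domain gives
flat, and `dt` generating the differentials gives unramified. -/
theorem isStandardSmoothOfRelativeDimension_one [IsDomain C] [Algebra.FiniteType k C] (t : C)
    (ht : Transcendental k t) (hs : ∀ ω : Ω[C⁄k], ∃ c : C, ω = c • KaehlerDifferential.D k C t) :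
    Algebra.IsStandardSmoothOfRelativeDimension 1 k C := by
  let : Algebra k[X] C := (aeval t).toAlgebra
  have hmap : ∀ f : k[X], algebraMap k[X] C f = aeval t f := fun _ ↦ rfl
  have : IsScalarTower k k[X] C := IsScalarTower.of_algebraMap_eq fun r ↦ by simp [hmap]
  have : Algebra.FiniteType k[X] C := Algebra.FiniteType.of_restrictScalars_finiteType k k[X] C
  have : Algebra.FinitePresentation k[X] C := Algebra.FinitePresentation.of_finiteType.1 inferInstance
  have hinj : Function.Injective (algebraMap k[X] C) := transcendental_iff_injective.1 ht
  have : FaithfulSMul k[X] C := (faithfulSMul_iff_algebraMap_injective _ _).2 hinj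
  have : Module.IsTorsionFree k[X] C := inferInstance
  have : Module.Flat k[X] C := inferInstance
  have : Algebra.FormallyUnramified k[X] C := by
    rw [Algebra.formallyUnramified_iff]
    have hz : ∀ ω : Ω[C⁄k[X]], ω = 0 := by
      intro ω
      obtain ⟨η, rfl⟩ := KaehlerDifferential.map_surjective k k[X] C ω
      obtain ⟨c, rfl⟩ := hs η
      rw [map_smul, KaehlerDifferential.map_D]
      have : algebraMap C C t = algebraMap k[X] C X := by simp [hmap]
      rw [this, Derivation.map_algebraMap, smul_zero]
    exact ⟨fun u v ↦ by rw [hz u, hz v]⟩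
  have : Algebra.Etale k[X] C := Algebra.Etale.of_formallyUnramified_of_flat
  have h0 : Algebra.IsStandardSmoothOfRelativeDimension 0 k[X] C :=
    Algebra.Etale.iff_isStandardSmoothOfRelativeDimension_zero.1 this
  have h1 : Algebra.IsStandardSmoothOfRelativeDimension 1 k k[X] :=
    isStandardSmoothOfRelativeDimension_polynomial
  exact Algebra.IsStandardSmoothOfRelativeDimension.trans 1 0 k k[X] C

theorem transcendental_of_sq_eq_aeval (hx : Transcendental k x) (hP : P.natDegree ≠ 0)
    (hy : y ^ 2 = aeval x P) : Transcendental k y := by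
  intro h
  have := h.pow 2
  rw [hy] at this
  exact hx.aeval P hP (mem_nonZeroDivisors_of_ne_zero
    (leadingCoeff_ne_zero.2 fun h ↦ hP (by rw [h, natDegree_zero]))) this

theorem isStandardSmoothOfRelativeDimension_away [IsDomain C] [Algebra.FiniteType k C] (t s : C)
    (η : Ω[C⁄k]) (hη : ∀ ω, ∃ c : C, ω = c • η) (ht : KaehlerDifferential.D k C t = s • η)
    (hs : s ≠ 0) (htr : Transcendental k t) :
    Algebra.IsStandardSmoothOfRelativeDimension 1 k (Localization.Away s) := by
  have : IsDomain (Localization.Away s) :=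
    IsLocalization.isDomain_localization (powers_le_nonZeroDivisors_of_noZeroDivisors hs)
  have : Algebra.FiniteType C (Localization.Away s) :=
    inferInstance
  have : Algebra.FiniteType k (Localization.Away s) := Algebra.FiniteType.trans (S := C) inferInstance this
  have hinj : Function.Injective (algebraMap C (Localization.Away s)) :=
    IsLocalization.injective _ (powers_le_nonZeroDivisors_of_noZeroDivisors hs)
  refine isStandardSmoothOfRelativeDimension_one (algebraMap C (Localization.Away s) t)
    ((transcendental_algebraMap_iff hinj).2 htr) fun ω ↦ ?_
  obtain ⟨⟨ω₁, d⟩, h⟩ := IsLocalizedModule.surj (Submonoid.powers s)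
    (KaehlerDifferential.map k k C (Localization.Away s)) ω
  obtain ⟨c, hc⟩ := hη ω₁
  obtain ⟨u, hu⟩ := (IsLocalization.map_units (Localization.Away s) d).exists_left_inv
  obtain ⟨v, hv⟩ := (IsLocalization.Away.algebraMap_isUnit (S := Localization.Away s) s).exists_left_inv
  refine ⟨u * algebraMap _ _ c * v, ?_⟩
  have h₁ := KaehlerDifferential.map_D k k C (Localization.Away s) t
  rw [ht, map_smul, algebra_compatible_smul (Localization.Away s)] at h₁
  change d.1 • ω = _ at h
  dsimp only at h
  rw [hc, map_smul, algebra_compatible_smul (Localization.Away s),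
    algebra_compatible_smul (Localization.Away s) c] at h
  rw [← h₁, smul_smul, mul_assoc _ v, hv, mul_one, mul_smul, ← h, smul_smul, hu, one_smul]

/-- By the Bézout relation the loci `2y ≠ 0` and `P'(x) ≠ 0` cover the chart; `x` is a coordinate on
the first and `y` on the second. -/
theorem locally_isStandardSmoothOfRelativeDimension [IsDomain C] [Algebra.FiniteType k C]
    (hx : Transcendental k x) (hP : P.natDegree ≠ 0)
    (hy : y ^ 2 = aeval x P) (hab : a * P + b * derivative P = 1)
    (hs : Submodule.span C {KaehlerDifferential.D k C x, KaehlerDifferential.D k C y} = ⊤) :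
    RingHom.Locally (RingHom.IsStandardSmoothOfRelativeDimension 1) (algebraMap k C) := by
  have hytr := transcendental_of_sq_eq_aeval hx hP hy
  have h₁ := congrArg (aeval x) hab
  simp only [map_add, map_mul, map_one] at h₁
  have h2 : (2 : C) ≠ 0 := by
    intro h
    have := algebraMap_half (k := k) (C := C)
    rw [h, zero_mul] at this
    exact zero_ne_one this
  refine ⟨{2 * y, aeval x (derivative P)}, ?_, ?_⟩
  · rw [Ideal.eq_top_iff_one, Ideal.mem_span_pair]
    refine ⟨algebraMap k C 2⁻¹ * aeval x a * y, aeval x b, ?_⟩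
    linear_combination h₁ + aeval x a * (y ^ 2 * (algebraMap_half (k := k) (C := C)) + hy)
  · have key : ∀ t s : C, KaehlerDifferential.D k C t = s • chartForm a b x y → s ≠ 0 →
        Transcendental k t → RingHom.IsStandardSmoothOfRelativeDimension 1
          ((algebraMap C (Localization.Away s)).comp (algebraMap k C)) := by
      intro t s ht hs0 htr
      rw [← IsScalarTower.algebraMap_eq k C (Localization.Away s),
        RingHom.isStandardSmoothOfRelativeDimension_algebraMap]
      exact isStandardSmoothOfRelativeDimension_away t s _ (exists_eq_smul_chartForm hy hab hs) ht
        hs0 htr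
    rintro s (rfl | rfl)
    · refine key x _ (D_eq_smul_chartForm hy hab) (mul_ne_zero h2 ?_) hx
      rintro rfl
      exact hytr isAlgebraic_zero
    · refine key y _ (D_eq_smul_chartForm' hy hab) ?_ hytr
      intro h
      have hd := (transcendental_iff.1 hx) _ h
      exact hP (derivative_eq_zero.1 hd)

/-- If the generator vanished, `C` would be unramified over `k`, hence finite, against the
transcendence of `x`. -/
theorem chartForm_ne_zero [IsDomain C] [Algebra.FiniteType k C]
    (hx : Transcendental k x) (hy : y ^ 2 = aeval x P) (hab : a * P + b * derivative P = 1)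
    (hs : Submodule.span C {KaehlerDifferential.D k C x, KaehlerDifferential.D k C y} = ⊤) :
    chartForm a b x y ≠ 0 := by
  intro h
  have : Algebra.FormallyUnramified k C := by
    rw [Algebra.formallyUnramified_iff]
    refine ⟨fun u v ↦ ?_⟩
    obtain ⟨c, rfl⟩ := exists_eq_smul_chartForm hy hab hs u
    obtain ⟨d, rfl⟩ := exists_eq_smul_chartForm hy hab hs v
    rw [h, smul_zero, smul_zero]
  have : Algebra.EssFiniteType k C := inferInstance
  have := Algebra.FormallyUnramified.finite_of_free k C
  exact hx (Algebra.IsAlgebraic.isAlgebraic x)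

end Chart

/-! ### Affine charts of a cyclic cover of a double cover of the line -/
section CoverChart
open Polynomial
variable {k C : Type u} [Field k] [CharZero k] [CommRing C] [Algebra k C] {x y u v : C}

theorem D_mem_of_adjoin_eq_top {s : Set C} (hs : Algebra.adjoin k s = ⊤) (M : Submodule C (Ω[C⁄k]))
    (hM : ∀ a ∈ s, KaehlerDifferential.D k C a ∈ M) : M = ⊤ := by
  rw [eq_top_iff, ← KaehlerDifferential.span_range_derivation, Submodule.span_le]
  rintro _ ⟨a, rfl⟩
  have ha : a ∈ Algebra.adjoin k s := by rw [hs]; trivial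
  induction ha using Algebra.adjoin_induction with
  | mem a ha => exact hM a ha
  | algebraMap r => rw [Derivation.map_algebraMap]; exact M.zero_mem
  | add a b _ _ ha hb => rw [map_add]; exact M.add_mem ha hb
  | mul a b _ _ ha hb =>
    rw [Derivation.leibniz]
    exact M.add_mem (M.smul_mem _ hb) (M.smul_mem _ ha)

theorem D_aeval_mem (M : Submodule C (Ω[C⁄k])) (hx : KaehlerDifferential.D k C x ∈ M) (f : k[X]) :
    KaehlerDifferential.D k C (aeval x f) ∈ M := by
  rw [Derivation.map_aeval]
  exact M.smul_mem _ hx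

variable {a b e : k[X]} {n : ℕ} {c : k}

/-- This expresses that the cover is unramified. Differentiating `u ^ n`, `v ^ n` and `u v` puts `u
^ n du` and `v ^ n du` in `M`. Now `a(x)` is a combination of `u ^ n` and `v ^ n`, while `e(x) ^ n =
u ^ n v ^ n`; coprimality of `a` and `e` leaves `du` itself. -/
theorem D_cover_mem (hn : n ≠ 0) (hc : c ≠ 0) (M : Submodule C (Ω[C⁄k]))
    (hx : KaehlerDifferential.D k C x ∈ M) (hy : KaehlerDifferential.D k C y ∈ M)
    (huv : u * v = aeval x e) (hae : IsCoprime a e)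
    (hu : u ^ n = algebraMap k C c * (aeval x a + aeval x b * y))
    (hv : v ^ n = algebraMap k C c⁻¹ * (aeval x a - aeval x b * y)) :
    KaehlerDifferential.D k C u ∈ M := by
  have hg : ∀ (d : k) (f : k[X]), KaehlerDifferential.D k C
      (algebraMap k C d * (aeval x a + aeval x f * y)) ∈ M := fun d f ↦ by
    rw [Derivation.leibniz, Derivation.map_algebraMap, smul_zero, add_zero, map_add,
      Derivation.leibniz]
    exact M.smul_mem _ (M.add_mem (D_aeval_mem M hx _)
      (M.add_mem (M.smul_mem _ hy) (M.smul_mem _ (D_aeval_mem M hx _))))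
  have hpow : ∀ t : C, KaehlerDifferential.D k C (t ^ n) ∈ M →
      t ^ (n - 1) • KaehlerDifferential.D k C t ∈ M := fun t ht ↦ by
    rw [Derivation.leibniz_pow, ← Nat.cast_smul_eq_nsmul k] at ht
    have := (M.restrictScalars k).smul_mem (n : k)⁻¹ ht
    rwa [smul_smul, inv_mul_cancel₀ (Nat.cast_ne_zero.2 hn), one_smul] at this
  have h₁ := hpow u (by rw [hu]; exact hg _ _)
  have h₂ := hpow v (by
    rw [hv, sub_eq_add_neg, ← neg_mul, ← map_neg]; exact hg _ _)
  have hun : u ^ n • KaehlerDifferential.D k C u ∈ M := by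
    have := M.smul_mem u h₁
    rwa [smul_smul, mul_pow_sub_one hn] at this
  have hvn : v ^ n • KaehlerDifferential.D k C u ∈ M := by
    have h := D_aeval_mem M hx e
    rw [← huv, Derivation.leibniz] at h
    have h := M.smul_mem (v ^ (n - 1)) h
    rw [smul_add, smul_smul, smul_smul, pow_sub_one_mul hn, mul_comm, mul_smul] at h
    exact (M.add_mem_iff_right (M.smul_mem u h₂)).1 h
  have ha : aeval x a • KaehlerDifferential.D k C u ∈ M := by
    have : aeval x a = algebraMap k C (2⁻¹ * c⁻¹) * u ^ n + algebraMap k C (2⁻¹ * c) * v ^ n := by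
      rw [hu, hv]
      have h2 : (algebraMap k C 2⁻¹) * 2 = 1 := by
        rw [← map_ofNat (algebraMap k C) 2, ← map_mul, inv_mul_cancel₀ two_ne_zero, map_one]
      have h3 : (algebraMap k C c⁻¹) * algebraMap k C c = 1 := by
        rw [← map_mul, inv_mul_cancel₀ hc, map_one]
      rw [map_mul, map_mul]
      linear_combination -aeval x a * h2 - (algebraMap k C 2⁻¹) * 2 * aeval x a * h3
    rw [this, add_smul, mul_smul, mul_smul]
    exact M.add_mem (M.smul_mem _ hun) (M.smul_mem _ hvn)
  have he : aeval x (e ^ n) • KaehlerDifferential.D k C u ∈ M := by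
    rw [map_pow, ← huv, mul_pow, mul_comm, mul_smul]
    exact M.smul_mem _ hun
  obtain ⟨f, g, hfg⟩ := hae.pow_right (n := n)
  have h := congrArg (aeval x) hfg
  rw [map_add, map_mul, map_mul, map_one] at h
  rw [← one_smul C (KaehlerDifferential.D k C u), ← h, add_smul, mul_smul, mul_smul]
  exact M.add_mem (M.smul_mem _ ha) (M.smul_mem _ he)

theorem span_D_cover (hn : n ≠ 0) (hc : c ≠ 0)
    (hgen : Algebra.adjoin k {x, y, u, v} = ⊤)
    (huv : u * v = aeval x e) (hae : IsCoprime a e)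
    (hu : u ^ n = algebraMap k C c * (aeval x a + aeval x b * y))
    (hv : v ^ n = algebraMap k C c⁻¹ * (aeval x a - aeval x b * y)) :
    Submodule.span C {KaehlerDifferential.D k C x, KaehlerDifferential.D k C y} = ⊤ := by
  have hx : KaehlerDifferential.D k C x ∈
    Submodule.span C {KaehlerDifferential.D k C x, KaehlerDifferential.D k C y} :=
      Submodule.subset_span (by simp)
  have hy : KaehlerDifferential.D k C y ∈
    Submodule.span C {KaehlerDifferential.D k C x, KaehlerDifferential.D k C y} :=
      Submodule.subset_span (by simp)
  refine D_mem_of_adjoin_eq_top hgen _ ?_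
  rintro t (rfl | rfl | rfl | rfl)
  · exact hx
  · exact hy
  · exact D_cover_mem hn hc _ hx hy huv hae hu hv
  · refine D_cover_mem (b := -b) hn (inv_ne_zero hc) _ hx hy (by rw [mul_comm, huv]) hae ?_ ?_
    · rw [hv, map_neg]; ring
    · rw [hu, map_neg, inv_inv]; ring

omit [CharZero k] in
theorem isIntegral_cover {P : k[X]} (hn : n ≠ 0)
    (hgen : Algebra.adjoin k {x, y, u, v} = ⊤) (hy : y ^ 2 = aeval x P)
    (hu : u ^ n = algebraMap k C c * (aeval x a + aeval x b * y))
    (hv : v ^ n = algebraMap k C c⁻¹ * (aeval x a - aeval x b * y)) (t : C) :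
    IsIntegral (Algebra.adjoin k {x}) t := by
  have hx : ∀ f : k[X], IsIntegral (Algebra.adjoin k {x}) (aeval x f) := fun f ↦
    isIntegral_algebraMap (x := (⟨aeval x f, aeval_mem_adjoin_singleton k x⟩ : Algebra.adjoin k {x}))
  have hk : ∀ d : k, IsIntegral (Algebra.adjoin k {x}) (algebraMap k C d) := fun d ↦ by
    rw [← aeval_C x]; exact hx _
  have hy' : IsIntegral (Algebra.adjoin k {x}) y :=
    IsIntegral.of_pow two_pos (by rw [hy]; exact hx _)
  have ht : t ∈ Algebra.adjoin k {x, y, u, v} := by rw [hgen]; trivial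
  induction ht using Algebra.adjoin_induction with
  | mem t ht =>
    rcases ht with rfl | rfl | rfl | rfl
    · simpa using hx X
    · exact hy'
    · exact IsIntegral.of_pow hn.bot_lt
        (by rw [hu]; exact (hk _).mul ((hx _).add ((hx _).mul hy')))
    · exact IsIntegral.of_pow hn.bot_lt
        (by rw [hv]; exact (hk _).mul ((hx _).sub ((hx _).mul hy')))
  | algebraMap r => exact hk r
  | add a b _ _ ha hb => exact ha.add hb
  | mul a b _ _ ha hb => exact ha.mul hb

end CoverChart

/-! ### Subalgebras of a field obtained from each other by inverting an element -/
section Subalgebra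
variable {k K : Type u} [Field k] [Field K] [Algebra k K]

theorem isLocalizationAway_inclusion {T O : Subalgebra k K} (h : T ≤ O) (x : T) (hx : (x : K) ≠ 0)
    (hxO : (x : K)⁻¹ ∈ O) (hO : ∀ o ∈ O, ∃ N : ℕ, (x : K) ^ N * o ∈ T) :
    letI := (Subalgebra.inclusion h).toRingHom.toAlgebra
    IsLocalization.Away x O := by
  let := (Subalgebra.inclusion h).toRingHom.toAlgebra
  have hmap : ∀ t : T, ((algebraMap T O t : O) : K) = t := fun _ ↦ rfl
  refine IsLocalization.Away.mk (r := x) ?_ ?_ ?_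
  · exact IsUnit.of_mul_eq_one ⟨_, hxO⟩ (Subtype.ext (mul_inv_cancel₀ hx))
  · rintro ⟨o, ho⟩
    obtain ⟨N, hN⟩ := hO o ho
    exact ⟨N, ⟨_, hN⟩, Subtype.ext (mul_comm _ _)⟩
  · intro a b hab
    refine ⟨0, ?_⟩
    have : a = b := Subtype.ext (congrArg (fun t : O ↦ (t : K)) hab)
    rw [this]

theorem isOpenImmersion_inclusion {T O : Subalgebra k K} (h : T ≤ O) (x : T) (hx : (x : K) ≠ 0)
    (hxO : (x : K)⁻¹ ∈ O) (hO : ∀ o ∈ O, ∃ N : ℕ, (x : K) ^ N * o ∈ T) :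
    IsOpenImmersion (Spec.map (CommRingCat.ofHom (Subalgebra.inclusion h).toRingHom)) := by
  let := (Subalgebra.inclusion h).toRingHom.toAlgebra
  have := isLocalizationAway_inclusion h x hx hxO hO
  exact IsOpenImmersion.of_isLocalization x

theorem exists_lift_inclusion {T O : Subalgebra k K} (h : T ≤ O) (x : T) (hx : (x : K) ≠ 0)
    (hxO : (x : K)⁻¹ ∈ O) (hO : ∀ o ∈ O, ∃ N : ℕ, (x : K) ^ N * o ∈ T)
    {F : Type u} [Field F] (φ : T →+* F) (hφ : φ x ≠ 0) :
    ∃ ψ : O →+* F, ψ.comp (Subalgebra.inclusion h).toRingHom = φ := by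
  let := (Subalgebra.inclusion h).toRingHom.toAlgebra
  have := isLocalizationAway_inclusion h x hx hxO hO
  exact ⟨IsLocalization.Away.lift x hφ.isUnit, IsLocalization.Away.lift_comp x hφ.isUnit⟩

/-- Taking the join of the two chart rings as functions on the overlap makes the gluing separated.
-/
theorem surjective_lift_inclusion (S T : Subalgebra k K) :
    Function.Surjective (Algebra.TensorProduct.lift (Subalgebra.inclusion (le_sup_left : S ≤ S ⊔ T))
      (Subalgebra.inclusion (le_sup_right : T ≤ S ⊔ T)) (fun _ _ ↦ .all _ _)) := by
  set l := Algebra.TensorProduct.lift (Subalgebra.inclusion (le_sup_left : S ≤ S ⊔ T))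
      (Subalgebra.inclusion (le_sup_right : T ≤ S ⊔ T)) (fun _ _ ↦ .all _ _) with hl
  have h : S ⊔ T ≤ l.range.map (S ⊔ T).val := by
    refine sup_le (fun s hs ↦ ⟨_, ⟨(⟨s, hs⟩ : S) ⊗ₜ 1, rfl⟩, ?_⟩)
      (fun t ht ↦ ⟨_, ⟨1 ⊗ₜ (⟨t, ht⟩ : T), rfl⟩, ?_⟩) <;> simp [hl]
  rintro ⟨o, ho⟩
  obtain ⟨_, ⟨t, rfl⟩, ht⟩ := h ho
  exact ⟨t, Subtype.ext ht⟩

theorem isDomain_tensorProduct_subalgebra (T : Subalgebra k K) (F : Type u) [Field F] [Algebra k F]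
    [IsDomain (K ⊗[k] F)] : IsDomain (T ⊗[k] F) := by
  have h : Function.Injective (Algebra.TensorProduct.map T.val (AlgHom.id k F)) :=
    Module.Flat.rTensor_preserves_injective_linearMap T.val.toLinearMap Subtype.val_injective
  exact h.isDomain (Algebra.TensorProduct.map T.val (AlgHom.id k F)).toRingHom

theorem exists_pow_mul_mem_adjoin {T : Subalgebra k K} {x : K} (hx : x ∈ T) {s : Set K}
    (hs : ∀ t ∈ s, ∃ N : ℕ, x ^ N * t ∈ T) : ∀ o ∈ Algebra.adjoin k s, ∃ N : ℕ, x ^ N * o ∈ T := by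
  intro o ho
  induction ho using Algebra.adjoin_induction with
  | mem t ht => exact hs t ht
  | algebraMap r => exact ⟨0, by rw [pow_zero, one_mul]; exact T.algebraMap_mem r⟩
  | add a b _ _ ha hb =>
    obtain ⟨M, hM⟩ := ha
    obtain ⟨N, hN⟩ := hb
    refine ⟨M + N, ?_⟩
    have : x ^ (M + N) * (a + b) = x ^ N * (x ^ M * a) + x ^ M * (x ^ N * b) := by ring
    rw [this]
    exact T.add_mem (T.mul_mem (T.pow_mem hx _) hM) (T.mul_mem (T.pow_mem hx _) hN)
  | mul a b _ _ ha hb =>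
    obtain ⟨M, hM⟩ := ha
    obtain ⟨N, hN⟩ := hb
    refine ⟨M + N, ?_⟩
    have : x ^ (M + N) * (a * b) = (x ^ M * a) * (x ^ N * b) := by ring
    rw [this]
    exact T.mul_mem hM hN

end Subalgebra

/-! ### The projective model of a cyclic cover -/
section Cover
open Polynomial

/-- With `x₁ = 1 / x` and `y₁ = y / x²`, one has `dx / 2y = -dx₁ / 2y₁`. The hypothesis `hc` is the
derivative of `P(x) = x⁴ P₁(1 / x)`. -/
theorem mapDifferentials_chartForm_eq {k A B O : Type u} [Field k] [CharZero k] [CommRing A]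
    [CommRing B] [CommRing O] [Algebra k A] [Algebra k B] [Algebra k O] (p : A →ₐ[k] O)
    (q : B →ₐ[k] O) {P P₁ s t s₁ t₁ : k[X]} {x y : A} {x₁ y₁ : B}
    (hy : y ^ 2 = aeval x P) (h : s * P + t * derivative P = 1)
    (hy₁ : y₁ ^ 2 = aeval x₁ P₁) (h₁ : s₁ * P₁ + t₁ * derivative P₁ = 1)
    (hxx : p x * q x₁ = 1) (hyy : p y = q y₁ * p x ^ 2)
    (hc : p x ^ 2 * aeval (q x₁) (derivative P₁) =
      4 * q x₁ * aeval (p x) P - aeval (p x) (derivative P)) :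
    mapDifferentials p (chartForm s t x y) = mapDifferentials q (-chartForm s₁ t₁ x₁ y₁) := by
  set ω := mapDifferentials q (chartForm s₁ t₁ x₁ y₁) with hω
  have hX₁ : KaehlerDifferential.D k _ (q x₁) = (2 * q y₁) • ω := by
    rw [← mapDifferentials_D, D_eq_smul_chartForm hy₁ h₁, mapDifferentials_smul, map_mul,
      map_ofNat]
  have hY₁ : KaehlerDifferential.D k _ (q y₁) = aeval (q x₁) (derivative P₁) • ω := by
    rw [← mapDifferentials_D, D_eq_smul_chartForm' hy₁ h₁, mapDifferentials_smul,
      aeval_algHom_apply]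
  have e' : q y₁ * p x = p y * q x₁ := by
    rw [hyy]
    linear_combination -q y₁ * p x * hxx
  have hX : KaehlerDifferential.D k _ (p x) = (-(2 * p y)) • ω := by
    have h := congrArg (KaehlerDifferential.D k _) hxx
    rw [Derivation.leibniz, Derivation.map_one_eq_zero, hX₁, smul_smul] at h
    have h := congrArg (p x • ·) h
    simp only [smul_add, smul_smul, smul_zero, hxx, one_smul] at h
    rw [eq_neg_of_add_eq_zero_right h, ← neg_smul]
    congr 2
    rw [hyy]
    ring
  have hY : KaehlerDifferential.D k _ (p y) = (-aeval (p x) (derivative P)) • ω := by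
    have hy' : p y ^ 2 = aeval (p x) P := by rw [← map_pow, hy, aeval_algHom_apply]
    rw [hyy, Derivation.leibniz, Derivation.leibniz_pow, hX, hY₁, ← Nat.cast_smul_eq_nsmul O,
      smul_smul, smul_smul, smul_smul, smul_smul, ← add_smul]
    congr 1
    norm_num
    rw [hc, ← hy']
    linear_combination -4 * p y * e'
  have h₃ : p (algebraMap k A 2⁻¹ * aeval x s * y) * -(2 * p y) +
      p (aeval x t) * -aeval (p x) (derivative P) = -1 := by
    have h := congrArg (aeval x) h
    rw [map_add, map_mul, map_mul, map_one, ← hy] at h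
    have h₂ := algebraMap_half (k := k) (C := A)
    have h₃ : algebraMap k A 2⁻¹ * aeval x s * y * (2 * y) +
        aeval x t * aeval x (derivative P) = 1 := by
      linear_combination h + aeval x s * y ^ 2 * h₂
    have h₄ := congrArg p h₃
    rw [map_add, map_mul, map_mul _ (aeval x t), map_mul _ 2, map_ofNat, map_one,
      ← aeval_algHom_apply p x (derivative P)] at h₄
    linear_combination -h₄
  rw [map_neg, ← hω, chartForm, map_add, mapDifferentials_smul, mapDifferentials_smul,
    mapDifferentials_D, mapDifferentials_D, hX, hY, smul_smul, smul_smul, ← add_smul, h₃,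
    neg_smul, one_smul]

/-- A presentation of a function field as a cyclic cover `z ^ n = c (a(x) + b(x) y)` of the double
cover `y² = P(x)` of the line, unramified over it, with equations `P₁`, `a₁`, `b₁` near `x = ∞`. -/
structure CoverData (k K : Type u) [Field k] [Field K] [Algebra k K] where
  (x y z : K)
  (P P₁ a a₁ b b₁ : k[X])
  (n : ℕ)
  (c : k)
  transcendental : Transcendental k x
  natDegree_ne_zero : P.natDegree ≠ 0
  natDegree_ne_zero' : P₁.natDegree ≠ 0
  separable : P.Separable
  separable' : P₁.Separable
  n_ne_zero : n ≠ 0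
  c_ne_zero : c ≠ 0
  y_sq : y ^ 2 = aeval x P
  aeval_P₁ : aeval x⁻¹ P₁ * x ^ 4 = aeval x P
  aeval_derivative : x ^ 2 * aeval x⁻¹ (derivative P₁) =
    4 * x⁻¹ * aeval x P - aeval x (derivative P)
  z_pow : z ^ n = algebraMap k K c * (aeval x a + aeval x b * y)
  pell : a ^ 2 - P * b ^ 2 = 1
  aeval_a₁ : aeval x⁻¹ a₁ * x ^ n = aeval x a
  aeval_b₁ : aeval x⁻¹ b₁ * x ^ n = aeval x b * x ^ 2
  eval_a₁ : a₁.eval 0 ≠ 0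

variable {k K : Type u} [Field k] [Field K] [Algebra k K]

theorem adjoin_coe_eq_top {x y u v : K} (X Y U V : Algebra.adjoin k {x, y, u, v}) (hX : X = x)
    (hY : Y = y) (hU : U = u) (hV : V = v) : Algebra.adjoin k {X, Y, U, V} = ⊤ := by
  refine Subalgebra.map_injective (f := (Algebra.adjoin k {x, y, u, v}).val)
    Subtype.val_injective ?_
  rw [AlgHom.map_adjoin, Algebra.map_top, Subalgebra.range_val]
  congr 1
  simp [Set.image_insert_eq, hX, hY, hU, hV]

theorem finiteType_adjoin (x y u v : K) : Algebra.FiniteType k (Algebra.adjoin k {x, y, u, v}) :=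
  (Subalgebra.fg_iff_finiteType _).1 (by
    classical
    have := Subalgebra.fg_adjoin_finset (R := k) ({x, y, u, v} : Finset K)
    simpa using this)

theorem transcendental_coe (T : Subalgebra k K) (t : T) (ht : Transcendental k (t : K)) :
    Transcendental k t := fun h ↦ ht (h.algHom T.val)

namespace CoverData
variable (d : CoverData k K)

theorem x_ne_zero : d.x ≠ 0 := by
  intro h
  have := d.transcendental
  rw [h] at this
  exact this isAlgebraic_zero

/-- The Pell identity makes `a + b y` and `a - b y` mutually inverse; this is why `z⁻¹` can be
adjoined to the first chart without losing integrality over `k[x]`. -/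
theorem z_pow_mul : d.z ^ d.n * (algebraMap k K d.c⁻¹ * (aeval d.x d.a - aeval d.x d.b * d.y)) = 1 := by
  have h := congrArg (aeval d.x) d.pell
  simp only [map_sub, map_mul, map_pow, map_one, ← d.y_sq] at h
  have h₁ : algebraMap k K d.c * algebraMap k K d.c⁻¹ = 1 := by
    rw [← map_mul, mul_inv_cancel₀ d.c_ne_zero, map_one]
  rw [d.z_pow]
  linear_combination h + (aeval d.x d.a ^ 2 - d.y ^ 2 * aeval d.x d.b ^ 2) * h₁

theorem z_ne_zero : d.z ≠ 0 := by
  intro h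
  have := d.z_pow_mul
  rw [h, zero_pow d.n_ne_zero, zero_mul] at this
  exact zero_ne_one this

theorem z_inv_pow : d.z⁻¹ ^ d.n = algebraMap k K d.c⁻¹ * (aeval d.x d.a - aeval d.x d.b * d.y) := by
  rw [inv_pow]
  exact inv_eq_of_mul_eq_one_right d.z_pow_mul

/-- Functions regular away from `x = ∞`. -/
def chart : Subalgebra k K := Algebra.adjoin k {d.x, d.y, d.z, d.z⁻¹}

/-- Functions regular away from `x = 0`. -/
def chart' : Subalgebra k K :=
  Algebra.adjoin k {d.x⁻¹, d.y * d.x⁻¹ ^ 2, d.z * d.x⁻¹, d.x⁻¹ * d.z⁻¹}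

instance : Algebra.FiniteType k d.chart := finiteType_adjoin ..
instance : Algebra.FiniteType k d.chart' := finiteType_adjoin ..

/-- The coordinate `x` on the first chart. -/
def X : d.chart := ⟨d.x, Algebra.subset_adjoin (by simp)⟩
/-- The square root of `P(x)` on the first chart. -/
def Y : d.chart := ⟨d.y, Algebra.subset_adjoin (by simp)⟩
/-- The cyclic coordinate on the first chart. -/
def Z : d.chart := ⟨d.z, Algebra.subset_adjoin (by simp)⟩
/-- The inverse of the cyclic coordinate on the first chart. -/
def Z' : d.chart := ⟨d.z⁻¹, Algebra.subset_adjoin (by simp)⟩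

/-- The coordinate `1 / x` on the second chart. -/
def X₁ : d.chart' := ⟨d.x⁻¹, Algebra.subset_adjoin (by simp)⟩
/-- The square root of `P₁(1 / x)` on the second chart. -/
def Y₁ : d.chart' := ⟨d.y * d.x⁻¹ ^ 2, Algebra.subset_adjoin (by simp)⟩
/-- The cyclic coordinate on the second chart. -/
def Z₁ : d.chart' := ⟨d.z * d.x⁻¹, Algebra.subset_adjoin (by simp)⟩
/-- The coordinate on the second chart whose product with `Z₁` is `X₁ ^ 2`. -/
def Z₁' : d.chart' := ⟨d.x⁻¹ * d.z⁻¹, Algebra.subset_adjoin (by simp)⟩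

theorem adjoin_eq_top : Algebra.adjoin k {d.X, d.Y, d.Z, d.Z'} = ⊤ :=
  adjoin_coe_eq_top _ _ _ _ rfl rfl rfl rfl

theorem adjoin_eq_top' : Algebra.adjoin k {d.X₁, d.Y₁, d.Z₁, d.Z₁'} = ⊤ :=
  adjoin_coe_eq_top _ _ _ _ rfl rfl rfl rfl

theorem coe_aeval {T : Subalgebra k K} (t : T) (f : k[X]) : ((aeval t f : T) : K) = aeval (t : K) f :=
  (aeval_algHom_apply T.val t f).symm

theorem Y_sq : d.Y ^ 2 = aeval d.X d.P := Subtype.ext <| by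
  rw [coe_aeval]; exact d.y_sq

theorem Z_mul_Z' : d.Z * d.Z' = aeval d.X (1 : k[X]) := Subtype.ext <| by
  rw [coe_aeval, map_one]; exact mul_inv_cancel₀ d.z_ne_zero

theorem Z_pow : d.Z ^ d.n =
    algebraMap k d.chart d.c * (aeval d.X d.a + aeval d.X d.b * d.Y) := Subtype.ext <| by
  push_cast
  exact d.z_pow

theorem Z'_pow : d.Z' ^ d.n =
    algebraMap k d.chart d.c⁻¹ * (aeval d.X d.a - aeval d.X d.b * d.Y) := Subtype.ext <| by
  refine Eq.trans ?_ (congrArg₂ (fun s t ↦ algebraMap k K d.c⁻¹ * (s - t * d.y))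
    (coe_aeval d.X d.a).symm (coe_aeval d.X d.b).symm)
  exact d.z_inv_pow

theorem Y₁_sq : d.Y₁ ^ 2 = aeval d.X₁ d.P₁ := Subtype.ext <| by
  rw [coe_aeval]
  change (d.y * d.x⁻¹ ^ 2) ^ 2 = aeval d.x⁻¹ d.P₁
  rw [mul_pow, d.y_sq, ← d.aeval_P₁, ← pow_mul, mul_assoc, ← mul_pow, mul_inv_cancel₀ d.x_ne_zero,
    one_pow, mul_one]

theorem Z₁_mul_Z₁' : d.Z₁ * d.Z₁' = aeval d.X₁ (Polynomial.X ^ 2 : k[X]) := Subtype.ext <| by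
  rw [coe_aeval]
  change d.z * d.x⁻¹ * (d.x⁻¹ * d.z⁻¹) = aeval d.x⁻¹ (Polynomial.X ^ 2 : k[X])
  have := d.z_ne_zero
  simp only [map_pow, aeval_X]
  field_simp

theorem aeval_infty_add (s : K) : aeval d.x⁻¹ d.a₁ + aeval d.x⁻¹ d.b₁ * (s * d.x⁻¹ ^ 2) =
    (aeval d.x d.a + aeval d.x d.b * s) * d.x⁻¹ ^ d.n := by
  have hx := d.x_ne_zero
  have h₁ := d.aeval_a₁
  have h₂ := d.aeval_b₁
  have h₃ : d.x ^ d.n * d.x⁻¹ ^ d.n = 1 := by rw [← mul_pow, mul_inv_cancel₀ hx, one_pow]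
  have h₄ : d.x ^ 2 * d.x⁻¹ ^ 2 = 1 := by rw [← mul_pow, mul_inv_cancel₀ hx, one_pow]
  linear_combination (exp := 1) d.x⁻¹ ^ d.n * h₁ + s * d.x⁻¹ ^ 2 * d.x⁻¹ ^ d.n * h₂
    - (aeval d.x⁻¹ d.a₁ + aeval d.x⁻¹ d.b₁ * (s * d.x⁻¹ ^ 2)) * h₃ +
      s * d.x⁻¹ ^ d.n * aeval d.x d.b * h₄

theorem Z₁_pow : d.Z₁ ^ d.n =
    algebraMap k d.chart' d.c * (aeval d.X₁ d.a₁ + aeval d.X₁ d.b₁ * d.Y₁) := Subtype.ext <| by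
  push_cast
  refine Eq.trans ?_ (congrArg (algebraMap k K d.c * ·) (d.aeval_infty_add d.y)).symm
  change (d.z * d.x⁻¹) ^ d.n = _
  rw [mul_pow, d.z_pow, mul_assoc]

theorem Z₁'_pow : d.Z₁' ^ d.n =
    algebraMap k d.chart' d.c⁻¹ * (aeval d.X₁ d.a₁ - aeval d.X₁ d.b₁ * d.Y₁) := Subtype.ext <| by
  refine Eq.trans ?_ (congrArg₂ (fun s t ↦ algebraMap k K d.c⁻¹ * (s - t * (d.y * d.x⁻¹ ^ 2)))
    (coe_aeval d.X₁ d.a₁).symm (coe_aeval d.X₁ d.b₁).symm)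
  change (d.x⁻¹ * d.z⁻¹) ^ d.n = algebraMap k K d.c⁻¹ *
    (aeval d.x⁻¹ d.a₁ - aeval d.x⁻¹ d.b₁ * (d.y * d.x⁻¹ ^ 2))
  have := d.aeval_infty_add (-d.y)
  rw [mul_pow, d.z_inv_pow]
  linear_combination -algebraMap k K d.c⁻¹ * this

/-- This supplies the coprimality needed by `D_cover_mem` at infinity, where the product of the two
cyclic coordinates is `X₁ ^ 2` instead of `1`. -/
theorem isCoprime_a₁ : IsCoprime d.a₁ (Polynomial.X ^ 2) := by
  refine IsCoprime.pow_right (IsCoprime.symm ?_)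
  rw [Irreducible.coprime_iff_not_dvd irreducible_X, X_dvd_iff, coeff_zero_eq_eval_zero]
  exact d.eval_a₁

theorem transcendental_X : Transcendental k d.X := transcendental_coe _ _ d.transcendental

theorem transcendental_X₁ : Transcendental k d.X₁ := transcendental_coe _ _ <| by
  intro h
  exact d.transcendental (IsAlgebraic.inv_iff.1 h)

/-- The inclusion of the first chart into the functions on the intersection of the two charts. -/
def inl : d.chart →ₐ[k] ↥(d.chart ⊔ d.chart') := Subalgebra.inclusion le_sup_left
/-- The inclusion of the second chart into the functions on the intersection. -/
def inr : d.chart' →ₐ[k] ↥(d.chart ⊔ d.chart') := Subalgebra.inclusion le_sup_right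

theorem inl_X_mul_inr_X₁ : d.inl d.X * d.inr d.X₁ = 1 :=
  Subtype.ext (mul_inv_cancel₀ d.x_ne_zero)

theorem chart_sup_chart' : d.chart ⊔ d.chart' = Algebra.adjoin k ({d.x, d.y, d.z, d.z⁻¹} ∪
    {d.x⁻¹, d.y * d.x⁻¹ ^ 2, d.z * d.x⁻¹, d.x⁻¹ * d.z⁻¹}) :=
  (Algebra.adjoin_union _ _).symm

theorem exists_pow_mul_mem_chart (o : K) (ho : o ∈ d.chart ⊔ d.chart') :
    ∃ N : ℕ, d.x ^ N * o ∈ d.chart := by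
  rw [chart_sup_chart'] at ho
  have hx := d.x_ne_zero
  refine exists_pow_mul_mem_adjoin (T := d.chart) (x := d.x) d.X.2 ?_ o ho
  rintro t ((rfl | rfl | rfl | rfl) | rfl | rfl | rfl | rfl)
  · exact ⟨0, by rw [pow_zero, one_mul]; exact d.X.2⟩
  · exact ⟨0, by rw [pow_zero, one_mul]; exact d.Y.2⟩
  · exact ⟨0, by rw [pow_zero, one_mul]; exact d.Z.2⟩
  · exact ⟨0, by rw [pow_zero, one_mul]; exact d.Z'.2⟩
  · exact ⟨1, by rw [pow_one, mul_inv_cancel₀ hx]; exact one_mem _⟩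
  · exact ⟨2, by convert d.Y.2 using 1; simp only [Y]; field_simp⟩
  · exact ⟨1, by convert d.Z.2 using 1; simp only [Z]; field_simp⟩
  · exact ⟨1, by convert d.Z'.2 using 1; simp only [Z']; field_simp⟩

theorem exists_pow_mul_mem_chart' (o : K) (ho : o ∈ d.chart ⊔ d.chart') :
    ∃ N : ℕ, d.x⁻¹ ^ N * o ∈ d.chart' := by
  rw [chart_sup_chart'] at ho
  have hx := d.x_ne_zero
  refine exists_pow_mul_mem_adjoin (T := d.chart') (x := d.x⁻¹) d.X₁.2 ?_ o ho
  rintro t ((rfl | rfl | rfl | rfl) | rfl | rfl | rfl | rfl)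
  · exact ⟨1, by rw [pow_one, inv_mul_cancel₀ hx]; exact one_mem _⟩
  · exact ⟨2, by convert d.Y₁.2 using 1; simp only [Y₁]; ring⟩
  · exact ⟨1, by convert d.Z₁.2 using 1; simp only [Z₁]; ring⟩
  · exact ⟨1, by convert d.Z₁'.2 using 1; simp only [Z₁']; ring⟩
  · exact ⟨0, by rw [pow_zero, one_mul]; exact d.X₁.2⟩
  · exact ⟨0, by rw [pow_zero, one_mul]; exact d.Y₁.2⟩
  · exact ⟨0, by rw [pow_zero, one_mul]; exact d.Z₁.2⟩
  · exact ⟨0, by rw [pow_zero, one_mul]; exact d.Z₁'.2⟩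

instance : IsOpenImmersion (Spec.map (CommRingCat.ofHom d.inl.toRingHom)) :=
  isOpenImmersion_inclusion le_sup_left d.X d.x_ne_zero (d.inr d.X₁).2 d.exists_pow_mul_mem_chart

instance : IsOpenImmersion (Spec.map (CommRingCat.ofHom d.inr.toRingHom)) :=
  isOpenImmersion_inclusion le_sup_right d.X₁ (inv_ne_zero d.x_ne_zero)
    (by rw [X₁, inv_inv]; exact (d.inl d.X).2) d.exists_pow_mul_mem_chart'

theorem exists_lift_inl {F : Type u} [Field F] (φ : d.chart →+* F) (h : φ d.X ≠ 0) :
    ∃ ψ : ↥(d.chart ⊔ d.chart') →+* F, ψ.comp d.inl.toRingHom = φ :=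
  exists_lift_inclusion le_sup_left d.X d.x_ne_zero (d.inr d.X₁).2 d.exists_pow_mul_mem_chart φ h

theorem exists_lift_inr {F : Type u} [Field F] (φ : d.chart' →+* F) (h : φ d.X₁ ≠ 0) :
    ∃ ψ : ↥(d.chart ⊔ d.chart') →+* F, ψ.comp d.inr.toRingHom = φ :=
  exists_lift_inclusion le_sup_right d.X₁ (inv_ne_zero d.x_ne_zero)
    (by rw [X₁, inv_inv]; exact (d.inl d.X).2) d.exists_pow_mul_mem_chart' φ h

/-- The projective curve defined by `d`, with its structure morphism. -/
def curveHom : glued d.inl d.inr ⟶ Spec (.of k) := gluedHom d.inl d.inr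

instance isProper_curveHom : IsProper d.curveHom :=
  isProper_gluedHom d.inl d.inr d.X d.X₁ d.inl_X_mul_inr_X₁
    (isIntegral_cover d.n_ne_zero d.adjoin_eq_top d.Y_sq d.Z_pow d.Z'_pow)
    (isIntegral_cover d.n_ne_zero d.adjoin_eq_top' d.Y₁_sq d.Z₁_pow d.Z₁'_pow)
    d.exists_lift_inl d.exists_lift_inr (surjective_lift_inclusion _ _)

variable [CharZero k]

theorem span_D : Submodule.span d.chart
    {KaehlerDifferential.D k d.chart d.X, KaehlerDifferential.D k d.chart d.Y} = ⊤ :=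
  span_D_cover d.n_ne_zero d.c_ne_zero d.adjoin_eq_top d.Z_mul_Z' isCoprime_one_right
    d.Z_pow d.Z'_pow

theorem span_D' : Submodule.span d.chart'
    {KaehlerDifferential.D k d.chart' d.X₁, KaehlerDifferential.D k d.chart' d.Y₁} = ⊤ :=
  span_D_cover d.n_ne_zero d.c_ne_zero d.adjoin_eq_top' d.Z₁_mul_Z₁' d.isCoprime_a₁
    d.Z₁_pow d.Z₁'_pow

instance smooth_curveHom : SmoothOfRelativeDimension 1 d.curveHom := by
  obtain ⟨s, t, h⟩ := d.separable
  obtain ⟨s₁, t₁, h₁⟩ := d.separable'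
  exact smooth_gluedHom d.inl d.inr 1
    (locally_isStandardSmoothOfRelativeDimension d.transcendental_X d.natDegree_ne_zero d.Y_sq h
      d.span_D)
    (locally_isStandardSmoothOfRelativeDimension d.transcendental_X₁ d.natDegree_ne_zero' d.Y₁_sq h₁
      d.span_D')

theorem mapDifferentials_chartForm {s t s₁ t₁ : k[X]} (h : s * d.P + t * derivative d.P = 1)
    (h₁ : s₁ * d.P₁ + t₁ * derivative d.P₁ = 1) :
    mapDifferentials d.inl (chartForm s t d.X d.Y) =
      mapDifferentials d.inr (-chartForm s₁ t₁ d.X₁ d.Y₁) := by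
  refine mapDifferentials_chartForm_eq d.inl d.inr d.Y_sq h d.Y₁_sq h₁ d.inl_X_mul_inr_X₁ ?_ ?_
  · refine Subtype.ext ?_
    change d.y = d.y * d.x⁻¹ ^ 2 * d.x ^ 2
    have := d.x_ne_zero
    field_simp
  · refine Subtype.ext ?_
    push_cast
    exact d.aeval_derivative

theorem genus_curveHom (hdom : ∀ (F : Type u) [Field F] [Algebra k F], IsDomain (K ⊗[k] F)) :
    genus d.curveHom = 1 := by
  have : Smooth (gluedHom d.inl d.inr) := d.smooth_curveHom.smooth
  have : UniversallyClosed (gluedHom d.inl d.inr) := d.isProper_curveHom.toUniversallyClosed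
  obtain ⟨s, t, h⟩ := d.separable
  obtain ⟨s₁, t₁, h₁⟩ := d.separable'
  refine genus_gluedHom d.inl d.inr (fun a b hab ↦ ?_) (chartForm s t d.X d.Y)
    (exists_eq_smul_chartForm d.Y_sq h d.span_D)
    (chartForm_ne_zero d.transcendental_X d.Y_sq h d.span_D) (-chartForm s₁ t₁ d.X₁ d.Y₁)
    (fun ω ↦ ?_) (d.mapDifferentials_chartForm h h₁)
  · refine mem_range_algebraMap_of_isIntegral (fun F _ _ ↦ ?_) a
      (isIntegral_of_glued d.inl d.inr a b hab)
    have := hdom F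
    exact isDomain_tensorProduct_subalgebra _ F
  · obtain ⟨c, hc⟩ := exists_eq_smul_chartForm d.Y₁_sq h₁ d.span_D' ω
    exact ⟨-c, by rw [hc, neg_smul_neg]⟩

theorem isGenusOneCurve_curveHom
    (hdom : ∀ (F : Type u) [Field F] [Algebra k F], IsDomain (K ⊗[k] F)) :
    IsGenusOneCurve d.curveHom := by
  refine ⟨inferInstance, geometricallyIntegral_gluedHom d.inl d.inr (fun F _ _ ↦ ?_)
    (fun F _ _ ↦ ?_), inferInstance, d.genus_curveHom hdom⟩
  all_goals
    have := hdom F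
    exact isDomain_tensorProduct_subalgebra _ F

end CoverData
end Cover

/-! ### Equations satisfied by the points of the curve. -/

section Points
open Polynomial
variable {k K : Type u} [Field k] [Field K] [Algebra k K] (d : CoverData k K)

theorem exists_algHom_of_spec {k A F : Type u} [Field k] [CommRing A] [CommRing F] [Algebra k A]
    [Algebra k F] (φ : A →+* F)
    (h : Spec.map (CommRingCat.ofHom φ) ≫ Spec.map (CommRingCat.ofHom (algebraMap k A)) =
      Spec.map (CommRingCat.ofHom (algebraMap k F))) : ∃ ψ : A →ₐ[k] F, ψ.toRingHom = φ := by
  rw [← Spec.map_comp] at h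
  have h := congr(($(Spec.map_injective h)).hom)
  exact ⟨⟨φ, fun r ↦ congr($h r)⟩, rfl⟩

/-- A field over which the affine model `y² = P(x)`, `z ^ n = c (a(x) + b(x) y)` or one of its
points at infinity acquires a rational point. -/
def CoverData.HasPoint (d : CoverData k K) (F : Type u) [Field F] [Algebra k F] : Prop :=
  (∃ X Y Z : F, Y ^ 2 = aeval X d.P ∧
    Z ^ d.n = algebraMap k F d.c * (aeval X d.a + aeval X d.b * Y)) ∨
  (∃ Z : F, Z ^ d.n = algebraMap k F (d.c * (2 * d.a₁.eval 0))) ∨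
  ∃ Z : F, Z ^ d.n = algebraMap k F (d.c⁻¹ * (2 * d.a₁.eval 0))

theorem CoverData.hasPoint_of_algHom {F : Type u} [Field F] [Algebra k F] (φ : d.chart →ₐ[k] F) :
    d.HasPoint F := by
  refine .inl ⟨φ d.X, φ d.Y, φ d.Z, ?_, ?_⟩
  · rw [← map_pow, d.Y_sq, aeval_algHom_apply]
  · rw [← map_pow, d.Z_pow, aeval_algHom_apply, aeval_algHom_apply, map_mul, map_add, map_mul,
      AlgHom.commutes]

/-- Where `X₁ ≠ 0` the point lies on the first chart. Where `X₁ = 0` one of `Z₁`, `Z₁'` vanishes, so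
`a₁(0)` equals plus or minus `b₁(0) Y₁`, and the other coordinate has `n`-th power `2 a₁(0)` times
`c` or `c⁻¹`. -/
theorem CoverData.hasPoint_of_algHom' {F : Type u} [Field F] [Algebra k F] (φ : d.chart' →ₐ[k] F) :
    d.HasPoint F := by
  by_cases h : φ d.X₁ = 0
  · right
    have h₀ : ∀ f : k[X], aeval (φ d.X₁) f = algebraMap k F (f.eval 0) := fun f ↦ by
      rw [h, ← map_zero (algebraMap k F), aeval_algebraMap_apply, coe_aeval_eq_eval]
    have h₁ := congrArg φ d.Z₁_pow
    have h₂ := congrArg φ d.Z₁'_pow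
    have h₃ := congrArg φ d.Z₁_mul_Z₁'
    simp only [map_mul, map_add, map_sub, map_pow, AlgHom.commutes, ← aeval_algHom_apply, h₀] at h₁ h₂
    rw [map_mul, ← aeval_algHom_apply, h₀, eval_pow, eval_X, zero_pow two_ne_zero, map_zero,
      mul_eq_zero] at h₃
    have hc : ∀ e : k, e ≠ 0 → algebraMap k F e ≠ 0 := fun e he ↦ by simpa using he
    rcases h₃ with h₃ | h₃
    · right
      refine ⟨φ d.Z₁', ?_⟩
      rw [h₃, zero_pow d.n_ne_zero] at h₁
      have := (mul_eq_zero.1 h₁.symm).resolve_left (hc _ d.c_ne_zero)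
      rw [h₂, map_mul, map_mul, map_ofNat]
      linear_combination -(algebraMap k F d.c⁻¹) * this
    · left
      refine ⟨φ d.Z₁, ?_⟩
      rw [h₃, zero_pow d.n_ne_zero] at h₂
      have := (mul_eq_zero.1 h₂.symm).resolve_left (hc _ (inv_ne_zero d.c_ne_zero))
      rw [h₁, map_mul, map_mul, map_ofNat]
      linear_combination -(algebraMap k F d.c) * this
  · obtain ⟨ψ, hψ⟩ := d.exists_lift_inr φ.toRingHom h
    refine d.hasPoint_of_algHom (F := F)
      ((⟨ψ, fun r ↦ ?_⟩ : ↥(d.chart ⊔ d.chart') →ₐ[k] F).comp d.inl)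
    have := congr($hψ (algebraMap k d.chart' r))
    exact this.trans (φ.commutes r)

theorem CoverData.hasPoint_of_spec {F : Type u} [Field F] [Algebra k F]
    (s : Spec (.of F) ⟶ glued d.inl d.inr)
    (hs : s ≫ d.curveHom = Spec.map (CommRingCat.ofHom (algebraMap k F))) : d.HasPoint F := by
  rcases glued_spec_field d.inl d.inr s with ⟨φ, rfl⟩ | ⟨φ, rfl⟩
  · rw [Category.assoc, curveHom, gluedInl_gluedHom] at hs
    obtain ⟨ψ, -⟩ := exists_algHom_of_spec φ hs
    exact d.hasPoint_of_algHom ψ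
  · rw [Category.assoc, curveHom, gluedInr_gluedHom] at hs
    obtain ⟨ψ, -⟩ := exists_algHom_of_spec φ hs
    exact d.hasPoint_of_algHom' ψ

end Points

/-! ### Consequences of divisibility of the degrees of points -/
section Index
variable {k : Type u} [Field k] {X : Scheme.{u}} (f : X ⟶ Spec (.of k))

theorem dvd_pointDegree (n : ℕ) (hn : ∀ (F : Type u) [Field F] [Algebra k F],
    (∃ s : Spec (.of F) ⟶ X, s ≫ f = Spec.map (CommRingCat.ofHom (algebraMap k F))) →
      n ∣ Module.finrank k F) (x : X) : n ∣ pointDegree f x := by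
  let : Algebra k (X.residueField x) :=
    (Spec.preimage (X.fromSpecResidueField x ≫ f)).hom.toAlgebra
  refine hn (X.residueField x) ⟨X.fromSpecResidueField x, ?_⟩
  exact (Spec.map_preimage (X.fromSpecResidueField x ≫ f)).symm

/-- A nonempty quasi-compact scheme has a closed point, and the Nullstellensatz makes its residue
field finite over `k`. -/
theorem exists_isClosed_pointDegree_ne_zero [Nonempty X] [IsProper f] :
    ∃ x : X, IsClosed {x} ∧ pointDegree f x ≠ 0 := by
  have : CompactSpace X := (quasiCompact_iff_compactSpace f).mp inferInstance
  obtain ⟨x, -, hx⟩ := (isClosed_univ (X := X)).exists_closed_singleton Set.univ_nonempty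
  refine ⟨x, hx, ?_⟩
  have hfin : IsFinite (X.fromSpecResidueField x ≫ f) := by
    rw [isClosed_singleton_iff_isClosedImmersion] at hx
    rw [isFinite_iff_locallyOfFiniteType_of_jacobsonSpace]
    infer_instance
  rw [← Spec.map_preimage (X.fromSpecResidueField x ≫ f), IsFinite.SpecMap_iff] at hfin
  let : Algebra k (X.residueField x) :=
    (Spec.preimage (X.fromSpecResidueField x ≫ f)).hom.toAlgebra
  have : Module.Finite k (X.residueField x) := hfin
  exact (Module.finrank_pos (R := k) (M := X.residueField x)).ne'

theorem exists_gcd (S : Set ℕ) : ∃ g : ℕ, (∀ s ∈ S, g ∣ s) ∧ ∀ m, (∀ s ∈ S, m ∣ s) → m ∣ g := by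
  obtain ⟨g, hg⟩ := (IsPrincipalIdealRing.principal
    (Ideal.span ((fun s : ℕ ↦ (s : ℤ)) '' S))).principal
  refine ⟨g.natAbs, fun s hs ↦ ?_, fun m hm ↦ ?_⟩
  · have : (s : ℤ) ∈ Ideal.span ((fun s : ℕ ↦ (s : ℤ)) '' S) :=
      Ideal.subset_span ⟨s, hs, rfl⟩
    rw [hg] at this
    exact Int.natAbs_dvd_natAbs.2 (Ideal.mem_span_singleton.1 this)
  · have : g ∈ Ideal.span ((fun s : ℕ ↦ (s : ℤ)) '' S) := by
      rw [hg]; exact Ideal.mem_span_singleton_self g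
    have h : Ideal.span ((fun s : ℕ ↦ (s : ℤ)) '' S) ≤ Ideal.span {(m : ℤ)} := by
      rw [Ideal.span_le]
      rintro _ ⟨s, hs, rfl⟩
      exact Ideal.mem_span_singleton.2 (Int.natCast_dvd_natCast.2 (hm s hs))
    have := Int.natAbs_dvd_natAbs.2 (Ideal.mem_span_singleton.1 (h this))
    simpa using this

/-- A closed point of nonzero degree makes the greatest common divisor positive, so that
divisibility by `n` becomes a lower bound. -/
theorem exists_hasIndex [Nonempty X] [IsProper f] (n : ℕ)
    (hn : ∀ (F : Type u) [Field F] [Algebra k F],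
    (∃ s : Spec (.of F) ⟶ X, s ≫ f = Spec.map (CommRingCat.ofHom (algebraMap k F))) →
      n ∣ Module.finrank k F) : ∃ g, HasIndex f g ∧ n ≤ g := by
  obtain ⟨g, hg, hg'⟩ := exists_gcd {m | ∃ x : X, IsClosed {x} ∧ pointDegree f x = m}
  refine ⟨g, ⟨fun x hx ↦ hg _ ⟨x, hx, rfl⟩, fun m hm ↦ hg' m ?_⟩, Nat.le_of_dvd ?_ (hg' n ?_)⟩
  · rintro _ ⟨x, hx, rfl⟩
    exact hm x hx
  · obtain ⟨x, hx, hx0⟩ := exists_isClosed_pointDegree_ne_zero f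
    refine Nat.pos_of_ne_zero fun h ↦ hx0 ?_
    have := hg _ ⟨x, hx, rfl⟩
    rwa [h, zero_dvd_iff] at this
  · rintro _ ⟨x, -, rfl⟩
    exact dvd_pointDegree f n hn x

theorem exists_section_of_dense [GeometricallyIntegral f] (L : Type u) [Field L] [Algebra k L]
    (h : Dense (rationalPoints (baseChange f L))) :
    ∃ s : Spec (.of L) ⟶ X, s ≫ f = Spec.map (CommRingCat.ofHom (algebraMap k L)) := by
  have : IsIntegral (pullback f (Spec.map (CommRingCat.ofHom (algebraMap k L)))) := inferInstance
  obtain ⟨x, s, hs, -⟩ := h.nonempty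
  refine ⟨s ≫ pullback.fst _ _, ?_⟩
  rw [Category.assoc, pullback.condition, ← Category.assoc]
  change (s ≫ baseChange f L) ≫ _ = _
  rw [hs, Category.id_comp]

end Index

/-! ### The congruent number curve `y² = x³ - x` -/
section Congruent
open Polynomial WeierstrassCurve WeierstrassCurve.Affine
variable {F : Type u} [Field F] [CharZero F]

/-- The curve `y² = x³ - x`. -/
def congruentCurve (F : Type u) [Field F] : WeierstrassCurve.Affine F := ⟨0, 0, 0, -1, 0⟩

theorem nonsingular_congruentCurve {x y : F} (h : y ^ 2 = x ^ 3 - x) :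
    (congruentCurve F).Nonsingular x y := by
  rw [nonsingular_iff, equation_iff]
  simp only [congruentCurve]
  refine ⟨by linear_combination h, ?_⟩
  by_contra! hc
  obtain ⟨h₁, h₂⟩ := hc
  have hy : y = 0 := by linear_combination 2⁻¹ * h₂
  rw [hy] at h
  -- The discriminant `4` of `x³ - x` is a combination of the cubic and its derivative.
  have : (4 : F) = 0 := by linear_combination 18 * x * h + (4 - 6 * x ^ 2) * h₁
  norm_num at this

theorem congruentCurve_equation {x y : F} (h : (congruentCurve F).Nonsingular x y) :
    y ^ 2 = x ^ 3 - x := by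
  have := (equation_iff ..).1 h.1
  simp only [congruentCurve] at this
  linear_combination this

theorem negY_congruentCurve (x y : F) : (congruentCurve F).negY x y = -y := by
  simp [negY, congruentCurve]

variable [DecidableEq F]

/-- The duplication formula gives the double of `(x, y)` the abscissa `(x² + 1)² / 4 (x³ - x)`, so
halving amounts to solving a quartic, up to the sign of the point. -/
theorem exists_half [IsAlgClosed F] {p q : F} (h : (congruentCurve F).Nonsingular p q) :
    ∃ P : (congruentCurve F).Point, P + P = .some p q h := by
  obtain ⟨x, hx⟩ := IsAlgClosed.exists_root ((X ^ 2 + 1) ^ 2 - C (4 * p) * (X ^ 3 - X) : F[X]) (by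
    have : ((X ^ 2 + 1) ^ 2 - C (4 * p) * (X ^ 3 - X) : F[X]).degree = 4 := by compute_degree!
    rw [this]; norm_num)
  simp only [IsRoot.def, eval_sub, eval_pow, eval_add, eval_X, eval_one, eval_mul, eval_C] at hx
  obtain ⟨y, hy⟩ := IsAlgClosed.exists_pow_nat_eq (x ^ 3 - x) two_pos
  have hy0 : y ≠ 0 := by
    rintro rfl
    have h1 : (x ^ 2 + 1) ^ 2 = 0 := by linear_combination hx - 4 * p * hy
    have h2 : x ^ 2 + 1 = 0 := pow_eq_zero_iff two_ne_zero |>.1 h1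
    have h3 : x * (x ^ 2 + 1 - 2) = 0 := by linear_combination -hy
    rw [h2] at h3
    have h4 : x = 0 := by linear_combination -2⁻¹ * h3
    rw [h4] at h2
    norm_num at h2
  have hns := nonsingular_congruentCurve hy
  have hne : y ≠ (congruentCurve F).negY x y := by
    rw [negY_congruentCurve]
    intro h
    exact hy0 (by linear_combination 2⁻¹ * h)
  have hsum := Point.add_self_of_Y_ne (h₁ := hns) hne
  have hX : (congruentCurve F).addX x x ((congruentCurve F).slope x x y y) = p := by
    rw [slope_of_Y_ne rfl hne, negY_congruentCurve]
    simp only [addX, congruentCurve]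
    have : y - -y ≠ 0 := by
      intro h
      exact hy0 (by linear_combination 2⁻¹ * h)
    field_simp
    linear_combination hx + (-8 * x - 4 * p) * hy
  rcases (Point.X_eq_iff (h₁ := nonsingular_add hns hns fun hxy ↦ hne hxy.right)
    (h₂ := h)).1 hX with h' | h'
  · exact ⟨_, hsum.trans h'⟩
  · refine ⟨-.some _ _ hns, ?_⟩
    rw [← neg_add, hsum, h', neg_neg]

theorem exists_pow_two_nsmul_eq [IsAlgClosed F] (P : (congruentCurve F).Point) (r : ℕ) :
    ∃ Q : (congruentCurve F).Point, 2 ^ r • Q = P := by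
  induction r with
  | zero => exact ⟨P, by simp⟩
  | succ r ih =>
    obtain ⟨Q, hQ⟩ := ih
    rcases Q with _ | ⟨p, q, h⟩
    · refine ⟨0, ?_⟩
      rw [← hQ, ← Point.zero_def, smul_zero, smul_zero]
    · obtain ⟨R, hR⟩ := exists_half h
      exact ⟨R, by rw [pow_succ, mul_smul, two_smul, hR, hQ]⟩

/-- The point `(0, 0)` of order two. -/
def originPoint (F : Type u) [Field F] [CharZero F] : (congruentCurve F).Point :=
  .some 0 0 (nonsingular_congruentCurve (by ring))

/-- If `q` were zero the point would be killed by `2`, hence by `2 ^ r`, and could not be sent to a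
nonzero point. -/
theorem exists_division_point [IsAlgClosed F] (r : ℕ) (hr : r ≠ 0) :
    ∃ (p q : F) (h : (congruentCurve F).Nonsingular p q), q ≠ 0 ∧
      2 ^ r • Point.some p q h = originPoint F := by
  obtain ⟨Q, hQ⟩ := exists_pow_two_nsmul_eq (originPoint F) r
  rcases Q with _ | ⟨p, q, h⟩
  · rw [← Point.zero_def, smul_zero] at hQ
    exact absurd hQ.symm (Point.some_ne_zero _)
  · refine ⟨p, q, h, fun hq ↦ ?_, hQ⟩
    obtain ⟨s, rfl⟩ := Nat.exists_eq_succ_of_ne_zero hr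
    rw [pow_succ, mul_smul, two_smul, Point.add_self_of_Y_eq (by rw [negY_congruentCurve, hq, neg_zero]),
      smul_zero] at hQ
    exact absurd hQ.symm (Point.some_ne_zero _)

end Congruent

/-! ### Functions with prescribed zeros on the congruent number curve, and their norms. -/

section Congruent
open Polynomial WeierstrassCurve WeierstrassCurve.Affine WeierstrassCurve.Affine.CoordinateRing
variable {F : Type u} [Field F] [CharZero F]

/-- As `(0, 0)` is its own negative, `m (p, q) + (0, 0) = 0` in the group law. In the ideal class
group of the coordinate ring this says that the corresponding product of point ideals is principal.
-/
theorem exists_span_eq_of_nsmul [DecidableEq F] {p q : F} (h : (congruentCurve F).Nonsingular p q)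
    (m : ℕ) (hm : m • Point.some p q h = originPoint F) :
    ∃ g : (congruentCurve F).CoordinateRing,
      XYIdeal (congruentCurve F) p (C q) ^ m * XYIdeal (congruentCurve F) 0 (C 0) =
        Ideal.span {g} := by
  have h0 : (congruentCurve F).Nonsingular 0 0 := nonsingular_congruentCurve (by ring)
  have hsum : m • Point.some p q h + Point.some 0 0 h0 = 0 := by
    rw [hm]
    exact Point.add_self_of_Y_eq (by rw [negY_congruentCurve, neg_zero])
  have hc := congrArg Point.toClass hsum
  rw [map_add, map_nsmul, Point.toClass_some, Point.toClass_some, map_zero] at hc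
  have hc' : ClassGroup.mk (congruentCurve F).FunctionField (XYIdeal' h ^ m * XYIdeal' h0) = 1 := by
    rw [map_mul, map_pow]
    exact hc
  obtain ⟨g, -, hg⟩ := (ClassGroup.mk_eq_one_of_coe_ideal
    (I' := XYIdeal (congruentCurve F) p (C q) ^ m * XYIdeal (congruentCurve F) 0 (C 0)) (by
      rw [Units.val_mul, Units.val_pow_eq_pow_val, XYIdeal'_eq, XYIdeal'_eq,
        FractionalIdeal.coeIdeal_mul, FractionalIdeal.coeIdeal_pow])).1 hc'
  exact ⟨g, hg⟩

theorem polynomial_congruentCurve (F : Type u) [Field F] :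
    (congruentCurve F).polynomial = X ^ 2 - C (X ^ 3 - X) := by
  simp only [WeierstrassCurve.Affine.polynomial, congruentCurve, C_0, zero_mul, add_zero, C_neg, C_1]
  ring_nf

theorem mk_X_sq : CoordinateRing.mk (congruentCurve F) X ^ 2 =
    CoordinateRing.mk _ (C (X ^ 3 - X)) := by
  rw [← map_pow]
  refine AdjoinRoot.mk_eq_mk.2 ⟨1, ?_⟩
  rw [polynomial_congruentCurve, mul_one]

/-- The hyperelliptic involution `y ↦ -y`. -/
def conj (F : Type u) [Field F] :
    (congruentCurve F).CoordinateRing →+* (congruentCurve F).CoordinateRing :=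
  AdjoinRoot.lift (AdjoinRoot.of _) (-AdjoinRoot.root _) (by
    have h := AdjoinRoot.eval₂_root (congruentCurve F).polynomial
    have he (t) : eval₂ (AdjoinRoot.of (congruentCurve F).polynomial) t (congruentCurve F).polynomial =
        t ^ 2 - AdjoinRoot.of _ (X ^ 3 - X) := by
      conv_lhs => enter [3]; rw [polynomial_congruentCurve]
      rw [eval₂_sub, eval₂_X_pow, eval₂_C]
    rw [he, neg_sq, ← he, h])

theorem conj_mk_C (f : F[X]) : conj F (CoordinateRing.mk _ (C f)) = CoordinateRing.mk _ (C f) :=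
  AdjoinRoot.lift_of _

theorem conj_mk_X : conj F (CoordinateRing.mk _ X) = -CoordinateRing.mk _ X := AdjoinRoot.lift_root _

theorem map_conj_XYIdeal (p q : F) : (XYIdeal (congruentCurve F) p (C q)).map (conj F) =
    XYIdeal (congruentCurve F) p (C ((congruentCurve F).negY p q)) := by
  have h₁ : conj F (XClass _ p) = XClass _ p := conj_mk_C _
  have h₂ : conj F (YClass _ (C q)) = -YClass _ (C (-q)) := by
    rw [YClass, YClass, map_sub, map_sub, conj_mk_C, conj_mk_X, map_sub, C_neg, C_neg, map_neg]
    ring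
  rw [XYIdeal, Ideal.map_span, Set.image_pair, XYIdeal, negY_congruentCurve, h₁, h₂,
    Ideal.span_insert, Ideal.span_insert, Ideal.span_singleton_neg]

theorem mul_conj (a b : F[X]) :
    (a • (1 : (congruentCurve F).CoordinateRing) + b • CoordinateRing.mk _ X) *
      conj F (a • (1 : (congruentCurve F).CoordinateRing) + b • CoordinateRing.mk _ X) =
      CoordinateRing.mk _ (C (a ^ 2 - (X ^ 3 - X) * b ^ 2)) := by
  rw [CoordinateRing.smul, CoordinateRing.smul, mul_one, map_add, map_mul, conj_mk_C, conj_mk_C,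
    conj_mk_X]
  simp only [map_sub, map_mul, map_pow]
  have := mk_X_sq (F := F)
  simp only [map_sub, map_pow] at this
  linear_combination -(CoordinateRing.mk (congruentCurve F) (C b)) ^ 2 * this

theorem dvd_of_mk_C_dvd {f g : F[X]}
    (h : CoordinateRing.mk (congruentCurve F) (C f) ∣ CoordinateRing.mk (congruentCurve F) (C g)) : f ∣ g := by
  obtain ⟨t, ht⟩ := h
  obtain ⟨a, b, rfl⟩ := exists_smul_basis_eq t
  have h0 : (g - f * a) • (1 : (congruentCurve F).CoordinateRing) + (-(f * b)) • CoordinateRing.mk _ X = 0 := by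
    simp only [CoordinateRing.smul, mul_one] at ht ⊢
    simp only [map_sub, map_mul, map_neg]
    rw [ht]
    ring
  exact ⟨a, by linear_combination (smul_basis_eq_zero h0).1⟩

/-- Multiply the ideal identity by its conjugate under `y ↦ -y`: the ideals of a point and of its
negative multiply to the ideal of `x - p`, and a generator times its conjugate is its norm. -/
theorem exists_norm_eq {p q : F} (h : (congruentCurve F).Nonsingular p q) (m : ℕ) (a b : F[X])
    (hg : XYIdeal (congruentCurve F) p (C q) ^ m * XYIdeal (congruentCurve F) 0 (C 0) =
      Ideal.span {a • (1 : (congruentCurve F).CoordinateRing) + b • CoordinateRing.mk _ X}) :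
    ∃ c : F, c ≠ 0 ∧ a ^ 2 - (X ^ 3 - X) * b ^ 2 = C c * ((X - C p) ^ m * X) := by
  have h0 : (congruentCurve F).Nonsingular 0 0 := nonsingular_congruentCurve (by ring)
  have hσ := congrArg (Ideal.map (conj F)) hg
  rw [Ideal.map_mul, Ideal.map_pow, map_conj_XYIdeal, map_conj_XYIdeal, Ideal.map_span,
    Set.image_singleton] at hσ
  have hmul := congrArg₂ (· * ·) hσ hg
  simp only [Ideal.span_singleton_mul_span_singleton] at hmul
  rw [mul_mul_mul_comm, ← mul_pow, XYIdeal_neg_mul h, XYIdeal_neg_mul h0, XIdeal, XIdeal,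
    Ideal.span_singleton_pow, Ideal.span_singleton_mul_span_singleton,
    mul_comm (conj F _), mul_conj, XClass, XClass, ← map_pow, ← map_mul, ← C_pow, ← C_mul, C_0,
    sub_zero] at hmul
  have hass := Ideal.span_singleton_eq_span_singleton.1 hmul
  obtain ⟨u, hu⟩ := associated_of_dvd_dvd (dvd_of_mk_C_dvd hass.dvd) (dvd_of_mk_C_dvd hass.dvd')
  obtain ⟨c, hc, hcu⟩ := Polynomial.isUnit_iff.1 u.isUnit
  refine ⟨c, hc.ne_zero, ?_⟩
  rw [← hu, ← hcu, mul_comm]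

/-- Evaluation of functions at a point of the curve. -/
def evalPoint (p q : F) (h : q ^ 2 = p ^ 3 - p) : (congruentCurve F).CoordinateRing →+* F :=
  AdjoinRoot.lift (evalRingHom p) q (by
    rw [polynomial_congruentCurve, eval₂_sub, eval₂_X_pow, eval₂_C, coe_evalRingHom, eval_sub,
      eval_pow, eval_X, h, sub_self])

theorem evalPoint_mk_C (p q : F) (h : q ^ 2 = p ^ 3 - p) (f : F[X]) :
    evalPoint p q h (CoordinateRing.mk _ (C f)) = f.eval p :=
  AdjoinRoot.lift_of _

theorem evalPoint_mk_X (p q : F) (h : q ^ 2 = p ^ 3 - p) : evalPoint p q h (CoordinateRing.mk _ X) = q :=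
  AdjoinRoot.lift_root _

/-- A multiple of `x - p` vanishes at `(p, -q)`, whereas `(y - q) ^ m y` lies in the ideal and does
not vanish there. -/
theorem not_dvd_generator {p q : F} (h : (congruentCurve F).Nonsingular p q) (hq : q ≠ 0) (m : ℕ)
    (g : (congruentCurve F).CoordinateRing)
    (hg : XYIdeal (congruentCurve F) p (C q) ^ m * XYIdeal (congruentCurve F) 0 (C 0) =
      Ideal.span {g}) : ¬ CoordinateRing.mk _ (C (X - C p)) ∣ g := by
  intro hd
  have hmem : CoordinateRing.mk (congruentCurve F) (X - C (C q)) ^ m * CoordinateRing.mk (congruentCurve F) (X - C (C 0)) ∈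
      Ideal.span {g} := by
    rw [← hg]
    exact Ideal.mul_mem_mul (Ideal.pow_mem_pow (Ideal.subset_span (by simp [YClass])) _)
      (Ideal.subset_span (by simp [YClass]))
  have hd' := hd.trans (Ideal.mem_span_singleton.1 hmem)
  have he : (-q) ^ 2 = p ^ 3 - p := by rw [neg_sq]; exact congruentCurve_equation h
  have := map_dvd (evalPoint p (-q) he) hd'
  rw [evalPoint_mk_C, eval_sub, eval_X, eval_C, sub_self, zero_dvd_iff, map_mul, map_pow, map_sub,
    map_sub, map_sub, map_sub, evalPoint_mk_C, evalPoint_mk_C, evalPoint_mk_X, eval_C, eval_C,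
    sub_zero] at this
  refine mul_ne_zero (pow_ne_zero _ ?_) (neg_ne_zero.2 hq) this
  intro h2
  exact hq (by linear_combination -2⁻¹ * h2)

theorem exists_polynomial_solution [IsAlgClosed F] (r : ℕ) (hr : r ≠ 0) :
    ∃ (p c : F) (a b : F[X]), p ^ 3 - p ≠ 0 ∧ c ≠ 0 ∧ 2 * a.natDegree + 2 ≤ 2 ^ r ∧
      2 * b.natDegree + 2 ≤ 2 ^ r ∧ b.eval p ≠ 0 ∧
      X * a ^ 2 - (X ^ 2 - 1) * b ^ 2 = C c * (X - C p) ^ 2 ^ r := by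
  classical
  obtain ⟨p, q, h, hq, hP⟩ := exists_division_point (F := F) r hr
  have hpq := congruentCurve_equation h
  have hp3 : p ^ 3 - p ≠ 0 := by
    rw [← hpq]
    exact pow_ne_zero 2 hq
  obtain ⟨g, hg⟩ := exists_span_eq_of_nsmul h _ hP
  obtain ⟨a', b, rfl⟩ := exists_smul_basis_eq g
  obtain ⟨c, hc, hN⟩ := exists_norm_eq h _ a' b hg
  -- Both `x³ - x` and the norm are divisible by `x`, so `x` divides `a'²`; one factor `x` can then
  -- be cancelled from the norm identity.
  have hdvd : (X : F[X]) ∣ a' := by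
    refine prime_X.dvd_of_dvd_pow (n := 2) ⟨(X ^ 2 - 1) * b ^ 2 + C c * (X - C p) ^ 2 ^ r, ?_⟩
    linear_combination hN
  obtain ⟨a, rfl⟩ := hdvd
  have hab : X * a ^ 2 - (X ^ 2 - 1) * b ^ 2 = C c * (X - C p) ^ 2 ^ r := by
    refine mul_left_cancel₀ (X_ne_zero (R := F)) ?_
    linear_combination hN
  obtain ⟨s, rfl⟩ := Nat.exists_eq_succ_of_ne_zero hr
  -- The norm has degree `2 ^ r + 1`, the maximum of `2 deg (x a)` and `2 deg b + 3`; parity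
  -- sharpens the resulting bound on `a`.
  have hdeg := degree_norm_smul_basis (W' := congruentCurve F) (X * a) b
  rw [norm_smul_basis] at hdeg
  have hN' : (X * a) ^ 2 - X * a * b * (C (congruentCurve F).a₁ * X + C (congruentCurve F).a₃) -
      b ^ 2 * (X ^ 3 + C (congruentCurve F).a₂ * X ^ 2 + C (congruentCurve F).a₄ * X +
        C (congruentCurve F).a₆) = C c * ((X - C p) ^ 2 ^ (s + 1) * X) := by
    rw [← hN]
    simp [congruentCurve]
    ring
  have hdN : (C c * ((X - C p) ^ 2 ^ (s + 1) * X)).degree = ((2 ^ (s + 1) + 1 : ℕ) : WithBot ℕ) := by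
    rw [degree_mul, degree_C hc, degree_mul, degree_pow, degree_X_sub_C, degree_X]
    simp
  rw [hN', hdN] at hdeg
  have h2 : 2 ^ (s + 1) = 2 * 2 ^ s := by rw [pow_succ, mul_comm]
  have hspos : 0 < 2 ^ s := by positivity
  refine ⟨p, c, a, b, hp3, hc, ?_, ?_, ?_, hab⟩
  · by_cases ha : a = 0
    · simp [ha]; omega
    · have h1 := le_max_left (2 • (X * a).degree) (2 • b.degree + 3)
      rw [← hdeg, degree_mul, degree_X, degree_eq_natDegree ha, nsmul_eq_mul] at h1
      have h3 : 2 * (1 + a.natDegree) ≤ 2 ^ (s + 1) + 1 := by exact_mod_cast h1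
      omega
  · by_cases hb : b = 0
    · simp [hb]; omega
    · have h1 := le_max_right (2 • (X * a).degree) (2 • b.degree + 3)
      rw [← hdeg, degree_eq_natDegree hb, nsmul_eq_mul] at h1
      have h3 : 2 * b.natDegree + 3 ≤ 2 ^ (s + 1) + 1 := by exact_mod_cast h1
      omega
  -- If `b(p) = 0`, the identity forces `a(p) = 0`, and `x - p` would divide the generator.
  · intro hb
    have he := congrArg (eval p) hab
    simp only [eval_sub, eval_mul, eval_pow, eval_X, eval_C, hb, sub_self] at he
    rw [zero_pow two_ne_zero, zero_pow (by positivity), mul_zero, mul_zero, sub_zero] at he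
    have hp : p ≠ 0 := by
      rintro rfl
      exact hp3 (by ring)
    have ha : a.eval p = 0 := pow_eq_zero_iff two_ne_zero |>.1 ((mul_eq_zero.1 he).resolve_left hp)
    refine not_dvd_generator h hq _ _ hg ?_
    obtain ⟨a₀, ha₀⟩ := dvd_iff_isRoot.2 ha
    obtain ⟨b₀, hb₀⟩ := dvd_iff_isRoot.2 hb
    refine ⟨(X * a₀) • 1 + b₀ • CoordinateRing.mk _ X, ?_⟩
    rw [ha₀, hb₀]
    simp only [CoordinateRing.smul, map_mul]
    ring

end Congruent

/-! ### A polynomial Pell equation -/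
section Pell
open Polynomial
variable {k : Type u} [Field k] [CharZero k]

/-- The quartic `x (1 + p x) (1 + (p + 1) x) (1 + (p - 1) x)`. -/
def quartic (p : k) : k[X] :=
  (X * (1 + C p * X)) * ((1 + C (p + 1) * X) * (1 + C (p - 1) * X))

/-- The equation `(w + p)³ - (w + p)` of the curve `y² = quartic p` near infinity. -/
def shiftedCubic (p : k) : k[X] := (X + C p) ^ 3 - (X + C p)

theorem separable_one_add_C_mul_X {a : k} (ha : a ≠ 0) : (1 + C a * X : k[X]).Separable := by
  refine ⟨0, C a⁻¹, ?_⟩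
  simp only [derivative_add, derivative_one, derivative_C_mul, derivative_X, mul_one, zero_mul,
    zero_add, ← C_mul, inv_mul_cancel₀ ha, C_1]

theorem isCoprime_X_one_add (a : k) : IsCoprime X (1 + C a * X : k[X]) := ⟨-C a, 1, by ring⟩

theorem isCoprime_one_add_one_add {a b : k} (h : a - b ≠ 0) :
    IsCoprime (1 + C a * X : k[X]) (1 + C b * X) := by
  refine ⟨-C ((a - b)⁻¹ * b), C ((a - b)⁻¹ * a), ?_⟩
  have : C (a - b)⁻¹ * (C a - C b) = (1 : k[X]) := by
    rw [← C_sub, ← C_mul, inv_mul_cancel₀ h, C_1]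
  rw [C_mul, C_mul]
  linear_combination this

theorem separable_quartic {p : k} (hp : p ^ 3 - p ≠ 0) : (quartic p).Separable := by
  have hp0 : p ≠ 0 := by rintro rfl; exact hp (by ring)
  have hp1 : p + 1 ≠ 0 := fun h ↦ hp (by linear_combination (p ^ 2 - p) * h)
  have hp2 : p - 1 ≠ 0 := fun h ↦ hp (by linear_combination (p ^ 2 + p) * h)
  refine Separable.mul (separable_X.mul (separable_one_add_C_mul_X hp0) (isCoprime_X_one_add _))
    ((separable_one_add_C_mul_X hp1).mul (separable_one_add_C_mul_X hp2)
      (isCoprime_one_add_one_add (by ring_nf; exact two_ne_zero))) ?_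
  refine IsCoprime.mul_left (IsCoprime.mul_right (isCoprime_X_one_add _) (isCoprime_X_one_add _))
    (IsCoprime.mul_right (isCoprime_one_add_one_add ?_) (isCoprime_one_add_one_add ?_))
  · ring_nf; exact neg_ne_zero.2 one_ne_zero
  · ring_nf; exact one_ne_zero

theorem separable_shiftedCubic (p : k) : (shiftedCubic p).Separable := by
  refine ⟨-9 * C 2⁻¹ * (X + C p), 3 * C 2⁻¹ * (X + C p) ^ 2 - 1, ?_⟩
  have h : C (2⁻¹ : k) * 2 = 1 := by
    rw [← map_ofNat C 2, ← C_mul, inv_mul_cancel₀ two_ne_zero, C_1]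
  simp only [shiftedCubic, derivative_sub, derivative_add, derivative_X_add_C_pow, derivative_X,
    derivative_C, Nat.cast_ofNat, map_ofNat]
  linear_combination (3 * (X + C p) ^ 2) * h

theorem natDegree_quartic_ne_zero {p : k} (hp : p ^ 3 - p ≠ 0) : (quartic p).natDegree ≠ 0 := by
  intro h
  have h0 : (quartic p).eval 0 = 0 := by simp [quartic]
  obtain ⟨a, ha⟩ := natDegree_eq_zero.1 h
  rw [← ha, eval_C] at h0
  exact (separable_quartic hp).ne_zero (by rw [← ha, h0, C_0])

theorem natDegree_shiftedCubic (p : k) : (shiftedCubic p).natDegree ≠ 0 := by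
  have : (shiftedCubic p).natDegree = 3 := by
    rw [shiftedCubic]
    compute_degree!
  omega

/-- Substitute `x = p + 1 / w` and multiply by `w ^ (2 l + 2)`: `taylor` is the translation and
`reflect` the inversion. The point `x = p` goes to infinity and the right side becomes constant. -/
theorem reflect_taylor_pell {p c : k} {a b : k[X]} {l : ℕ} (ha : a.natDegree ≤ l)
    (hb : b.natDegree ≤ l)
    (h : X * a ^ 2 - (X ^ 2 - 1) * b ^ 2 = C c * (X - C p) ^ (2 * l + 2)) :
    X * (1 + C p * X) * (reflect l (taylor p a)) ^ 2 -
      (1 + C (p + 1) * X) * (1 + C (p - 1) * X) * (reflect l (taylor p b)) ^ 2 = C c := by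
  have h₁ := congrArg (taylor p) h
  simp only [map_sub, taylor_mul, taylor_pow, taylor_X, taylor_one, taylor_C] at h₁
  have h₂ := congrArg (reflect (2 + (l + l))) h₁
  have hX : (X + C p : k[X]) - C p = X := by ring
  have ha' : (taylor p a).natDegree ≤ l := by rwa [natDegree_taylor]
  have hb' : (taylor p b).natDegree ≤ l := by rwa [natDegree_taylor]
  rw [hX, reflect_sub, pow_two (taylor p a), pow_two (taylor p b),
    reflect_mul _ _ (F := 2) (G := l + l) (by compute_degree!) (natDegree_mul_le_of_le ha' ha'),
    reflect_mul _ _ (F := 2) (G := l + l) (by compute_degree) (natDegree_mul_le_of_le hb' hb'),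
    reflect_mul _ _ ha' ha', reflect_mul _ _ hb' hb', reflect_C_mul_X_pow] at h₂
  have e₁ : reflect 2 (X + C p) = X * (1 + C p * X) := by
    rw [← pow_one (X : k[X]), reflect_add, reflect_monomial, reflect_C, revAt_le one_le_two]
    ring
  have e₂ : reflect 2 ((X + C p) ^ 2 - C 1) = (1 + C (p + 1) * X) * (1 + C (p - 1) * X) := by
    have : (X + C p) ^ 2 - C 1 = X ^ 2 + C (2 * p) * X ^ 1 + C (p ^ 2 - 1) := by
      rw [C_mul, C_sub, C_pow, map_ofNat]
      ring
    rw [this, reflect_add, reflect_add, reflect_monomial, reflect_C_mul_X_pow, reflect_C,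
      revAt_le one_le_two, revAt_le le_rfl]
    simp only [C_mul, C_sub, C_pow, C_add, map_ofNat, C_1]
    ring
  have e₃ : revAt (2 + (l + l)) (2 * l + 2) = 0 := by
    rw [revAt_le (by omega)]; omega
  rw [e₁, e₂, e₃, pow_zero, mul_one] at h₂
  linear_combination h₂

theorem rootMultiplicity_C_mul {k : Type u} [Field k] {a : k} (ha : a ≠ 0) (f : k[X]) (x : k) :
    (C a * f).rootMultiplicity x = f.rootMultiplicity x := by
  by_cases hf : f = 0
  · rw [hf, mul_zero]
  · rw [rootMultiplicity_mul (mul_ne_zero (C_ne_zero.2 ha) hf), rootMultiplicity_C, zero_add]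

theorem odd_rootMultiplicity {f g : k[X]} {x : k} (hf : f.Separable) (hx : f.eval x = 0)
    (hg : g ≠ 0) : Odd ((f * g ^ 2).rootMultiplicity x) := by
  have h1 : f.rootMultiplicity x = 1 :=
    le_antisymm (rootMultiplicity_le_one_of_separable hf x)
      ((rootMultiplicity_pos hf.ne_zero).2 hx)
  rw [rootMultiplicity_mul (mul_ne_zero hf.ne_zero (pow_ne_zero 2 hg)), h1, pow_two,
    rootMultiplicity_mul (mul_ne_zero hg hg)]
  exact ⟨g.rootMultiplicity x, by ring⟩

/-- From `D₁ a₁² - D₂ b₁² = c`, squaring `√D₁ a₁ + √D₂ b₁` and dividing by `c` gives `A + B √(D₁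
D₂)` of norm `1`. Moreover `A - 1` and `A + 1` are constants times `D₂ b₁²` and `D₁ a₁²`, and `D₁`,
`D₂` are separable, whence the odd multiplicities. -/
theorem exists_pell {p c : k} (hp : p ^ 3 - p ≠ 0) (hc : c ≠ 0) {a b : k[X]} {l : ℕ}
    (ha : a.natDegree ≤ l) (hb : b.natDegree ≤ l) (hbp : b.eval p ≠ 0)
    (h : X * a ^ 2 - (X ^ 2 - 1) * b ^ 2 = C c * (X - C p) ^ (2 * l + 2)) :
    ∃ A B : k[X], A ^ 2 - quartic p * B ^ 2 = 1 ∧ A.natDegree = 2 * l + 2 ∧ B.natDegree ≤ 2 * l ∧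
      (∃ α, Odd ((A - 1).rootMultiplicity α)) ∧ ∃ β, Odd ((A + 1).rootMultiplicity β) := by
  have hp0 : p ≠ 0 := by rintro rfl; exact hp (by ring)
  have hp1 : p + 1 ≠ 0 := fun h ↦ hp (by linear_combination (p ^ 2 - p) * h)
  have hp2 : p - 1 ≠ 0 := fun h ↦ hp (by linear_combination (p ^ 2 + p) * h)
  have key := reflect_taylor_pell ha hb h
  set a₁ := reflect l (taylor p a)
  set b₁ := reflect l (taylor p b) with hb₁
  set D₁ : k[X] := X * (1 + C p * X) with hD₁
  set D₂ : k[X] := (1 + C (p + 1) * X) * (1 + C (p - 1) * X) with hD₂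
  have hs₁ : D₁.Separable :=
    separable_X.mul (separable_one_add_C_mul_X hp0) (isCoprime_X_one_add _)
  have hs₂ : D₂.Separable := (separable_one_add_C_mul_X hp1).mul (separable_one_add_C_mul_X hp2)
    (isCoprime_one_add_one_add (by ring_nf; exact two_ne_zero))
  have hcC : C c⁻¹ * C c = (1 : k[X]) := by rw [← C_mul, inv_mul_cancel₀ hc, C_1]
  -- This coefficient is `b(p)`; its nonvanishing gives `A` the exact degree `2 l + 2`.
  have hbl : b₁.coeff l ≠ 0 := by
    rw [hb₁, coeff_reflect, revAt_le le_rfl, Nat.sub_self, taylor_coeff_zero]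
    exact hbp
  have hb0 : b₁ ≠ 0 := by rintro h; exact hbl (by rw [h, coeff_zero])
  have hal : a₁.natDegree ≤ l :=
    natDegree_reflect_le.trans (max_le le_rfl (by rwa [natDegree_taylor]))
  have hbl' : b₁.natDegree = l :=
    le_antisymm (natDegree_reflect_le.trans (max_le le_rfl (by rwa [natDegree_taylor])))
      (le_natDegree_of_ne_zero hbl)
  have hlin : ∀ {e : k}, e ≠ 0 → (1 + C e * X : k[X]).natDegree = 1 := fun {e} he ↦ by
    rw [add_comm]; exact natDegree_linear he
  have hT : (D₂ * b₁ ^ 2).natDegree = 2 * l + 2 := by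
    rw [natDegree_mul hs₂.ne_zero (pow_ne_zero 2 hb0), natDegree_pow, hbl', hD₂,
      natDegree_mul (separable_one_add_C_mul_X hp1).ne_zero
        (separable_one_add_C_mul_X hp2).ne_zero, hlin hp1, hlin hp2]
    ring
  have ha0 : a₁ ≠ 0 := by
    rintro h
    rw [h] at key
    have : (D₂ * b₁ ^ 2).natDegree = 0 := by
      have : D₂ * b₁ ^ 2 = C (-c) := by rw [C_neg]; linear_combination -key
      rw [this, natDegree_C]
    omega
  have h2c : 2 * c⁻¹ ≠ 0 := mul_ne_zero two_ne_zero (inv_ne_zero hc)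
  have hA : C c⁻¹ * (D₁ * a₁ ^ 2 + D₂ * b₁ ^ 2) - 1 = C (2 * c⁻¹) * (D₂ * b₁ ^ 2) := by
    rw [C_mul, map_ofNat]
    linear_combination C c⁻¹ * key + hcC
  have hA' : C c⁻¹ * (D₁ * a₁ ^ 2 + D₂ * b₁ ^ 2) + 1 = C (2 * c⁻¹) * (D₁ * a₁ ^ 2) := by
    rw [C_mul, map_ofNat]
    linear_combination -C c⁻¹ * key - hcC
  refine ⟨C c⁻¹ * (D₁ * a₁ ^ 2 + D₂ * b₁ ^ 2), C (2 * c⁻¹) * (a₁ * b₁), ?_, ?_, ?_, ?_, ?_⟩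
  · have : quartic p = D₁ * D₂ := rfl
    rw [this, C_mul, map_ofNat]
    linear_combination (C c⁻¹) ^ 2 * (D₁ * a₁ ^ 2 - D₂ * b₁ ^ 2 + C c) * key +
      (C c⁻¹ * C c + 1) * hcC
  · rw [← sub_add_cancel (C c⁻¹ * (D₁ * a₁ ^ 2 + D₂ * b₁ ^ 2)) 1, hA, ← C_1, natDegree_add_C,
      natDegree_C_mul h2c, hT]
  · refine (natDegree_C_mul_le _ _).trans ((natDegree_mul_le_of_le hal hbl'.le).trans_eq ?_)
    ring
  · refine ⟨-(p + 1)⁻¹, ?_⟩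
    rw [hA, rootMultiplicity_C_mul h2c]
    refine odd_rootMultiplicity hs₂ ?_ hb0
    simp [hD₂, hp1]
  · refine ⟨0, ?_⟩
    rw [hA', rootMultiplicity_C_mul h2c]
    refine odd_rootMultiplicity hs₁ ?_ ha0
    simp [hD₁]

end Pell

/-! ### Divisibility of the degree of a point -/
section Valuations
open Polynomial WithZero
variable {F : Type u} [Field F]

theorem valuation_eval_le_one (w : Valuation F ℤᵐ⁰) (A : F[X]) (hA : ∀ i, w (A.coeff i) ≤ 1) (x : F)
    (hx : w x ≤ 1) : w (A.eval x) ≤ 1 := by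
  rw [eval_eq_sum_range]
  refine w.map_sum_le fun i _ ↦ ?_
  rw [map_mul, map_pow]
  exact mul_le_one₀ (hA i) zero_le (pow_le_one₀ zero_le hx)

theorem valuation_eval_eq_pow (w : Valuation F ℤᵐ⁰) (A : F[X]) (hA : ∀ i, w (A.coeff i) ≤ 1)
    (hl : w A.leadingCoeff = 1) (x : F) (hx : 1 < w x) : w (A.eval x) = w x ^ A.natDegree := by
  have hx0 : w x ≠ 0 := (zero_lt_one.trans hx).ne'
  have htop : w (A.coeff A.natDegree * x ^ A.natDegree) = w x ^ A.natDegree := by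
    rw [map_mul, map_pow, coeff_natDegree, hl, one_mul]
  rw [eval_eq_sum_range, Finset.sum_range_succ, ← htop]
  refine Valuation.map_add_eq_of_lt_right w ?_
  rw [htop]
  refine w.map_sum_lt (pow_ne_zero _ hx0) fun i hi ↦ ?_
  rw [map_mul, map_pow]
  exact (mul_le_of_le_one_left' (hA i)).trans_lt (pow_lt_pow_right₀ hx (Finset.mem_range.1 hi))

theorem valuation_unit_eq_one_or (w : Valuation F ℤᵐ⁰) {f g : F} (hfg : f * g = 1) :
    (w f = 1 ∧ w (f + g) ≤ 1) ∨ (1 < w f ∧ w (f + g) = w f) ∨ (1 < w g ∧ w (f + g) = w g) := by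
  have h : w f * w g = 1 := by rw [← map_mul, hfg, map_one]
  have hg0 : w g ≠ 0 := by
    intro h0
    rw [h0, mul_zero] at h
    exact zero_ne_one h
  have hf : w f = (w g)⁻¹ := eq_inv_of_mul_eq_one_left h
  rcases lt_trichotomy (w g) 1 with hlt | heq | hgt
  · have : 1 < w f := by rw [hf]; exact one_lt_inv₀ (zero_lt_iff.2 hg0) |>.2 hlt
    exact .inr (.inl ⟨this, Valuation.map_add_eq_of_lt_left _ (hlt.trans this)⟩)
  · rw [heq, mul_one] at h
    exact .inl ⟨h, (Valuation.map_add _ _ _).trans (max_le h.le heq.le)⟩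
  · have : w f < 1 := by rw [hf]; exact inv_lt_one_of_one_lt₀ hgt
    exact .inr (.inr ⟨hgt, Valuation.map_add_eq_of_lt_right _ (this.trans hgt)⟩)

/-- Since `f g = 1`, the larger of `w f` and `w g` is read off from `w (f + g) = w (A(x))`. For
integral `x` this is at most `1`, and `f` is a unit; otherwise it is `w x ^ deg A`. -/
theorem exists_valuation_eq_pow (w : Valuation F ℤᵐ⁰) (A : F[X]) (hA : ∀ i, w (A.coeff i) ≤ 1)
    (hl : w A.leadingCoeff = 1) (h2 : w 2 = 1) (hn : A.natDegree ≠ 0) {f g x : F} (hfg : f * g = 1)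
    (hx : f + g = 2 * A.eval x) : ∃ u : ℤᵐ⁰, u ≠ 0 ∧ w f = u ^ A.natDegree := by
  have hw : w (f + g) = w (A.eval x) := by rw [hx, map_mul, h2, one_mul]
  rcases le_or_gt (w x) 1 with h | h
  · have := valuation_eval_le_one w A hA x h
    rw [← hw] at this
    refine ⟨1, one_ne_zero, ?_⟩
    rw [one_pow]
    rcases valuation_unit_eq_one_or w hfg with h' | h' | h'
    · exact h'.1
    · exact absurd (h'.1.trans_le (h'.2 ▸ this)) (lt_irrefl _)
    · exact absurd (h'.1.trans_le (h'.2 ▸ this)) (lt_irrefl _)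
  · have hx0 : w x ≠ 0 := (zero_lt_one.trans h).ne'
    rw [valuation_eval_eq_pow w A hA hl x h] at hw
    rcases valuation_unit_eq_one_or w hfg with h' | h' | h'
    · rw [hw] at h'
      exact absurd h'.2 (one_lt_pow₀ h hn).not_ge
    · exact ⟨w x, hx0, by rw [← h'.2, hw]⟩
    · refine ⟨(w x)⁻¹, inv_ne_zero hx0, ?_⟩
      rw [inv_pow, ← hw, h'.2]
      exact eq_inv_of_mul_eq_one_left (by rw [← map_mul, hfg, map_one])

theorem dvd_of_pow_eq_exp {n : ℕ} (hn : n ≠ 0) {s : ℤᵐ⁰} {e : ℕ} (h : s ^ n = exp (-(e : ℤ))) :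
    n ∣ e := by
  have hs : s ≠ 0 := by
    rintro rfl
    rw [zero_pow hn] at h
    exact exp_ne_zero h.symm
  rw [← exp_log hs, ← exp_nsmul, exp_inj] at h
  rw [nsmul_eq_mul] at h
  exact Int.natCast_dvd_natCast.1 ⟨-log s, by rw [mul_neg, h, neg_neg]⟩

end Valuations

/-! ### Ramification and the degree of a field with a point. -/

section NumberFields
open IsDedekindDomain NumberField
variable {k F : Type u} [Field k] [NumberField k] [Field F] [Algebra k F] [FiniteDimensional k F]

set_option linter.deprecated false in
-- The degree is the sum of `e f` over the primes above `v`, and each such prime gives a valuation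
-- restricting to the `e`-th power of that of `v`.
theorem dvd_finrank_of_dvd_ramificationIdx (v : HeightOneSpectrum (𝓞 k)) (n : ℕ)
    (h : ∀ (w : Valuation F (WithZero (Multiplicative ℤ))) (e : ℕ),
      (∀ x : k, w (algebraMap k F x) = v.valuation k x ^ e) → n ∣ e) :
    n ∣ Module.finrank k F := by
  have : NumberField F := NumberField.of_module_finite k F
  have := v.isMaximal
  rw [← Ideal.sum_ramification_inertia (𝓞 F) k F v.ne_bot]
  refine Finset.dvd_sum fun P hP ↦ Dvd.dvd.mul_right ?_ _
  rw [IsDedekindDomain.mem_primesOverFinset_iff v.ne_bot] at hP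
  obtain ⟨h₁, h₂⟩ := hP
  let w : HeightOneSpectrum (𝓞 F) := ⟨P, h₁, Ideal.ne_bot_of_liesOver_of_ne_bot v.ne_bot P⟩
  have : w.asIdeal.LiesOver v.asIdeal := h₂
  exact h (w.valuation F) _ fun x ↦ (HeightOneSpectrum.valuation_liesOver F v w x).symm

/-- In each case of `HasPoint`, `c` or `c⁻¹` times an element whose valuation is an `n`-th power is
itself an `n`-th power, so `n` divides the valuation of the uniformizer `c`, which is the
ramification index. -/
theorem dvd_finrank_of_hasPoint {K : Type u} [Field K] [Algebra k K] (d : CoverData k K)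
    (v : HeightOneSpectrum (𝓞 k)) (hA : ∀ i, v.valuation k (d.a.coeff i) ≤ 1)
    (hl : v.valuation k d.a.leadingCoeff = 1) (h2 : v.valuation k 2 = 1)
    (hdeg : d.a.natDegree = d.n) (ha₁ : d.a₁.eval 0 = d.a.leadingCoeff)
    (hc : v.valuation k d.c = WithZero.exp (-1)) (F : Type u) [Field F] [Algebra k F]
    (h : d.HasPoint F) : d.n ∣ Module.finrank k F := by
  -- An infinite extension has `finrank` zero, which every `n` divides.
  by_cases hfin : FiniteDimensional k F
  swap
  · rw [Module.finrank_of_not_finite hfin]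
    exact dvd_zero _
  refine dvd_finrank_of_dvd_ramificationIdx v d.n fun w e hw ↦ ?_
  have hwc : w (algebraMap k F d.c) = WithZero.exp (-(e : ℤ)) := by
    rw [hw, hc, ← WithZero.exp_nsmul, nsmul_eq_mul, mul_neg_one]
  have hwc' : w (algebraMap k F d.c⁻¹) = (WithZero.exp (-(e : ℤ)))⁻¹ := by
    rw [map_inv₀, map_inv₀, hwc]
  have hwl : w (algebraMap k F (2 * d.a₁.eval 0)) = 1 := by
    rw [hw, map_mul, h2, ha₁, hl, one_mul, one_pow]
  rcases h with ⟨x, y, z, hy, hz⟩ | ⟨z, hz⟩ | ⟨z, hz⟩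
  · have hfg : (Polynomial.aeval x d.a + Polynomial.aeval x d.b * y) *
        (Polynomial.aeval x d.a - Polynomial.aeval x d.b * y) = 1 := by
      have h := congrArg (Polynomial.aeval x) d.pell
      simp only [map_sub, map_mul, map_pow, map_one, ← hy] at h
      linear_combination h
    obtain ⟨u, hu0, hu⟩ := exists_valuation_eq_pow w (d.a.map (algebraMap k F)) (x := x)
      (fun i ↦ by
        rw [Polynomial.coeff_map, hw]
        exact pow_le_one' (hA i) e)
      (by rw [Polynomial.leadingCoeff_map, hw, hl, one_pow])
      (by rw [← map_ofNat (algebraMap k F) 2, hw, h2, one_pow])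
      (by rw [Polynomial.natDegree_map, hdeg]; exact d.n_ne_zero) hfg (by
        rw [Polynomial.eval_map_algebraMap]
        ring)
    rw [Polynomial.natDegree_map, hdeg] at hu
    have hz' := congrArg w hz
    rw [map_pow, map_mul, hwc, hu] at hz'
    refine dvd_of_pow_eq_exp d.n_ne_zero (s := w z * u⁻¹) ?_
    rw [mul_pow, hz', mul_assoc, ← mul_pow, mul_inv_cancel₀ hu0, one_pow, mul_one]
  · have hz' := congrArg w hz
    rw [map_pow, map_mul, map_mul, hwc, hwl, mul_one] at hz'
    exact dvd_of_pow_eq_exp d.n_ne_zero hz'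
  · have hz' := congrArg w hz
    rw [map_pow, map_mul, map_mul, hwc', hwl, mul_one] at hz'
    refine dvd_of_pow_eq_exp d.n_ne_zero (s := (w z)⁻¹) ?_
    rw [inv_pow, hz', inv_inv]

theorem infinite_heightOneSpectrum (k : Type u) [Field k] [NumberField k] :
    Infinite (HeightOneSpectrum (𝓞 k)) := by
  have key (l : Nat.Primes) : ∃ v : HeightOneSpectrum (𝓞 k),
      v.asIdeal.LiesOver (Ideal.span {(l : ℤ)}) := by
    have : (Ideal.span {((l : ℕ) : ℤ)}).IsPrime :=
      (Ideal.span_singleton_prime (by exact_mod_cast l.2.ne_zero)).2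
        (Nat.prime_iff_prime_int.1 l.2)
    obtain ⟨P, hP, hPl⟩ := (Ideal.span {((l : ℕ) : ℤ)}).nonempty_primesOver (S := 𝓞 k)
    have hb : (Ideal.span {((l : ℕ) : ℤ)}) ≠ ⊥ := by
      rw [Ne, Ideal.span_singleton_eq_bot]
      exact_mod_cast l.2.ne_zero
    exact ⟨⟨P, hP, Ideal.ne_bot_of_liesOver_of_ne_bot hb P⟩, hPl⟩
  choose f hf using key
  refine Infinite.of_injective f fun l m h ↦ ?_
  have h₁ := (hf l).over
  rw [h, ← (hf m).over, Ideal.span_singleton_eq_span_singleton, Int.associated_iff_natAbs] at h₁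
  exact Subtype.ext (by simpa using h₁)

/-- A nonzero element of a number field is a unit at all but finitely many primes. -/
theorem exists_prime_valuation_eq_one (k : Type u) [Field k] [NumberField k] (s : Finset k) :
    ∃ v : HeightOneSpectrum (𝓞 k), ∀ x ∈ s, x ≠ 0 → v.valuation k x = 1 := by
  have := infinite_heightOneSpectrum k
  have hfin : (⋃ x ∈ s, HeightOneSpectrum.Support (𝓞 k) x ∪
      HeightOneSpectrum.Support (𝓞 k) x⁻¹).Finite :=
    Set.Finite.biUnion s.finite_toSet fun x _ ↦
      (HeightOneSpectrum.Support.finite _ x).union (HeightOneSpectrum.Support.finite _ x⁻¹)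
  obtain ⟨v, hv⟩ := hfin.exists_notMem
  refine ⟨v, fun x hx hx0 ↦ ?_⟩
  simp only [Set.mem_iUnion, not_exists, Set.mem_union, not_or] at hv
  obtain ⟨h₁, h₂⟩ := hv x hx
  have h₁ : ¬ 1 < v.valuation k x := h₁
  have h₂ : ¬ 1 < v.valuation k x⁻¹ := h₂
  rw [map_inv₀] at h₂
  have hv0 : v.valuation k x ≠ 0 := (Valuation.ne_zero_iff _).2 hx0
  refine le_antisymm (not_lt.1 h₁) (not_lt.1 fun h ↦ h₂ ?_)
  exact (one_lt_inv₀ (zero_lt_iff.2 hv0)).2 h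

end NumberFields

/-! ### Genus one curves of large index -/
section Descent
open Polynomial

theorem exists_polynomial_lift {k E : Type u} [Field k] [Field E] [Algebra k E] (f : E[X])
    (hf : ∀ i, f.coeff i ∈ Set.range (algebraMap k E)) :
    ∃ g : k[X], g.map (algebraMap k E) = f :=
  (mem_lifts f).1 ((lifts_iff_coeff_lifts f).2 hf)

/-- Only finitely many algebraic numbers occur in the solution. A square root of `-1` is adjoined as
well, for the irreducibility of the cover. -/
theorem exists_numberField_solution (r : ℕ) (hr : r ≠ 0) :
    ∃ (k : Type) (_ : Field k) (_ : NumberField k) (p c : k) (a b : k[X]), (∃ i : k, i ^ 2 = -1) ∧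
      p ^ 3 - p ≠ 0 ∧ c ≠ 0 ∧ 2 * a.natDegree + 2 ≤ 2 ^ r ∧
      2 * b.natDegree + 2 ≤ 2 ^ r ∧ b.eval p ≠ 0 ∧
      X * a ^ 2 - (X ^ 2 - 1) * b ^ 2 = C c * (X - C p) ^ 2 ^ r := by
  classical
  obtain ⟨p, c, a, b, hp, hc, ha, hb, hbp, h⟩ :=
    exists_polynomial_solution (F := AlgebraicClosure ℚ) r hr
  obtain ⟨i, hi⟩ := IsAlgClosed.exists_pow_nat_eq (-1 : AlgebraicClosure ℚ) two_pos
  let S : Finset (AlgebraicClosure ℚ) := {p, c, i} ∪ (a.coeffs ∪ b.coeffs)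
  let k := IntermediateField.adjoin ℚ (S : Set (AlgebraicClosure ℚ))
  have hS : ∀ x ∈ S, x ∈ Set.range (algebraMap k (AlgebraicClosure ℚ)) := fun x hx ↦
    ⟨⟨x, IntermediateField.subset_adjoin ℚ _ hx⟩, rfl⟩
  have hcoeff : ∀ (f : (AlgebraicClosure ℚ)[X]), f.coeffs ⊆ S → ∀ i,
      f.coeff i ∈ Set.range (algebraMap k (AlgebraicClosure ℚ)) := fun f hf i ↦ by
    by_cases h0 : f.coeff i = 0
    · exact ⟨0, by rw [h0, map_zero]⟩
    · exact hS _ (hf (coeff_mem_coeffs h0))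
  have hfin : FiniteDimensional ℚ k := IntermediateField.finiteDimensional_adjoin
    fun x _ ↦ ((AlgebraicClosure.isAlgebraic ℚ).isAlgebraic x).isIntegral
  have hnf : NumberField k := ⟨⟩
  obtain ⟨p', hp'⟩ := hS p (by simp [S])
  obtain ⟨c', hc'⟩ := hS c (by simp [S])
  obtain ⟨i', hi'⟩ := hS i (by simp [S])
  obtain ⟨a', ha'⟩ := exists_polynomial_lift a (hcoeff a fun x hx ↦ by simp [S, hx])
  obtain ⟨b', hb'⟩ := exists_polynomial_lift b (hcoeff b fun x hx ↦ by simp [S, hx])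
  have hinj := (algebraMap k (AlgebraicClosure ℚ)).injective
  rw [← ha', natDegree_map] at ha
  rw [← hb', natDegree_map] at hb
  refine ⟨k, inferInstance, hnf, p', c', a', b', ⟨i', hinj ?_⟩, fun h0 ↦ hp ?_, fun h0 ↦ hc ?_,
    ha, hb, fun h0 ↦ hbp ?_, map_injective _ hinj ?_⟩
  · rw [map_pow, hi', hi, map_neg, map_one]
  · rw [← hp', ← map_pow, ← map_sub, h0, map_zero]
  · rw [← hc', h0, map_zero]
  · rw [← hb', ← hp', eval_map_apply, h0, map_zero]
  · simpa [ha', hb', hc', hp'] using h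

end Descent

/-! ### Assembly of the curves of large index. -/

section Construction
open Polynomial

theorem aeval_inv_reflect {k K : Type u} [Field k] [Field K] [Algebra k K] {x : K} (hx : x ≠ 0)
    {N : ℕ} {f : k[X]} (hf : f.natDegree ≤ N) : aeval x⁻¹ (reflect N f) * x ^ N = aeval x f := by
  let := invertibleOfNonzero hx
  have := eval₂_reflect_mul_pow (algebraMap k K) x N f hf
  rwa [invOf_eq_inv] at this

theorem aeval_inv_shiftedCubic {k K : Type u} [Field k] [Field K] [Algebra k K] {x : K} (hx : x ≠ 0)
    (p : k) : aeval x⁻¹ (shiftedCubic p) * x ^ 4 = aeval x (quartic p) := by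
  simp only [shiftedCubic, quartic, map_sub, map_add, map_mul, map_pow, aeval_X, aeval_C, map_one]
  field_simp
  ring

theorem aeval_inv_derivative_shiftedCubic {k K : Type u} [Field k] [Field K] [Algebra k K] {x : K}
    (hx : x ≠ 0) (p : k) : x ^ 2 * aeval x⁻¹ (derivative (shiftedCubic p)) =
      4 * x⁻¹ * aeval x (quartic p) - aeval x (derivative (quartic p)) := by
  simp only [shiftedCubic, quartic, derivative_mul, derivative_one, derivative_X_add_C_pow,
    derivative_X, derivative_C, Nat.reduceSub, map_sub, map_add, map_mul, map_pow, aeval_X,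
    aeval_C, map_one, map_zero, Nat.cast_ofNat, map_ofNat]
  field_simp
  ring

theorem exists_coverData {k : Type u} [Field k] [CharZero k] (hi : ∃ i : k, i ^ 2 = -1) {p : k}
    (hp : p ^ 3 - p ≠ 0) {A B : k[X]} (h : A ^ 2 - quartic p * B ^ 2 = 1) {r : ℕ}
    (hA : A.natDegree = 2 ^ r) (hB : B.natDegree + 2 ≤ 2 ^ r)
    (hα : ∃ α, Odd ((A - 1).rootMultiplicity α)) (hβ : ∃ β, Odd ((A + 1).rootMultiplicity β))
    {c : k} (hc : c ≠ 0) : ∃ (K : Type u) (_ : Field K) (_ : Algebra k K) (d : CoverData k K),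
      d.n = 2 ^ r ∧ d.a = A ∧ d.c = c ∧ d.a₁.eval 0 = A.leadingCoeff ∧
      ∀ (F : Type u) [Field F] [Algebra k F], IsDomain (K ⊗[k] F) := by
  obtain ⟨α, hα⟩ := hα
  obtain ⟨β, hβ⟩ := hβ
  obtain ⟨K, _, _, x, y, z, hx, hy, hz, hdom⟩ := exists_cover_field hi A B _ h c hc α β hα hβ r
  have hx0 : x ≠ 0 := by
    rintro rfl
    exact hx isAlgebraic_zero
  have hA0 : A ≠ 0 := by
    rintro rfl
    rw [natDegree_zero] at hA
    exact absurd hA.symm (by positivity)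
  have hev : (reflect (2 ^ r) A).eval 0 = A.leadingCoeff := by
    rw [← coeff_zero_eq_eval_zero, coeff_reflect, revAt_zero, leadingCoeff, hA]
  -- At infinity the coordinates are `1 / x` and `y / x²`; the factor `x²` is why `B` is reflected
  -- in degree `2 ^ r - 2` while `A` is reflected in degree `2 ^ r`.
  let d : CoverData k K :=
    { x := x, y := y, z := z, P := quartic p, P₁ := shiftedCubic p, a := A,
      a₁ := reflect (2 ^ r) A, b := B, b₁ := reflect (2 ^ r - 2) B, n := 2 ^ r, c := c
      transcendental := hx
      natDegree_ne_zero := natDegree_quartic_ne_zero hp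
      natDegree_ne_zero' := natDegree_shiftedCubic p
      separable := separable_quartic hp
      separable' := separable_shiftedCubic p
      n_ne_zero := by positivity
      c_ne_zero := hc
      y_sq := hy
      aeval_P₁ := aeval_inv_shiftedCubic hx0 p
      aeval_derivative := aeval_inv_derivative_shiftedCubic hx0 p
      z_pow := hz
      pell := h
      aeval_a₁ := aeval_inv_reflect hx0 hA.le
      aeval_b₁ := by
        have := aeval_inv_reflect hx0 (f := B) (N := 2 ^ r - 2) (by omega)
        rw [← this, mul_assoc, ← pow_add, Nat.sub_add_cancel (by omega)]
      eval_a₁ := by rw [hev]; exact leadingCoeff_ne_zero.2 hA0 }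
  exact ⟨K, inferInstance, inferInstance, d, rfl, rfl, rfl, hev, fun F _ _ ↦ hdom F⟩

theorem exists_genusOneCurve (r : ℕ) (hr : r ≠ 0) :
    ∃ (k : Type) (_ : Field k) (X : Scheme.{0}) (f : X ⟶ Spec (.of k)),
      GenusOneCurvesOverNumberFields k X f ∧ ∀ (F : Type) [Field F] [Algebra k F],
        (∃ s : Spec (.of F) ⟶ X, s ≫ f = Spec.map (CommRingCat.ofHom (algebraMap k F))) →
          2 ^ r ∣ Module.finrank k F := by
  classical
  obtain ⟨k, _, _, p, c, a, b, hi, hp, hc, ha, hb, hbp, h⟩ := exists_numberField_solution r hr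
  obtain ⟨s, rfl⟩ := Nat.exists_eq_succ_of_ne_zero hr
  have h2 : 2 ^ (s + 1) = 2 * (2 ^ s - 1) + 2 := by
    have : 0 < 2 ^ s := by positivity
    rw [pow_succ]
    omega
  obtain ⟨A, B, hAB, hA, hB, hα, hβ⟩ := exists_pell hp hc (a := a) (b := b) (l := 2 ^ s - 1)
    (by omega) (by omega) hbp (by rw [← h2]; exact h)
  -- The Pell solution has good reduction at `v`; the twisting constant is a uniformizer there,
  -- which forces total ramification in the divisibility argument.
  obtain ⟨v, hv⟩ := exists_prime_valuation_eq_one k (A.coeffs ∪ {2})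
  obtain ⟨π, hπ⟩ := v.valuation_exists_uniformizer k
  have hπ0 : π ≠ 0 := by
    rintro rfl
    rw [map_zero] at hπ
    exact WithZero.exp_ne_zero hπ.symm
  obtain ⟨K, _, _, d, hn, hda, hdc, hd₁, hdom⟩ :=
    exists_coverData hi hp hAB (by rw [hA, h2]) (by omega) hα hβ hπ0
  have hA0 : A ≠ 0 := by
    rintro rfl
    rw [natDegree_zero] at hA
    omega
  refine ⟨k, inferInstance, _, d.curveHom, ⟨inferInstance, d.isGenusOneCurve_curveHom hdom⟩,
    fun F _ _ ⟨t, ht⟩ ↦ ?_⟩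
  rw [← hn]
  refine dvd_finrank_of_hasPoint d v (fun i ↦ ?_) ?_ (hv 2 (by simp) two_ne_zero) ?_ ?_ ?_ F
    (d.hasPoint_of_spec t ht)
  · rw [hda]
    by_cases h0 : A.coeff i = 0
    · rw [h0, map_zero]
      exact zero_le
    · exact (hv _ (Finset.mem_union_left _ (coeff_mem_coeffs h0)) h0).le
  · rw [hda]
    have h0 := leadingCoeff_ne_zero.2 hA0
    exact hv _ (Finset.mem_union_left _ (coeff_mem_coeffs h0)) h0
  · rw [hda, hn, hA, h2]
  · rw [hd₁, hda]
  · rw [hdc, hπ]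

end Construction

end PotentialDensity

end

theorem proposition3p1 :
    ¬ PotentialDensity.UniformPotentialDensity.{0}
        PotentialDensity.GenusOneCurvesOverNumberFields.{0} ∧
      ∀ N : ℕ, ∃ (k : Type) (_ : Field k) (X : Scheme.{0}) (f : X ⟶ Spec (.of k)) (n : ℕ),
        PotentialDensity.GenusOneCurvesOverNumberFields k X f ∧
          PotentialDensity.HasIndex f n ∧ N ≤ n := by
  constructor
  · rintro ⟨d, hd⟩
    -- The exponent `d + 1` is nonzero and satisfies `2 ^ (d + 1) > d`, so no extension of degree at
    -- most `d` has a point.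
    obtain ⟨k, _, X, f, hf, h⟩ := PotentialDensity.exists_genusOneCurve (d + 1) d.succ_ne_zero
    obtain ⟨L, _, _, hfin, hL, hdense⟩ := hd k X f hf
    have := hf.2.geometricallyIntegral
    have hdvd := h L (PotentialDensity.exists_section_of_dense f L hdense)
    have := Nat.le_of_dvd Module.finrank_pos hdvd
    have : d + 1 < 2 ^ (d + 1) := Nat.lt_two_pow_self
    omega
  · intro N
    obtain ⟨k, _, X, f, hf, h⟩ := PotentialDensity.exists_genusOneCurve (N + 1) N.succ_ne_zero
    have := hf.2.isProper
    have := hf.2.geometricallyIntegral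
    have : IsIntegral (pullback f (Spec.map (CommRingCat.ofHom (algebraMap k k)))) := inferInstance
    have : Nonempty X := this.nonempty.map (pullback.fst f _)
    obtain ⟨n, hn, hle⟩ := PotentialDensity.exists_hasIndex f (2 ^ (N + 1)) h
    have : N + 1 < 2 ^ (N + 1) := Nat.lt_two_pow_self
    exact ⟨k, inferInstance, X, f, n, hf, hn, by omega⟩
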